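/- **Setting.** Let $n=n_0+n_1\ge 2$ nodes be given, the first $n_0$ of them ($N_0$) zeroth-order and the other $n_1$ ($N_1$) first-order, and let $d\ge 1$. Node $i$ has a data distribution $\mathcal D^i$ and a stochastic loss $F^i(x,\xi)$, $x\in\mathbb R^d$, with $F^i(x,\cdot)$ measurable and integrable; $f^i(x)=\mathbb E_{\xi\sim\mathcal D^i}F^i(x,\xi)$ is its local objective and $f=\frac1n\sum_{i=1}^n f^i$ the global objective (if each of the two groups holds one full copy of the data, i.e. $\frac1{n_0}\sum_{i\in N_0}f^i=\frac1{n_1}\sum_{i\in N_1}f^i$, this is the average loss over all data). Assume: 1. (Smoothness) $F^i(\cdot,\xi)$ is differentiable and $\|\nabla F^i(x,\xi)-\nabla F^i(y,\xi)\|\le L\|x-y\|$ for all $i,\xi,x,y$, where $L>0$. 2. (Balanced data) $\frac1{n_0}\sum_{i\in N_0}\|\nabla f^i(x)-\nabla f(x)\|^2\le\varsigma_0^2$ and $\frac1{n_1}\sum_{i\in N_1}\|\nabla f^i(x)-\nabla f(x)\|^2\le\varsigma_1^2$ for all $x$ (void for an empty group). 3. (Unbiasedness, bounded variance) $\mathbb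 E_\xi\nabla F^i(x,\xi)=\nabla f^i(x)$ and $\mathbb E_\xi\|\nabla F^i(x,\xi)-\nabla f^i(x)\|^2\le s_i^2$ for all $i,x$. Put $\sigma_0^2=\frac1{n_0}\sum_{i\in N_0}s_i^2$ and $\sigma_1^2=\frac1{n_1}\sum_{i\in N_1}s_i^2$ (the term of an empty group is $0$). **HDO algorithm.** All nodes start with the same model $X_0^i=\mu_0$. At each step a uniformly random pair of distinct nodes $i,j$ is chosen; both perform a local step $X^i\gets X^i-\eta G^i(X^i)$, $X^j\gets X^j-\eta G^j(X^j)$, and then both models are replaced by their average $(X^i+X^j)/2$. For $i\in N_1$, $G^i(x)=\nabla F^i(x,\xi)$; for $i\in N_0$, $G^i(x)=\frac{F^i(x+\nu u,\xi)-F^i(x,\xi)}{\nu}u$ with $\nu=\eta/\sqrt d$; here $\xi\sim\mathcal D^i$ and $u\sim N(0,I_d)$ are fresh and independent at every step. Let $X_t^i$ be the models after $t$ steps and $\mu_t=\frac1n\sum_iX_t^i$. **Theorem.** There are universal constants $C_0,C>0$ such that the following holds; in particular all expectations below exist. *Non-convex case.* Let $f$ be bounded below, $f^*=\inf f$, $\eta=\frac{n}{\sqrt{dT}}$,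 and $$T\ \ge\ C_0\max\Big\{\frac{L^2(dn_0+n_1)^2}{dn^2},\ n^2L^2,\ \frac{n^4L^2}{d},\ n\,n_0^3\,d\Big\}.$$ Then $$\frac1T\sum_{t=0}^{T-1}\mathbb E\|\nabla f(\mu_t)\|^2\le C\Big(f(\mu_0)-f^*+L\,\frac{dn_0\varsigma_0^2+n_1\varsigma_1^2}{nd}+L\,\frac{dn_0\sigma_0^2+n_1\sigma_1^2}{nd}+L^2\sqrt{\frac{n_0}{n}}\Big)\sqrt{\frac dT}.$$ *Strongly convex case.* Assume in addition that $f$ and all $f^i$ are strongly convex with parameter $\ell>0$, i.e. $\langle x-y,\nabla g(x)-\nabla g(y)\rangle\ge\ell\|x-y\|^2$ for $g=f$ and $g=f^i$. Let $x^*$ be the minimizer of $f$, let $T\ge2$ satisfy $$\frac{T}{\log T}\ \ge\ C_0\,\frac{n(d+n)(L+1)(\frac1\ell+1)}{\ell},$$ and let $\eta=\frac{4n\log T}{T\ell}$, $w_t=(1-\frac{\eta\ell}{2n})^{-t}$, $S_T=\sum_{t=1}^Tw_t$ and $y_T=\sum_{t=1}^T\frac{w_t}{S_T}\mu_{t-1}$.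 Then $$\mathbb E[f(y_T)-f(x^*)]+\frac{\ell\,\mathbb E\|\mu_T-x^*\|^2}{8}\le C\Big(\frac{L\|\mu_0-x^*\|^2}{T\log T}+\frac{\log T\,(dn_0\varsigma_0^2+n_1\varsigma_1^2)}{T\ell n}+\frac{\log T\,(dn_0\sigma_0^2+n_1\sigma_1^2)}{T\ell n}+\frac{\log T\,dn_0}{T\ell n}\Big).$$ -/

import Mathlib

open MeasureTheory ProbabilityTheory

universe u v

namespace HDO

/-- The parameter space `ℝ^d` with its Euclidean norm. -/
abbrev Vec (d : ℕ) : Type := EuclideanSpace ℝ (Fin d)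

/-- The data of a hybrid problem in dimension `d` with `n₀ + n₁` nodes: node `i` has a sample
space, a data distribution on it, and a stochastic loss `F i x ξ`. The nodes `i` with `i < n₀`
are the zeroth-order nodes, the remaining `n₁` nodes are the first-order nodes. -/
structure Problem (d n₀ n₁ : ℕ) where
  Sample : Fin (n₀ + n₁) → Type u
  [measurableSample : ∀ i, MeasurableSpace (Sample i)]
  law : ∀ i, Measure (Sample i)
  [isProbabilityMeasure_law : ∀ i, IsProbabilityMeasure (law i)]
  loss : ∀ i, Vec d → Sample i → ℝ

attribute [instance] Problem.measurableSample Problem.isProbabilityMeasure_law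

/-- The set `N₀` of zeroth-order nodes. -/
def zerothNodes (n₀ n₁ : ℕ) : Finset (Fin (n₀ + n₁)) :=
  Finset.univ.filter fun i => (i : ℕ) < n₀

/-- The set `N₁` of first-order nodes. -/
def firstNodes (n₀ n₁ : ℕ) : Finset (Fin (n₀ + n₁)) :=
  Finset.univ.filter fun i => n₀ ≤ (i : ℕ)

section

variable {d n₀ n₁ : ℕ} (P : Problem.{u} d n₀ n₁)

namespace Problem

/-- The local objective `fⁱ(x) = E_ξ[Fⁱ(x, ξ)]`. -/
noncomputable def localObj (i : Fin (n₀ + n₁)) (x : Vec d) : ℝ :=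
  ∫ ξ, P.loss i x ξ ∂(P.law i)

/-- The global objective: the average of the local objectives. When each of the two groups of
nodes holds one full copy of the data, this is the average loss over all data samples. -/
noncomputable def obj (x : Vec d) : ℝ :=
  (1 / ((n₀ + n₁ : ℕ) : ℝ)) * ∑ i, P.localObj i x

/-- The stochastic gradient `∇Fⁱ(x, ξ)` (gradient in `x`). -/
noncomputable def stochGrad (i : Fin (n₀ + n₁)) (x : Vec d) (ξ : P.Sample i) : Vec d :=
  gradient (fun z => P.loss i z ξ) x

/-- The stochastic losses are random variables with a finite mean, so that the local objectives
are well defined. -/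
structure WellDefined : Prop where
  measurable_loss : ∀ i x, Measurable (P.loss i x)
  integrable_loss : ∀ i x, Integrable (P.loss i x) (P.law i)

/-- All stochastic losses are differentiable with `L`-Lipschitz gradient. -/
structure Smooth (L : ℝ) : Prop where
  differentiable : ∀ i ξ, Differentiable ℝ fun x => P.loss i x ξ
  lipschitz : ∀ i ξ x y, ‖P.stochGrad i x ξ - P.stochGrad i y ξ‖ ≤ L * ‖x - y‖

/-- Balanced data distribution: in each of the two groups, the average squared deviation of the
local gradients from the global gradient is bounded. -/
structure Balanced (ς₀ ς₁ : ℝ) : Prop where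
  zerothOrder : ∀ x, (1 / (n₀ : ℝ)) *
    ∑ i ∈ zerothNodes n₀ n₁, ‖gradient (P.localObj i) x - gradient P.obj x‖ ^ 2 ≤ ς₀ ^ 2
  firstOrder : ∀ x, (1 / (n₁ : ℝ)) *
    ∑ i ∈ firstNodes n₀ n₁, ‖gradient (P.localObj i) x - gradient P.obj x‖ ^ 2 ≤ ς₁ ^ 2

/-- The stochastic gradients are square integrable, unbiased, and of variance at most `s i ^ 2`. -/
structure BoundedVariance (s : Fin (n₀ + n₁) → ℝ) : Prop where
  memLp : ∀ i x, MemLp (P.stochGrad i x) 2 (P.law i)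
  unbiased : ∀ i x, ∫ ξ, P.stochGrad i x ξ ∂(P.law i) = gradient (P.localObj i) x
  variance_le : ∀ i x,
    ∫ ξ, ‖P.stochGrad i x ξ - gradient (P.localObj i) x‖ ^ 2 ∂(P.law i) ≤ s i ^ 2

/-- Strong convexity with parameter `ℓ`, in the form of strong monotonicity of the gradient. -/
def StronglyConvex (ℓ : ℝ) (g : Vec d → ℝ) : Prop :=
  ∀ x y, ℓ * ‖x - y‖ ^ 2 ≤ inner ℝ (x - y) (gradient g x - gradient g y)

/-- The estimator `Gⁱ(x)` of node `i`, as a function of the sample `ξ` and the direction `u`: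
the two-point Gaussian smoothing estimator with parameter `ν` at a zeroth-order node, the
stochastic gradient at a first-order node. -/
noncomputable def estimator (ν : ℝ) (i : Fin (n₀ + n₁)) (x : Vec d) (ξ : P.Sample i)
    (u : Vec d) : Vec d :=
  if (i : ℕ) < n₀ then ((P.loss i (x + ν • u) ξ - P.loss i x ξ) / ν) • u
  else P.stochGrad i x ξ

/-- The randomness used in one interaction: the (ordered) pair of interacting nodes, and a sample
and a direction for every node (only those of the two interacting nodes are used). -/
abbrev Input : Type u :=
  (Fin (n₀ + n₁) × Fin (n₀ + n₁)) × ((∀ i, P.Sample i) × (Fin (n₀ + n₁) → Vec d))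

/-- The law of the randomness of one interaction: a uniformly random pair of distinct nodes,
samples `ξⁱ` from the data distributions, directions `uⁱ ∼ N(0, I_d)`, all independent. -/
noncomputable def inputLaw : Measure P.Input :=
  (uniformOn {p : Fin (n₀ + n₁) × Fin (n₀ + n₁) | p.1 ≠ p.2}).prod
    ((Measure.pi P.law).prod (Measure.pi fun _ => stdGaussian (Vec d)))

/-- The local step `Xⁱ - η Gⁱ(Xⁱ)` of node `i`. -/
noncomputable def localStep (η ν : ℝ) (w : P.Input) (X : Fin (n₀ + n₁) → Vec d)
    (i : Fin (n₀ + n₁)) : Vec d :=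
  X i - η • P.estimator ν i (X i) (w.2.1 i) (w.2.2 i)

/-- One interaction: the two chosen nodes perform a local step each and then both adopt the
average of their models; the other nodes keep their models. -/
noncomputable def interact (η ν : ℝ) (w : P.Input) (X : Fin (n₀ + n₁) → Vec d) :
    Fin (n₀ + n₁) → Vec d :=
  fun k => if k = w.1.1 ∨ k = w.1.2
    then (1 / 2 : ℝ) • (P.localStep η ν w X w.1.1 + P.localStep η ν w X w.1.2)
    else X k

/-- The models `X_t` of the HDO algorithm with learning rate `η` and smoothing parameter `ν`,
started with the model `x₀` at every node and driven by the sequence of inputs `w`. -/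
noncomputable def models (η ν : ℝ) (x₀ : Vec d) (w : ℕ → P.Input) :
    ℕ → Fin (n₀ + n₁) → Vec d
  | 0 => fun _ => x₀
  | t + 1 => P.interact η ν (w t) (models η ν x₀ w t)

/-- The mean model `μ_t = (1/n) ∑ᵢ X_tⁱ`. -/
noncomputable def meanModel (η ν : ℝ) (x₀ : Vec d) (w : ℕ → P.Input) (t : ℕ) : Vec d :=
  (1 / ((n₀ + n₁ : ℕ) : ℝ)) • ∑ i, P.models η ν x₀ w t i

/-- The weight `w_t = (1 - ηℓ/(2n))^(-t)`. -/
noncomputable def weight (n : ℕ) (η ℓ : ℝ) (t : ℕ) : ℝ :=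
  ((1 - η * ℓ / (2 * (n : ℝ))) ^ t)⁻¹

/-- The weighted average `y_T = ∑_{t=1}^T w_t μ_{t-1} / S_T`, where `S_T = ∑_{t=1}^T w_t`. -/
noncomputable def weightedMean (η ν ℓ : ℝ) (x₀ : Vec d) (w : ℕ → P.Input) (T : ℕ) : Vec d :=
  ∑ t ∈ Finset.Icc 1 T,
    (weight (n₀ + n₁) η ℓ t / ∑ r ∈ Finset.Icc 1 T, weight (n₀ + n₁) η ℓ r) •
      P.meanModel η ν x₀ w (t - 1)

/-- `W` is the randomness of a run of the algorithm: independent inputs, one per interaction,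
each with the law `inputLaw`. -/
structure IsInput {Ω : Type v} [MeasurableSpace Ω] (Pr : Measure Ω) (W : ℕ → Ω → P.Input) :
    Prop where
  measurable : ∀ t, Measurable (W t)
  indep : iIndepFun W Pr
  map_eq : ∀ t, Pr.map (W t) = P.inputLaw

end Problem

end

/-- `σ₀² = (1/n₀) ∑_{i ∈ N₀} sᵢ²`. -/
noncomputable def sigmaSqZeroth {n₀ n₁ : ℕ} (s : Fin (n₀ + n₁) → ℝ) : ℝ :=
  (1 / (n₀ : ℝ)) * ∑ i ∈ zerothNodes n₀ n₁, s i ^ 2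

/-- `σ₁² = (1/n₁) ∑_{i ∈ N₁} sᵢ²`. -/
noncomputable def sigmaSqFirst {n₀ n₁ : ℕ} (s : Fin (n₀ + n₁) → ℝ) : ℝ :=
  (1 / (n₁ : ℝ)) * ∑ i ∈ firstNodes n₀ n₁, s i ^ 2

end HDO

/-! Both rates come from a drift inequality for a Lyapunov function `φ (mean X) + κ * spread X`,
where `φ` is `f - f*` in the non-convex case and the squared distance to the minimizer in the
strongly convex case, and `spread` is the total squared deviation of the models from their mean.

Averaging a pair preserves the sum of the models, so an interaction moves the mean by `-(η/n)(Gⁱ +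
Gʲ)`. Averaged over the random pair, this is a descent step along the sum of the mean estimators.
The same averaging contracts the spread by `1 - 1/(2n)` in expectation, up to `η²` times second
moments of the estimators (`lintegral_lyapunov_interact_le`).

Stein's identity identifies the mean of a zeroth-order estimator as the gradient of the Gaussian
smoothing of `fⁱ` (`estMean_eq`), so its bias is at most `L * η` for `ν = η/√d`. Its second moment
costs a factor `d` compared with a stochastic gradient, plus a smoothing error (`estSq_le`).
Evaluating gradients at the models instead of at their mean costs a multiple of the spread
(`inner_gradient_sum_estMean_ge`, `inner_sub_sum_estMean_ge`).

The weight `κ` is chosen so that the contraction of the spread pays for every spread term produced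
in this way (`drift_algebra_nonconvex`, `drift_algebra_strongly_convex`). What remains is a drift `E
V(X_{t+1}) ≤ q E V(X_t) - E h(X_t) + K`, with `q = 1` or `q = 1 - ηℓ/(2n)`. It is integrated along
the Markov chain by `integrable_and_drift`, which also yields integrability, and summed, with
weights `q⁻ᵗ` in the second case. Since all models start equal, the initial spread is zero.
Inserting the step sizes gives the rates. -/

namespace HDO

/-! ### Smooth and strongly monotone gradients. -/

section Calculus

variable {E : Type*} [NormedAddCommGroup E] [InnerProductSpace ℝ E] [CompleteSpace E]

/-- A function with `L`-Lipschitz gradient deviates from its linearization at most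
quadratically. -/
theorem abs_sub_linearization_le {g : E → ℝ} {g' : E → E} {L : ℝ} (hL : 0 ≤ L)
    (hg : ∀ x, HasGradientAt g (g' x) x) (hLip : ∀ x y, ‖g' x - g' y‖ ≤ L * ‖x - y‖) (x y : E) :
    |g y - g x - inner ℝ (g' x) (y - x)| ≤ L * ‖y - x‖ ^ 2 := by
  have h := (convex_segment x y).norm_image_sub_le_of_norm_hasFDerivWithin_le'
    (f := g) (f' := fun z => InnerProductSpace.toDual ℝ E (g' z))
    (φ := InnerProductSpace.toDual ℝ E (g' x)) (C := L * ‖y - x‖)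
    (fun z _ => (hg z).hasFDerivAt.hasFDerivWithinAt) (fun z hz => by
      rw [← map_sub, LinearIsometryEquiv.norm_map]
      refine (hLip z x).trans (mul_le_mul_of_nonneg_left ?_ hL)
      obtain ⟨t, ht, rfl⟩ := segment_eq_image' ℝ x y ▸ hz
      rw [add_sub_cancel_left, norm_smul, Real.norm_eq_abs, abs_of_nonneg ht.1]
      exact mul_le_of_le_one_left (norm_nonneg _) ht.2)
    (left_mem_segment ℝ x y) (right_mem_segment ℝ x y)
  rw [InnerProductSpace.toDual_apply_apply, Real.norm_eq_abs] at h
  nlinarith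

/-- A quadratic remainder survives taking expectations, so this converse yields differentiability of
the local objectives without differentiating under the integral. -/
theorem hasGradientAt_of_abs_sub_linearization_le {g : E → ℝ} {v x : E} {L : ℝ}
    (h : ∀ y, |g y - g x - inner ℝ v (y - x)| ≤ L * ‖y - x‖ ^ 2) : HasGradientAt g v x := by
  rw [hasGradientAt_iff_hasFDerivAt, hasFDerivAt_iff_isLittleO]
  have h1 : (fun y => g y - g x - InnerProductSpace.toDual ℝ E v (y - x)) =O[nhds x]
      fun y => ‖y - x‖ ^ 2 := by
    refine Asymptotics.IsBigO.of_bound L (Filter.Eventually.of_forall fun y => ?_)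
    rw [InnerProductSpace.toDual_apply_apply, Real.norm_eq_abs, Real.norm_eq_abs,
      abs_of_nonneg (sq_nonneg ‖y - x‖)]
    exact h y
  exact h1.trans_isLittleO (Asymptotics.isLittleO_pow_sub_sub x one_lt_two)

/-- The gradient of a smooth function bounded below is controlled by the optimality gap. -/
theorem sq_norm_gradient_le {g : E → ℝ} {g' : E → E} {L m : ℝ} (hL : 0 < L)
    (hg : ∀ x, HasGradientAt g (g' x) x) (hLip : ∀ x y, ‖g' x - g' y‖ ≤ L * ‖x - y‖)
    (hm : ∀ x, m ≤ g x) (x : E) : ‖g' x‖ ^ 2 ≤ 4 * L * (g x - m) := by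
  -- The linearization bound has constant `L` rather than `L/2`, so the best gradient step has
  -- length `1/(2L)` and the final factor is `4L`.
  have h := (abs_le.1 (abs_sub_linearization_le hL.le hg hLip x (x - (1 / (2 * L)) • g' x))).2
  have h0 := hm (x - (1 / (2 * L)) • g' x)
  rw [sub_sub_cancel_left, inner_neg_right, norm_neg, inner_smul_right, real_inner_self_eq_norm_sq,
    norm_smul, Real.norm_of_nonneg (by positivity), mul_pow] at h
  have e : L * ((1 / (2 * L)) ^ 2 * ‖g' x‖ ^ 2) = 1 / (4 * L) * ‖g' x‖ ^ 2 := by field_simp; ring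
  have e' : 1 / (2 * L) * ‖g' x‖ ^ 2 = 2 * (1 / (4 * L) * ‖g' x‖ ^ 2) := by field_simp; ring
  have h2 : 1 / (4 * L) * ‖g' x‖ ^ 2 ≤ g x - m := by linarith
  have h3 : ‖g' x‖ ^ 2 = 4 * L * (1 / (4 * L) * ‖g' x‖ ^ 2) := by field_simp
  rw [h3]; exact mul_le_mul_of_nonneg_left h2 (by positivity)

/-- Strong monotonicity of the gradient gives the quadratic lower bound on the function. -/
theorem quadratic_lower_bound {g : E → ℝ} {g' : E → E} {ℓ : ℝ}
    (hg : ∀ x, HasGradientAt g (g' x) x)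
    (hmono : ∀ x y, ℓ * ‖x - y‖ ^ 2 ≤ inner ℝ (x - y) (g' x - g' y)) (x y : E) :
    g x + inner ℝ (g' x) (y - x) + ℓ / 2 * ‖y - x‖ ^ 2 ≤ g y := by
  set v := y - x with hv
  have hd : ∀ t : ℝ, HasDerivAt
      (fun t : ℝ => g (x + t • v) - t * inner ℝ (g' x) v - t ^ 2 * (ℓ / 2 * ‖v‖ ^ 2))
      (inner ℝ (g' (x + t • v)) v - inner ℝ (g' x) v - 2 * t * (ℓ / 2 * ‖v‖ ^ 2)) t := by
    intro t
    have h1 : HasDerivAt (fun t : ℝ => x + t • v) v t := by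
      simpa using ((hasDerivAt_id t).smul_const v).const_add x
    have h2 := (hg (x + t • v)).hasFDerivAt.comp_hasDerivAt t h1
    rw [InnerProductSpace.toDual_apply_apply] at h2
    have h3 : HasDerivAt (fun t : ℝ => t * inner ℝ (g' x) v) (inner ℝ (g' x) v) t := by
      simpa using (hasDerivAt_id t).mul_const (inner ℝ (g' x) v)
    have h4 : HasDerivAt (fun t : ℝ => t ^ 2 * (ℓ / 2 * ‖v‖ ^ 2)) (2 * t * (ℓ / 2 * ‖v‖ ^ 2)) t := by
      simpa using (hasDerivAt_pow 2 t).mul_const (ℓ / 2 * ‖v‖ ^ 2)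
    exact (h2.sub h3).sub h4
  -- Along the segment, `g` minus its tangent and minus the quadratic has nonnegative derivative:
  -- this is strong monotonicity at `x + t • v` and `x`, divided by `t > 0`.
  have hmon : MonotoneOn
      (fun t : ℝ => g (x + t • v) - t * inner ℝ (g' x) v - t ^ 2 * (ℓ / 2 * ‖v‖ ^ 2))
      (Set.Icc 0 1) := by
    refine monotoneOn_of_deriv_nonneg (convex_Icc 0 1)
      (fun t _ => (hd t).continuousAt.continuousWithinAt)
      (fun t _ => (hd t).differentiableAt.differentiableWithinAt) fun t ht => ?_
    rw [interior_Icc] at ht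
    rw [(hd t).deriv]
    have h := hmono (x + t • v) x
    rw [add_sub_cancel_left, inner_smul_left, norm_smul, Real.norm_of_nonneg ht.1.le,
      inner_sub_right, real_inner_comm, real_inner_comm _ v] at h
    simp only [conj_trivial] at h
    have h' : t * (ℓ * t * ‖v‖ ^ 2) ≤ t * (inner ℝ (g' (x + t • v)) v - inner ℝ (g' x) v) := by
      linarith
    have := le_of_mul_le_mul_left h' ht.1
    linarith
  have h := hmon (Set.left_mem_Icc.2 zero_le_one) (Set.right_mem_Icc.2 zero_le_one) zero_le_one
  simp only [zero_smul, add_zero, zero_mul, one_smul, one_mul, one_pow] at h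
  rw [hv, add_sub_cancel] at h
  rw [hv]
  norm_num at h
  linarith

end Calculus

end HDO

namespace HDO

/-! ### Gaussian moments and integration by parts. -/

section Gaussian

/-- The `p`-th absolute moment of the standard normal distribution. -/
noncomputable def gaussMoment (p : ℕ) : ℝ := ∫ x, |x| ^ p ∂(gaussianReal 0 1)

theorem gaussMoment_nonneg (p : ℕ) : 0 ≤ gaussMoment p :=
  integral_nonneg fun _ => pow_nonneg (abs_nonneg _) _

variable {d : ℕ}

/-- Both sides are centred Gaussians of variance `‖a‖ ^ 2`. This reduces moments of linear forms to
one-dimensional constants that do not depend on `d`. -/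
theorem map_inner_stdGaussian (a : Vec d) :
    (stdGaussian (Vec d)).map (fun u => inner ℝ a u) = (gaussianReal 0 1).map (fun x => ‖a‖ * x) := by
  have h := IsGaussian.map_eq_gaussianReal (μ := stdGaussian (Vec d)) (innerSL ℝ a)
  rw [integral_strongDual_stdGaussian, variance_dual_stdGaussian, innerSL_apply_norm] at h
  rw [gaussianReal_map_const_mul]
  simp only [mul_zero, mul_one]
  have e : (⟨‖a‖ ^ 2, sq_nonneg _⟩ : NNReal) = (‖a‖ ^ 2).toNNReal :=
    (Real.toNNReal_of_nonneg (sq_nonneg _)).symm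
  exact h.trans (by rw [← e]; rfl)

theorem integral_abs_inner_pow (a : Vec d) (p : ℕ) :
    ∫ u, |inner ℝ a u| ^ p ∂(stdGaussian (Vec d)) = ‖a‖ ^ p * gaussMoment p := by
  have h1 : ∫ u, |inner ℝ a u| ^ p ∂(stdGaussian (Vec d))
      = ∫ x, |x| ^ p ∂((stdGaussian (Vec d)).map (fun u => inner ℝ a u)) := by
    rw [integral_map (by fun_prop) (by fun_prop)]
  rw [h1, map_inner_stdGaussian, integral_map (by fun_prop) (by fun_prop), gaussMoment,
    ← integral_const_mul]
  simp [abs_mul, mul_pow]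

theorem integrable_norm_pow (p : ℕ) :
    Integrable (fun u => ‖u‖ ^ p) (stdGaussian (Vec d)) := by
  have h := (IsGaussian.memLp_id (stdGaussian (Vec d)) p (by simp)).integrable_norm_pow'
  simpa using h

theorem integrable_of_norm_le_pow {F : Type*} [NormedAddCommGroup F] {f : Vec d → F}
    (hf : AEStronglyMeasurable f (stdGaussian (Vec d))) (a b : ℝ) (p : ℕ)
    (h : ∀ u, ‖f u‖ ≤ a + b * ‖u‖ ^ p) : Integrable f (stdGaussian (Vec d)) :=
  ((integrable_const a).add ((integrable_norm_pow p).const_mul b)).mono' hf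
    (Filter.Eventually.of_forall h)

theorem integrable_abs_inner_pow (a : Vec d) (p : ℕ) :
    Integrable (fun u => |inner ℝ a u| ^ p) (stdGaussian (Vec d)) := by
  refine integrable_of_norm_le_pow (by fun_prop) 0 (‖a‖ ^ p) p fun u => ?_
  rw [zero_add, ← mul_pow, norm_pow, Real.norm_eq_abs, abs_abs]
  exact pow_le_pow_left₀ (abs_nonneg _) (abs_real_inner_le_norm a u) p

theorem gaussMoment_two : gaussMoment 2 = 1 := by
  have h := variance_id_gaussianReal (μ := 0) (v := 1)
  rw [variance_eq_integral (by fun_prop)] at h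
  simpa [gaussMoment, integral_id_gaussianReal] using h

theorem inner_single_eq (k : Fin d) (u : Vec d) :
    inner ℝ (EuclideanSpace.single k (1 : ℝ)) u = u k := by
  simp [EuclideanSpace.inner_single_left]

theorem integral_abs_coord_pow (k : Fin d) (p : ℕ) :
    ∫ u, |u k| ^ p ∂(stdGaussian (Vec d)) = gaussMoment p := by
  simpa [inner_single_eq] using integral_abs_inner_pow (EuclideanSpace.single k (1 : ℝ)) p

theorem integrable_abs_coord_pow (k : Fin d) (p : ℕ) :
    Integrable (fun u : Vec d => |u k| ^ p) (stdGaussian (Vec d)) := by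
  simpa [inner_single_eq] using integrable_abs_inner_pow (EuclideanSpace.single k (1 : ℝ)) p

theorem integral_sq_norm : ∫ u, ‖u‖ ^ 2 ∂(stdGaussian (Vec d)) = d := by
  simp_rw [EuclideanSpace.norm_sq_eq, Real.norm_eq_abs]
  rw [integral_finsetSum _ fun k _ => integrable_abs_coord_pow k 2]
  simp [integral_abs_coord_pow, gaussMoment_two, -sq_abs]

/-- The power mean inequality over the coordinates bounds `(∑ uₖ²)³` by `d² ∑ uₖ⁶`. -/
theorem integral_norm_pow_six_le :
    ∫ u, ‖u‖ ^ 6 ∂(stdGaussian (Vec d)) ≤ d ^ 3 * gaussMoment 6 := by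
  have h : ∀ u : Vec d, ‖u‖ ^ 6 ≤ (d : ℝ) ^ 2 * ∑ k, |u k| ^ 6 := by
    intro u
    have e : ‖u‖ ^ 6 = (∑ k, |u k| ^ 2) ^ 3 := by
      have := EuclideanSpace.norm_sq_eq u
      simp_rw [Real.norm_eq_abs] at this
      rw [← this]; ring
    rw [e]
    have h2 := pow_sum_le_card_mul_sum_pow (s := (Finset.univ : Finset (Fin d)))
      (f := fun k => |u k| ^ 2) (fun _ _ => by positivity) 2
    simpa [← pow_mul, -sq_abs] using h2
  calc ∫ u, ‖u‖ ^ 6 ∂(stdGaussian (Vec d))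
      ≤ ∫ u, (d : ℝ) ^ 2 * ∑ k, |u k| ^ 6 ∂(stdGaussian (Vec d)) :=
        integral_mono (integrable_norm_pow 6)
          ((integrable_finsetSum _ fun k _ => integrable_abs_coord_pow k 6).const_mul _) h
    _ = d ^ 3 * gaussMoment 6 := by
        rw [integral_const_mul, integral_finsetSum _ fun k _ => integrable_abs_coord_pow k 6]
        simp only [integral_abs_coord_pow, Finset.sum_const, Finset.card_univ, Fintype.card_fin,
          nsmul_eq_mul]
        ring

theorem integrable_inner_sq_mul_norm_sq (a : Vec d) :
    Integrable (fun u => inner ℝ a u ^ 2 * ‖u‖ ^ 2) (stdGaussian (Vec d)) := by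
  refine integrable_of_norm_le_pow (by fun_prop) 0 (‖a‖ ^ 2) 4 fun u => ?_
  rw [zero_add, norm_mul, norm_pow, norm_pow, norm_norm, Real.norm_eq_abs]
  have := pow_le_pow_left₀ (abs_nonneg _) (abs_real_inner_le_norm a u) 2
  nlinarith [sq_nonneg ‖u‖]

/-- Young's inequality is applied coordinate by coordinate, balanced by `‖a‖ ^ 2` so that both
fourth-moment terms have equal mean. The growth is linear in `d`; this is the price of a
zeroth-order node. -/
theorem integral_inner_sq_mul_norm_sq_le (a : Vec d) :
    ∫ u, inner ℝ a u ^ 2 * ‖u‖ ^ 2 ∂(stdGaussian (Vec d)) ≤ d * gaussMoment 4 * ‖a‖ ^ 2 := by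
  rcases eq_or_ne a 0 with rfl | ha
  · simp
  have ha' : 0 < ‖a‖ ^ 2 := by positivity
  have h : ∀ u : Vec d, inner ℝ a u ^ 2 * ‖u‖ ^ 2
      ≤ ∑ k, ((2 * ‖a‖ ^ 2)⁻¹ * |inner ℝ a u| ^ 4 + ‖a‖ ^ 2 / 2 * |u k| ^ 4) := by
    intro u
    rw [EuclideanSpace.norm_sq_eq, Finset.mul_sum]
    refine Finset.sum_le_sum fun k _ => ?_
    have e1 : |inner ℝ a u| ^ 4 = (inner ℝ a u ^ 2) ^ 2 := by
      rw [← sq_abs (inner ℝ a u)]; ring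
    have e2 : |u k| ^ 4 = (‖u k‖ ^ 2) ^ 2 := by rw [Real.norm_eq_abs]; ring
    rw [e1, e2]
    set p := inner ℝ a u ^ 2
    set q := ‖u k‖ ^ 2
    have : (2 * ‖a‖ ^ 2)⁻¹ * p ^ 2 + ‖a‖ ^ 2 / 2 * q ^ 2 - p * q
        = (2 * ‖a‖ ^ 2)⁻¹ * (p - ‖a‖ ^ 2 * q) ^ 2 := by field_simp; ring
    have : 0 ≤ (2 * ‖a‖ ^ 2)⁻¹ * (p - ‖a‖ ^ 2 * q) ^ 2 := by positivity
    linarith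
  have hi : ∀ k, Integrable (fun u : Vec d =>
      (2 * ‖a‖ ^ 2)⁻¹ * |inner ℝ a u| ^ 4 + ‖a‖ ^ 2 / 2 * |u k| ^ 4) (stdGaussian (Vec d)) :=
    fun k => ((integrable_abs_inner_pow a 4).const_mul _).add
      ((integrable_abs_coord_pow k 4).const_mul _)
  refine (integral_mono (integrable_inner_sq_mul_norm_sq a)
    (integrable_finsetSum _ fun k _ => hi k) h).trans (le_of_eq ?_)
  rw [integral_finsetSum _ fun k _ => hi k]
  have : ∀ k : Fin d, ∫ u, ((2 * ‖a‖ ^ 2)⁻¹ * |inner ℝ a u| ^ 4 + ‖a‖ ^ 2 / 2 * |u k| ^ 4)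
      ∂(stdGaussian (Vec d)) = ‖a‖ ^ 2 * gaussMoment 4 := by
    intro k
    rw [integral_add ((integrable_abs_inner_pow a 4).const_mul _)
      ((integrable_abs_coord_pow k 4).const_mul _), integral_const_mul, integral_const_mul,
      integral_abs_inner_pow, integral_abs_coord_pow]
    field_simp; ring
  simp only [this, Finset.sum_const, Finset.card_univ, Fintype.card_fin, nsmul_eq_mul]
  ring

/-- Gaussian integration by parts on the line. -/
theorem integral_mul_id_gaussianReal {g g' : ℝ → ℝ} (hg : ∀ x, HasDerivAt g (g' x) x)
    (h1 : Integrable g (gaussianReal 0 1)) (h2 : Integrable g' (gaussianReal 0 1))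
    (h3 : Integrable (fun x => g x * x) (gaussianReal 0 1)) :
    ∫ x, g x * x ∂(gaussianReal 0 1) = ∫ x, g' x ∂(gaussianReal 0 1) := by
  -- Everything is moved to Lebesgue measure with the density as a factor, whose derivative is `-x`
  -- times itself.
  have key : ∀ f : ℝ → ℝ, Integrable f (gaussianReal 0 1) →
      Integrable (fun x => f x * gaussianPDFReal 0 1 x) := by
    intro f hf
    rw [gaussianReal_of_var_ne_zero _ one_ne_zero,
      integrable_withDensity_iff_integrable_smul' (measurable_gaussianPDF 0 1)
        (Filter.Eventually.of_forall fun x => gaussianPDF_lt_top)] at hf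
    simpa [toReal_gaussianPDF, mul_comm] using hf
  have hpdf : ∀ x, HasDerivAt (gaussianPDFReal 0 1) (-(x * gaussianPDFReal 0 1 x)) x := by
    intro x
    have h : HasDerivAt (fun x : ℝ => -(x - 0) ^ 2 / (2 * ((1 : NNReal) : ℝ))) (-x) x := by
      refine (((((hasDerivAt_id x).sub_const 0).fun_pow 2).fun_neg.div_const
        (2 * ((1 : NNReal) : ℝ)))).congr_deriv ?_
      simp
      ring
    have h' := (h.exp.const_mul (√(2 * Real.pi * ((1 : NNReal) : ℝ)))⁻¹)
    rw [gaussianPDFReal_def]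
    exact h'.congr_deriv (by ring)
  have := integral_mul_deriv_eq_deriv_mul_of_integrable (u := g) (u' := g')
    (v := gaussianPDFReal 0 1) (v' := fun x => -(x * gaussianPDFReal 0 1 x))
    (fun x _ => hg x) (fun x _ => hpdf x) (by
      refine (key _ h3).neg.congr (Filter.Eventually.of_forall fun x => ?_)
      simp only [Pi.neg_apply, Pi.mul_apply]; ring) (key _ h2) (key _ h1)
  rw [integral_gaussianReal_eq_integral_smul one_ne_zero,
    integral_gaussianReal_eq_integral_smul one_ne_zero]
  simp only [smul_eq_mul]
  simp only [mul_neg, integral_neg, neg_inj] at this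
  calc ∫ x, gaussianPDFReal 0 1 x * (g x * x) = ∫ x, g x * (x * gaussianPDFReal 0 1 x) :=
        integral_congr_ae (Filter.Eventually.of_forall fun x => by ring)
    _ = ∫ x, g' x * gaussianPDFReal 0 1 x := this
    _ = _ := integral_congr_ae (Filter.Eventually.of_forall fun x => mul_comm _ _)

theorem integrable_comp_toLp_iff {F : Type*} [NormedAddCommGroup F] {f : Vec d → F} :
    Integrable (fun z : Fin d → ℝ => f (WithLp.toLp 2 z)) (Measure.pi fun _ => gaussianReal 0 1)
      ↔ Integrable f (stdGaussian (Vec d)) := by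
  rw [← map_pi_eq_stdGaussian]
  exact (MeasurableEquiv.toLp 2 (Fin d → ℝ)).measurableEmbedding.integrable_map_iff.symm

theorem integral_comp_toLp {F : Type*} [NormedAddCommGroup F] [NormedSpace ℝ F] (f : Vec d → F) :
    ∫ z : Fin d → ℝ, f (WithLp.toLp 2 z) ∂(Measure.pi fun _ => gaussianReal 0 1)
      = ∫ u, f u ∂(stdGaussian (Vec d)) := by
  rw [← map_pi_eq_stdGaussian]
  exact ((MeasurableEquiv.toLp 2 (Fin d → ℝ)).measurableEmbedding.integral_map _).symm

/-- Gaussian integration by parts in one coordinate. -/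
theorem integral_mul_coord_stdGaussian {g : Vec d → ℝ} {g' : Vec d → Vec d}
    (hg : ∀ x, HasGradientAt g (g' x) x) (h1 : Integrable g (stdGaussian (Vec d)))
    (k : Fin d) (h2 : Integrable (fun u => g' u k) (stdGaussian (Vec d)))
    (h3 : Integrable (fun u => g u * u k) (stdGaussian (Vec d))) :
    ∫ u, g u * u k ∂(stdGaussian (Vec d)) = ∫ u, g' u k ∂(stdGaussian (Vec d)) := by
  obtain _ | m := d
  · exact k.elim0
  -- Coordinate `k` is split off by Fubini. The slices are integrable only for almost every value of
  -- the other coordinates, which is enough.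
  have hmp := (measurePreserving_piFinSuccAbove
    (fun _ : Fin (m + 1) => gaussianReal 0 1) k).symm
  have toProd : ∀ f : Vec (m + 1) → ℝ, Integrable f (stdGaussian (Vec (m + 1))) →
      Integrable (fun p : ℝ × (Fin m → ℝ) => f (WithLp.toLp 2 (k.insertNth p.1 p.2)))
        ((gaussianReal 0 1).prod (Measure.pi fun _ => gaussianReal 0 1)) := by
    intro f hf
    exact (hmp.integrable_comp_emb (MeasurableEquiv.measurableEmbedding _)).2
      (integrable_comp_toLp_iff.2 hf)
  have intProd : ∀ f : Vec (m + 1) → ℝ, Integrable f (stdGaussian (Vec (m + 1))) →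
      ∫ u, f u ∂(stdGaussian (Vec (m + 1))) = ∫ z : Fin m → ℝ, ∫ x,
        f (WithLp.toLp 2 (k.insertNth x z)) ∂(gaussianReal 0 1)
          ∂(Measure.pi fun _ => gaussianReal 0 1) := by
    intro f hf
    rw [← integral_comp_toLp, ← hmp.integral_comp']
    exact integral_prod_symm _ (toProd f hf)
  rw [intProd _ h3, intProd _ h2]
  refine integral_congr_ae ?_
  filter_upwards [(toProd _ h1).prod_left_ae, (toProd _ h2).prod_left_ae,
    (toProd _ h3).prod_left_ae] with z z1 z2 z3
  have e : ∀ x : ℝ, (k.insertNth x z : Fin (m + 1) → ℝ) k = x := fun x => by simp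
  simp only [e] at z1 z2 z3 ⊢
  refine integral_mul_id_gaussianReal (fun x => ?_) z1 z2 z3
  have hline : HasDerivAt (fun x : ℝ => (WithLp.toLp 2 (k.insertNth x z) : Vec (m + 1)))
      (EuclideanSpace.single k 1) x := by
    have e2 : (fun x : ℝ => (WithLp.toLp 2 (k.insertNth x z) : Vec (m + 1)))
        = fun x => WithLp.toLp 2 (k.insertNth 0 z) + x • EuclideanSpace.single k (1 : ℝ) := by
      funext x
      ext j
      rcases Fin.eq_self_or_eq_succAbove k j with rfl | ⟨j, rfl⟩ <;> simp
    rw [e2]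
    simpa using ((hasDerivAt_id x).smul_const (EuclideanSpace.single k (1 : ℝ))).const_add
      (WithLp.toLp 2 (k.insertNth 0 z) : Vec (m + 1))
  have := (hg _).hasFDerivAt.comp_hasDerivAt x hline
  rw [InnerProductSpace.toDual_apply_apply, real_inner_comm, inner_single_eq] at this
  exact this

/-- Gaussian integration by parts (Stein's identity). -/
theorem integral_smul_stdGaussian {g : Vec d → ℝ} {g' : Vec d → Vec d}
    (hg : ∀ x, HasGradientAt g (g' x) x) (h1 : Integrable g (stdGaussian (Vec d)))
    (h2 : Integrable g' (stdGaussian (Vec d)))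
    (h3 : Integrable (fun u => g u • u) (stdGaussian (Vec d))) :
    ∫ u, g u • u ∂(stdGaussian (Vec d)) = ∫ u, g' u ∂(stdGaussian (Vec d)) := by
  ext k
  have e : ∀ f : Vec d → Vec d, Integrable f (stdGaussian (Vec d)) →
      (∫ u, f u ∂(stdGaussian (Vec d))) k = ∫ u, f u k ∂(stdGaussian (Vec d)) := fun f hf =>
    ((EuclideanSpace.proj k : Vec d →L[ℝ] ℝ).integral_comp_comm hf).symm
  have i : ∀ f : Vec d → Vec d, Integrable f (stdGaussian (Vec d)) →
      Integrable (fun u => f u k) (stdGaussian (Vec d)) := fun f hf =>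
    (EuclideanSpace.proj k : Vec d →L[ℝ] ℝ).integrable_comp hf
  rw [e _ h2, e _ h3]
  have := integral_mul_coord_stdGaussian hg h1 k (i _ h2) (by simpa using i _ h3)
  simpa using this

end Gaussian

end HDO

namespace HDO

/-! ### Regularity of the objectives and moments of the estimators. -/

namespace Problem

variable {d n₀ n₁ : ℕ} {P : Problem.{u} d n₀ n₁} {L : ℝ} {s : Fin (n₀ + n₁) → ℝ}

theorem Smooth.hasGradientAt_loss (hS : P.Smooth L) (i : Fin (n₀ + n₁)) (ξ : P.Sample i)
    (x : Vec d) : HasGradientAt (fun z => P.loss i z ξ) (P.stochGrad i x ξ) x :=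
  (hS.differentiable i ξ x).hasGradientAt

theorem Smooth.abs_loss_sub_le (hS : P.Smooth L) (hL : 0 ≤ L) (i : Fin (n₀ + n₁))
    (ξ : P.Sample i) (x y : Vec d) :
    |P.loss i y ξ - P.loss i x ξ - inner ℝ (P.stochGrad i x ξ) (y - x)| ≤ L * ‖y - x‖ ^ 2 :=
  abs_sub_linearization_le (g := fun z => P.loss i z ξ) hL
    (fun x => hS.hasGradientAt_loss i ξ x) (hS.lipschitz i ξ) x y

/-- The quadratic remainder bound of the sample losses is averaged over `ξ`; unbiasedness identifies
the averaged linear term. Thus `gradient (P.localObj i)` is a genuine gradient and not the default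
value. -/
theorem hasGradientAt_localObj (hP : P.WellDefined) (hS : P.Smooth L) (hV : P.BoundedVariance s)
    (hL : 0 ≤ L) (i : Fin (n₀ + n₁)) (x : Vec d) :
    HasGradientAt (P.localObj i) (gradient (P.localObj i) x) x := by
  have hg : Integrable (P.stochGrad i x) (P.law i) := (hV.memLp i x).integrable one_le_two
  refine hasGradientAt_of_abs_sub_linearization_le (L := L) fun y => ?_
  have hi : Integrable (fun ξ => inner ℝ (P.stochGrad i x ξ) (y - x)) (P.law i) :=
    hg.inner_const _
  have e : P.localObj i y - P.localObj i x - inner ℝ (gradient (P.localObj i) x) (y - x)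
      = ∫ ξ, (P.loss i y ξ - P.loss i x ξ - inner ℝ (P.stochGrad i x ξ) (y - x)) ∂(P.law i) := by
    have hd : Integrable (fun ξ => P.loss i y ξ - P.loss i x ξ) (P.law i) :=
      (hP.integrable_loss i y).sub (hP.integrable_loss i x)
    rw [integral_sub hd hi, integral_sub (hP.integrable_loss i y) (hP.integrable_loss i x), ← hV.unbiased i x,
      real_inner_comm, ← integral_inner hg]
    simp only [real_inner_comm, localObj]
  rw [e, ← Real.norm_eq_abs]
  refine (norm_integral_le_of_norm_le_const (C := L * ‖y - x‖ ^ 2)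
    (Filter.Eventually.of_forall fun ξ => hS.abs_loss_sub_le hL i ξ x y)).trans ?_
  simp

theorem norm_gradient_localObj_sub_le (hS : P.Smooth L) (hV : P.BoundedVariance s)
    (i : Fin (n₀ + n₁)) (x y : Vec d) :
    ‖gradient (P.localObj i) x - gradient (P.localObj i) y‖ ≤ L * ‖x - y‖ := by
  rw [← hV.unbiased, ← hV.unbiased, ← integral_sub ((hV.memLp i x).integrable one_le_two)
    ((hV.memLp i y).integrable one_le_two)]
  refine (norm_integral_le_of_norm_le_const (C := L * ‖x - y‖)
    (Filter.Eventually.of_forall fun ξ => hS.lipschitz i ξ x y)).trans ?_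
  simp

theorem gradient_obj (hP : P.WellDefined) (hS : P.Smooth L) (hV : P.BoundedVariance s)
    (hL : 0 ≤ L) (x : Vec d) :
    gradient P.obj x = (1 / ((n₀ + n₁ : ℕ) : ℝ)) • ∑ i, gradient (P.localObj i) x := by
  refine HasGradientAt.gradient ?_
  rw [hasGradientAt_iff_hasFDerivAt, map_smul, map_sum]
  exact (HasFDerivAt.fun_sum fun i _ =>
    (hasGradientAt_localObj hP hS hV hL i x).hasFDerivAt).const_mul _

theorem hasGradientAt_obj (hP : P.WellDefined) (hS : P.Smooth L) (hV : P.BoundedVariance s)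
    (hL : 0 ≤ L) (x : Vec d) : HasGradientAt P.obj (gradient P.obj x) x := by
  rw [gradient_obj hP hS hV hL, hasGradientAt_iff_hasFDerivAt, map_smul, map_sum]
  exact (HasFDerivAt.fun_sum fun i _ =>
    (hasGradientAt_localObj hP hS hV hL i x).hasFDerivAt).const_mul _

theorem norm_gradient_obj_sub_le (hP : P.WellDefined) (hS : P.Smooth L)
    (hV : P.BoundedVariance s) (hL : 0 ≤ L) (hn : 0 < n₀ + n₁) (x y : Vec d) :
    ‖gradient P.obj x - gradient P.obj y‖ ≤ L * ‖x - y‖ := by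
  have hn' : (0 : ℝ) < ((n₀ + n₁ : ℕ) : ℝ) := by exact_mod_cast hn
  rw [gradient_obj hP hS hV hL, gradient_obj hP hS hV hL, ← smul_sub, ← Finset.sum_sub_distrib,
    norm_smul, Real.norm_of_nonneg (by positivity)]
  have h : ‖∑ i, (gradient (P.localObj i) x - gradient (P.localObj i) y)‖
      ≤ ((n₀ + n₁ : ℕ) : ℝ) * (L * ‖x - y‖) := by
    refine (norm_sum_le _ _).trans
      ((Finset.sum_le_sum fun i _ => norm_gradient_localObj_sub_le hS hV i x y).trans ?_)
    simp
  calc _ ≤ 1 / ((n₀ + n₁ : ℕ) : ℝ) * (((n₀ + n₁ : ℕ) : ℝ) * (L * ‖x - y‖)) := by gcongr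
    _ = _ := by field_simp

/-! ### Measurability -/

theorem Smooth.continuous_stochGrad (hS : P.Smooth L) (i : Fin (n₀ + n₁)) (ξ : P.Sample i) :
    Continuous fun x => P.stochGrad i x ξ :=
  (LipschitzWith.of_dist_le_mul (K := L.toNNReal) fun x y => by
    rw [dist_eq_norm, dist_eq_norm]
    exact (hS.lipschitz i ξ x y).trans
      (mul_le_mul_of_nonneg_right (Real.le_coe_toNNReal L) (norm_nonneg _))).continuous

/-- A Carathéodory function, continuous in `x` and measurable in `ξ`, is jointly measurable. -/
theorem measurable_loss_uncurry (hP : P.WellDefined) (hS : P.Smooth L) (i : Fin (n₀ + n₁)) :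
    Measurable fun p : Vec d × P.Sample i => P.loss i p.1 p.2 :=
  measurable_uncurry_of_continuous_of_measurable (u := P.loss i)
    (fun ξ => (hS.differentiable i ξ).continuous) (hP.measurable_loss i)

/-- Each coordinate is the pointwise limit of difference quotients with increments `1/(m+1)`.
Genuine measurability, beyond the a.e. version in `MemLp`, is needed to run the chain. -/
theorem measurable_stochGrad (hP : P.WellDefined) (hS : P.Smooth L) (i : Fin (n₀ + n₁))
    (x : Vec d) : Measurable (P.stochGrad i x) := by
  have hcoord : ∀ k, Measurable fun ξ => P.stochGrad i x ξ k := by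
    intro k
    refine measurable_of_tendsto_metrizable (f := fun (m : ℕ) ξ =>
      ((m : ℝ) + 1) * (P.loss i (x + ((m : ℝ) + 1)⁻¹ • EuclideanSpace.single k (1 : ℝ)) ξ
        - P.loss i x ξ))
      (fun m => ((hP.measurable_loss i _).sub (hP.measurable_loss i _)).const_mul _) ?_
    rw [tendsto_pi_nhds]
    intro ξ
    have h := (hS.hasGradientAt_loss i ξ x).hasFDerivAt.hasLineDerivAt
      (EuclideanSpace.single k (1 : ℝ))
    rw [InnerProductSpace.toDual_apply_apply, real_inner_comm, inner_single_eq] at h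
    have h' := h.tendsto_slope_zero_right
    have hm : Filter.Tendsto (fun m : ℕ => ((m : ℝ) + 1)⁻¹) Filter.atTop (nhdsWithin 0 (Set.Ioi 0)) := by
      refine tendsto_nhdsWithin_iff.2 ⟨?_, Filter.Eventually.of_forall fun m => ?_⟩
      · simpa using tendsto_one_div_add_atTop_nhds_zero_nat (𝕜 := ℝ)
      · exact Set.mem_Ioi.2 (by positivity)
    have := h'.comp hm
    simpa [Function.comp_def] using this
  exact (MeasurableEquiv.toLp 2 (Fin d → ℝ)).measurable.comp (measurable_pi_lambda _ hcoord)

theorem measurable_stochGrad_uncurry (hP : P.WellDefined) (hS : P.Smooth L)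
    (i : Fin (n₀ + n₁)) : Measurable fun p : Vec d × P.Sample i => P.stochGrad i p.1 p.2 :=
  measurable_uncurry_of_continuous_of_measurable (u := P.stochGrad i)
    (fun ξ => hS.continuous_stochGrad i ξ) (measurable_stochGrad hP hS i)

theorem measurable_estimator (hP : P.WellDefined) (hS : P.Smooth L) (ν : ℝ)
    (i : Fin (n₀ + n₁)) :
    Measurable fun p : Vec d × (P.Sample i × Vec d) => P.estimator ν i p.1 p.2.1 p.2.2 := by
  unfold estimator
  split_ifs
  · have h1 : Measurable fun p : Vec d × (P.Sample i × Vec d) =>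
        P.loss i (p.1 + ν • p.2.2) p.2.1 :=
      (measurable_loss_uncurry hP hS i).comp (f := fun p : Vec d × (P.Sample i × Vec d) =>
        (p.1 + ν • p.2.2, p.2.1)) (by fun_prop)
    have h2 : Measurable fun p : Vec d × (P.Sample i × Vec d) => P.loss i p.1 p.2.1 :=
      (measurable_loss_uncurry hP hS i).comp (f := fun p : Vec d × (P.Sample i × Vec d) =>
        (p.1, p.2.1)) (by fun_prop)
    exact ((h1.sub h2).div_const ν).smul (by fun_prop)
  · exact (measurable_stochGrad_uncurry hP hS i).comp (f := fun p : Vec d × (P.Sample i × Vec d) =>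
        (p.1, p.2.1)) (by fun_prop)

/-! ### Moments of the gradient estimators -/

/-- The law of the sample and the direction used by node `i`. -/
noncomputable abbrev nodeLaw (P : Problem.{u} d n₀ n₁) (i : Fin (n₀ + n₁)) :
    Measure (P.Sample i × Vec d) :=
  (P.law i).prod (stdGaussian (Vec d))

/-- The mean of the estimator of node `i` at `x`. -/
noncomputable def estMean (P : Problem.{u} d n₀ n₁) (ν : ℝ) (i : Fin (n₀ + n₁)) (x : Vec d) :
    Vec d :=
  ∫ q, P.estimator ν i x q.1 q.2 ∂(P.nodeLaw i)

/-- The second moment of the estimator of node `i` at `x`. -/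
noncomputable def estSq (P : Problem.{u} d n₀ n₁) (ν : ℝ) (i : Fin (n₀ + n₁)) (x : Vec d) : ℝ :=
  ∫ q, ‖P.estimator ν i x q.1 q.2‖ ^ 2 ∂(P.nodeLaw i)

/-- The dimension factor `d` of a zeroth-order and `1` of a first-order node. -/
noncomputable def dimFactor (d n₀ n₁ : ℕ) (i : Fin (n₀ + n₁)) : ℝ := if (i : ℕ) < n₀ then d else 1

/-- The smoothing radius of node `i`, zero at a first-order node. -/
noncomputable def radius (n₀ n₁ : ℕ) (ν : ℝ) (i : Fin (n₀ + n₁)) : ℝ :=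
  if (i : ℕ) < n₀ then ν else 0

/-- The absolute constant in the second moment bound. -/
noncomputable def estConst : ℝ := 2 + 4 * gaussMoment 4 + 2 * gaussMoment 6

theorem integrable_sq_norm_stochGrad (hV : P.BoundedVariance s) (i : Fin (n₀ + n₁)) (x : Vec d) :
    Integrable (fun ξ => ‖P.stochGrad i x ξ‖ ^ 2) (P.law i) :=
  (hV.memLp i x).integrable_norm_pow two_ne_zero

theorem integral_sq_norm_stochGrad_le (hV : P.BoundedVariance s) (i : Fin (n₀ + n₁)) (x : Vec d) :
    ∫ ξ, ‖P.stochGrad i x ξ‖ ^ 2 ∂(P.law i)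
      ≤ 2 * (‖gradient (P.localObj i) x‖ ^ 2 + s i ^ 2) := by
  set v := gradient (P.localObj i) x
  have hi : Integrable (fun ξ => ‖P.stochGrad i x ξ - v‖ ^ 2) (P.law i) :=
    ((hV.memLp i x).sub (memLp_const v)).integrable_norm_pow two_ne_zero
  have h : ∀ ξ, ‖P.stochGrad i x ξ‖ ^ 2 ≤ 2 * ‖P.stochGrad i x ξ - v‖ ^ 2 + 2 * ‖v‖ ^ 2 := by
    intro ξ
    have := norm_add_le (P.stochGrad i x ξ - v) v
    rw [sub_add_cancel] at this
    nlinarith [norm_nonneg (P.stochGrad i x ξ), sq_nonneg (‖P.stochGrad i x ξ - v‖ - ‖v‖)]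
  refine (integral_mono (integrable_sq_norm_stochGrad hV i x)
    ((hi.const_mul 2).add (integrable_const _)) h).trans ?_
  rw [integral_add' (hi.const_mul 2) (integrable_const _), integral_const_mul, integral_const]
  have := hV.variance_le i x
  simp only [probReal_univ, one_smul]
  linarith

/-- The difference quotient differs from the directional derivative by at most `L ν ‖z‖²`, by
smoothness. -/
theorem estimator_zeroth_sq_le (hS : P.Smooth L) (hL : 0 ≤ L) {ν : ℝ} (hν : 0 < ν)
    {i : Fin (n₀ + n₁)} (hi : (i : ℕ) < n₀) (x : Vec d) (ξ : P.Sample i) (z : Vec d) :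
    ‖P.estimator ν i x ξ z‖ ^ 2
      ≤ 2 * (inner ℝ (P.stochGrad i x ξ) z ^ 2 * ‖z‖ ^ 2) + 2 * (L ^ 2 * ν ^ 2) * ‖z‖ ^ 6 := by
  rw [estimator, if_pos hi, norm_smul, mul_pow, Real.norm_eq_abs, sq_abs]
  have h := hS.abs_loss_sub_le hL i ξ x (x + ν • z)
  rw [add_sub_cancel_left, inner_smul_right, norm_smul, Real.norm_of_nonneg hν.le] at h
  set D := P.loss i (x + ν • z) ξ - P.loss i x ξ
  set a := inner ℝ (P.stochGrad i x ξ) z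
  have h1 : |D / ν - a| ≤ L * ν * ‖z‖ ^ 2 := by
    have e : D / ν - a = (D - ν * a) / ν := by field_simp
    rw [e, abs_div, abs_of_pos hν, div_le_iff₀ hν]
    linarith
  have h2 : (D / ν - a) ^ 2 ≤ (L * ν * ‖z‖ ^ 2) ^ 2 := by
    rw [← sq_abs]; exact pow_le_pow_left₀ (abs_nonneg _) h1 2
  have h3 : (D / ν) ^ 2 ≤ 2 * a ^ 2 + 2 * (L * ν * ‖z‖ ^ 2) ^ 2 := by
    nlinarith [sq_nonneg (D / ν - 2 * a)]
  calc (D / ν) ^ 2 * ‖z‖ ^ 2 ≤ (2 * a ^ 2 + 2 * (L * ν * ‖z‖ ^ 2) ^ 2) * ‖z‖ ^ 2 := by gcongr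
    _ = _ := by ring

theorem integrable_inner_stochGrad_sq (hP : P.WellDefined) (hS : P.Smooth L)
    (hV : P.BoundedVariance s) (i : Fin (n₀ + n₁)) (x : Vec d) :
    Integrable (fun q : P.Sample i × Vec d => inner ℝ (P.stochGrad i x q.1) q.2 ^ 2 * ‖q.2‖ ^ 2)
      (P.nodeLaw i) := by
  refine ((integrable_sq_norm_stochGrad hV i x).mul_prod (integrable_norm_pow 4)).mono' ?_
    (Filter.Eventually.of_forall fun q => ?_)
  · have h1 : Measurable fun q : P.Sample i × Vec d => P.stochGrad i x q.1 :=
      (measurable_stochGrad hP hS i x).comp measurable_fst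
    exact (((h1.inner measurable_snd).pow_const 2).mul
      (measurable_snd.norm.pow_const 2)).aestronglyMeasurable
  · rw [norm_mul, norm_pow, norm_pow, norm_norm, Real.norm_eq_abs]
    have := pow_le_pow_left₀ (abs_nonneg _) (abs_real_inner_le_norm (P.stochGrad i x q.1) q.2) 2
    nlinarith [sq_nonneg ‖q.2‖]

theorem integral_inner_stochGrad_sq_le (hP : P.WellDefined) (hS : P.Smooth L)
    (hV : P.BoundedVariance s) (i : Fin (n₀ + n₁)) (x : Vec d) :
    ∫ q, inner ℝ (P.stochGrad i x q.1) q.2 ^ 2 * ‖q.2‖ ^ 2 ∂(P.nodeLaw i)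
      ≤ d * gaussMoment 4 * (2 * (‖gradient (P.localObj i) x‖ ^ 2 + s i ^ 2)) := by
  have hi := integrable_inner_stochGrad_sq hP hS hV i x
  rw [integral_prod _ hi]
  refine (integral_mono hi.integral_prod_left
    ((integrable_sq_norm_stochGrad hV i x).const_mul (d * gaussMoment 4))
    fun ξ => integral_inner_sq_mul_norm_sq_le (P.stochGrad i x ξ)).trans ?_
  rw [integral_const_mul]
  exact mul_le_mul_of_nonneg_left (integral_sq_norm_stochGrad_le hV i x)
    (mul_nonneg (Nat.cast_nonneg _) (gaussMoment_nonneg 4))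

theorem aestronglyMeasurable_estimator (hP : P.WellDefined) (hS : P.Smooth L) (ν : ℝ)
    (i : Fin (n₀ + n₁)) (x : Vec d) :
    AEStronglyMeasurable (fun q => P.estimator ν i x q.1 q.2) (P.nodeLaw i) :=
  ((measurable_estimator hP hS ν i).comp (measurable_const.prodMk measurable_id)).aestronglyMeasurable
    (f := fun q : P.Sample i × Vec d => P.estimator ν i x q.1 q.2)

theorem memLp_estimator (hP : P.WellDefined) (hS : P.Smooth L) (hV : P.BoundedVariance s)
    (hL : 0 ≤ L) {ν : ℝ} (hν : 0 < ν) (i : Fin (n₀ + n₁)) (x : Vec d) :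
    MemLp (fun q => P.estimator ν i x q.1 q.2) 2 (P.nodeLaw i) := by
  have hm := aestronglyMeasurable_estimator hP hS ν i x
  by_cases hi : (i : ℕ) < n₀
  · rw [memLp_two_iff_integrable_sq_norm hm]
    refine (((integrable_inner_stochGrad_sq hP hS hV i x).const_mul 2).add
      (((integrable_norm_pow 6).comp_snd (P.law i)).const_mul (2 * (L ^ 2 * ν ^ 2)))).mono'
      (hm.norm.pow 2) (Filter.Eventually.of_forall fun q => ?_)
    rw [Real.norm_of_nonneg (by positivity)]
    exact estimator_zeroth_sq_le hS hL hν hi x q.1 q.2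
  · simp only [estimator, if_neg hi]
    exact (hV.memLp i x).comp_fst _

/-- In `estConst`, the summand `2` serves first-order nodes, `4 * gaussMoment 4` the directional
derivative and `2 * gaussMoment 6` the finite-difference error at zeroth-order nodes. -/
theorem estSq_le (hP : P.WellDefined) (hS : P.Smooth L) (hV : P.BoundedVariance s)
    (hL : 0 ≤ L) {ν : ℝ} (hν : 0 < ν) (i : Fin (n₀ + n₁)) (x : Vec d) :
    P.estSq ν i x ≤ estConst * (dimFactor d n₀ n₁ i *
      (‖gradient (P.localObj i) x‖ ^ 2 + s i ^ 2) + L ^ 2 * radius n₀ n₁ ν i ^ 2 * d ^ 3) := by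
  have h4 := gaussMoment_nonneg 4
  have h6 := gaussMoment_nonneg 6
  by_cases hi : (i : ℕ) < n₀
  · have i1 := (integrable_inner_stochGrad_sq hP hS hV i x).const_mul 2
    have i2 := ((integrable_norm_pow (d := d) 6).comp_snd (P.law i)).const_mul (2 * (L ^ 2 * ν ^ 2))
    have h := integral_mono ((memLp_estimator hP hS hV hL hν i x).integrable_norm_pow two_ne_zero)
      (i1.add i2) fun q => estimator_zeroth_sq_le hS hL hν hi x q.1 q.2
    have e : ∫ q : P.Sample i × Vec d, ‖q.2‖ ^ 6 ∂(P.nodeLaw i)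
        = ∫ z, ‖z‖ ^ 6 ∂(stdGaussian (Vec d)) := by
      rw [nodeLaw, integral_fun_snd (f := fun z : Vec d => ‖z‖ ^ 6)]; simp
    simp only [Pi.add_apply] at h
    rw [integral_add i1 i2, integral_const_mul, integral_const_mul, e] at h
    have hA := integral_inner_stochGrad_sq_le hP hS hV i x
    have hB := mul_le_mul_of_nonneg_left (integral_norm_pow_six_le (d := d))
      (show 0 ≤ 2 * (L ^ 2 * ν ^ 2) by positivity)
    simp only [dimFactor, radius, if_pos hi, estSq, estConst]
    refine h.trans ?_
    set A := ‖gradient (P.localObj i) x‖ ^ 2 + s i ^ 2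
    have hA0 : 0 ≤ A := by positivity
    have t1 : 0 ≤ d * A := by positivity
    have t2 : 0 ≤ L ^ 2 * ν ^ 2 * d ^ 3 := by positivity
    nlinarith [mul_nonneg h4 t2, mul_nonneg h6 t1]
  · simp only [dimFactor, radius, if_neg hi, estSq, estConst, estimator]
    rw [integral_fun_fst (f := fun ξ => ‖P.stochGrad i x ξ‖ ^ 2)]
    simp only [probReal_univ, one_smul]
    refine (integral_sq_norm_stochGrad_le hV i x).trans ?_
    set A := ‖gradient (P.localObj i) x‖ ^ 2 + s i ^ 2
    have hA0 : 0 ≤ A := by positivity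
    nlinarith [mul_nonneg h4 hA0, mul_nonneg h6 hA0]

theorem continuous_gradient_localObj (hS : P.Smooth L) (hV : P.BoundedVariance s)
    (i : Fin (n₀ + n₁)) : Continuous (gradient (P.localObj i)) :=
  (LipschitzWith.of_dist_le_mul (K := L.toNNReal) fun x y => by
    rw [dist_eq_norm, dist_eq_norm]
    exact (norm_gradient_localObj_sub_le hS hV i x y).trans
      (mul_le_mul_of_nonneg_right (Real.le_coe_toNNReal L) (norm_nonneg _))).continuous

theorem integrable_norm_stdGaussian : Integrable (fun z : Vec d => ‖z‖) (stdGaussian (Vec d)) := by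
  simpa using integrable_norm_pow (d := d) 1

theorem integrable_id_stdGaussian : Integrable (fun z : Vec d => z) (stdGaussian (Vec d)) :=
  (integrable_norm_iff (by fun_prop)).1 integrable_norm_stdGaussian

theorem integrable_gradient_localObj (hS : P.Smooth L) (hV : P.BoundedVariance s)
    (i : Fin (n₀ + n₁)) (x : Vec d) (r : ℝ) :
    Integrable (fun z => gradient (P.localObj i) (x + r • z)) (stdGaussian (Vec d)) := by
  have hc := continuous_gradient_localObj hS hV i
  refine integrable_of_norm_le_pow
    (hc.comp (by fun_prop : Continuous fun z : Vec d => x + r • z)).aestronglyMeasurable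
    ‖gradient (P.localObj i) x‖ (L * |r|) 1 fun z => ?_
  have h := norm_gradient_localObj_sub_le hS hV i (x + r • z) x
  rw [add_sub_cancel_left, norm_smul, Real.norm_eq_abs] at h
  have := norm_sub_norm_le (gradient (P.localObj i) (x + r • z)) (gradient (P.localObj i) x)
  rw [pow_one]
  linarith

/-- The estimators are unbiased for the gradients of the smoothed local objectives. -/
theorem estMean_eq (hP : P.WellDefined) (hS : P.Smooth L) (hV : P.BoundedVariance s)
    (hL : 0 ≤ L) {ν : ℝ} (hν : 0 < ν) (i : Fin (n₀ + n₁)) (x : Vec d) :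
    P.estMean ν i x
      = ∫ z, gradient (P.localObj i) (x + radius n₀ n₁ ν i • z) ∂(stdGaussian (Vec d)) := by
  by_cases hi : (i : ℕ) < n₀
  · have hint : Integrable (fun q => P.estimator ν i x q.1 q.2) (P.nodeLaw i) :=
      (memLp_estimator hP hS hV hL hν i x).integrable one_le_two
    have hint' := hint.integral_prod_right
    rw [estMean, integral_prod_symm _ hint]
    simp only [estimator, if_pos hi, radius] at hint' ⊢
    -- Integrating out the sample first leaves the difference quotient of `fⁱ` times `z`. Stein's
    -- identity then applies, because the gradient of that quotient in `z` is the gradient of `fⁱ`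
    -- at `x + ν • z`.
    have e : ∀ z, ∫ ξ, ((P.loss i (x + ν • z) ξ - P.loss i x ξ) / ν) • z ∂(P.law i)
        = ((P.localObj i (x + ν • z) - P.localObj i x) / ν) • z := by
      intro z
      rw [integral_smul_const, integral_div, integral_sub (hP.integrable_loss i _)
        (hP.integrable_loss i _)]
      rfl
    simp only [e] at hint' ⊢
    have hgrad := hasGradientAt_localObj hP hS hV hL i
    refine integral_smul_stdGaussian (fun z => ?_) ?_ (integrable_gradient_localObj hS hV i x ν) hint'
    · have h1 : HasFDerivAt (fun z : Vec d => x + ν • z) (ν • ContinuousLinearMap.id ℝ (Vec d)) z :=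
        ((hasFDerivAt_id z).const_smul ν).const_add x
      have h2 := (((hgrad (x + ν • z)).hasFDerivAt.comp z h1).sub_const
        (P.localObj i x)).mul_const ν⁻¹
      rw [hasGradientAt_iff_hasFDerivAt]
      simp only [Function.comp_def, ← div_eq_mul_inv] at h2
      refine h2.congr_fderiv ?_
      ext y
      simp [hν.ne']
    · have hc : Continuous (P.localObj i) :=
        continuous_iff_continuousAt.2 fun y => (hgrad y).continuousAt
      refine Integrable.div_const (Integrable.sub ?_ (integrable_const _)) ν
      refine integrable_of_norm_le_pow
        (hc.comp (by fun_prop : Continuous fun z : Vec d => x + ν • z)).aestronglyMeasurable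
        (|P.localObj i x| + ‖gradient (P.localObj i) x‖ * ν)
        (‖gradient (P.localObj i) x‖ * ν + L * ν ^ 2) 2 fun z => ?_
      have h := abs_sub_linearization_le hL hgrad (norm_gradient_localObj_sub_le hS hV i) x
        (x + ν • z)
      rw [add_sub_cancel_left, inner_smul_right, norm_smul, Real.norm_of_nonneg hν.le] at h
      have hb := abs_real_inner_le_norm (gradient (P.localObj i) x) z
      have hz : ‖z‖ ≤ 1 + ‖z‖ ^ 2 := by nlinarith [sq_nonneg (‖z‖ - 1)]
      have hc : ν * |inner ℝ (gradient (P.localObj i) x) z|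
          ≤ ν * (‖gradient (P.localObj i) x‖ * (1 + ‖z‖ ^ 2)) :=
        mul_le_mul_of_nonneg_left (hb.trans (mul_le_mul_of_nonneg_left hz (norm_nonneg _))) hν.le
      rw [← abs_of_pos hν, ← abs_mul, abs_of_pos hν] at hc
      rw [Real.norm_eq_abs]
      have t1 := abs_le.1 h
      have t2 := abs_le.1 hc
      have t3 := neg_abs_le (P.localObj i x)
      have t4 := le_abs_self (P.localObj i x)
      rw [abs_le]
      constructor <;> nlinarith
  · simp only [estMean, estimator, if_neg hi, radius, zero_smul, add_zero]
    rw [integral_fun_fst, hV.unbiased]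
    simp

/-- The bias averages gradient differences over displacements `r z`. The bound `‖z‖ ≤ √d/2 +
‖z‖²/(2√d)` has mean exactly `√d` on its right side. -/
theorem norm_estMean_sub_le (hP : P.WellDefined) (hS : P.Smooth L) (hV : P.BoundedVariance s)
    (hL : 0 ≤ L) {ν : ℝ} (hν : 0 < ν) (hd : 1 ≤ d) (i : Fin (n₀ + n₁)) (x : Vec d) :
    ‖P.estMean ν i x - gradient (P.localObj i) x‖ ≤ L * (radius n₀ n₁ ν i * √d) := by
  have hr : 0 ≤ radius n₀ n₁ ν i := by unfold radius; split_ifs <;> linarith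
  have hd' : (0 : ℝ) < √d := Real.sqrt_pos.2 (by exact_mod_cast hd)
  have hg := integrable_gradient_localObj hS hV i x (radius n₀ n₁ ν i)
  have e : P.estMean ν i x - gradient (P.localObj i) x
      = ∫ z, (gradient (P.localObj i) (x + radius n₀ n₁ ν i • z) - gradient (P.localObj i) x)
        ∂(stdGaussian (Vec d)) := by
    rw [integral_sub hg (integrable_const _), estMean_eq hP hS hV hL hν]
    simp
  rw [e]
  have hb : Integrable (fun z : Vec d => L * radius n₀ n₁ ν i * (√d / 2 + ‖z‖ ^ 2 / (2 * √d)))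
      (stdGaussian (Vec d)) :=
    (((integrable_const _).add ((integrable_norm_pow 2).div_const _))).const_mul _
  refine (norm_integral_le_of_norm_le hb (Filter.Eventually.of_forall fun z => ?_)).trans
    (le_of_eq ?_)
  · have h := norm_gradient_localObj_sub_le hS hV i (x + radius n₀ n₁ ν i • z) x
    rw [add_sub_cancel_left, norm_smul, Real.norm_of_nonneg hr, ← mul_assoc] at h
    refine h.trans (mul_le_mul_of_nonneg_left ?_ (mul_nonneg hL hr))
    have : √d / 2 + ‖z‖ ^ 2 / (2 * √d) - ‖z‖ = (√d - ‖z‖) ^ 2 / (2 * √d) := by field_simp; ring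
    have : 0 ≤ (√d - ‖z‖) ^ 2 / (2 * √d) := by positivity
    linarith
  · rw [integral_const_mul, integral_add (integrable_const _) ((integrable_norm_pow 2).div_const _),
      integral_div (2 * √d), integral_sq_norm]
    simp only [integral_const, probReal_univ, one_smul]
    have : (d : ℝ) = √d ^ 2 := (Real.sq_sqrt (Nat.cast_nonneg _)).symm
    have : (d : ℝ) / (2 * √d) = √d / 2 := by rw [div_eq_div_iff (by positivity) two_ne_zero]; nlinarith
    rw [this]; ring

/-- Strong convexity and smoothness give a one-point lower bound for the mean of the estimator at
`x` along the segment from `y` to `v`. -/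
theorem inner_estMean_ge (hP : P.WellDefined) (hS : P.Smooth L) (hV : P.BoundedVariance s)
    (hL : 0 ≤ L) {ν ℓ : ℝ} (hν : 0 < ν) (hℓ : 0 ≤ ℓ) (i : Fin (n₀ + n₁))
    (hc : StronglyConvex ℓ (P.localObj i)) (x v y : Vec d) :
    P.localObj i v - P.localObj i y + ℓ / 2 * ‖x - y‖ ^ 2 - L * ‖x - v‖ ^ 2
        - L * (radius n₀ n₁ ν i ^ 2 * d)
      ≤ inner ℝ (v - y) (P.estMean ν i x) := by
  set r := radius n₀ n₁ ν i
  have hgrad := hasGradientAt_localObj hP hS hV hL i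
  have hg := integrable_gradient_localObj hS hV i x r
  rw [estMean_eq hP hS hV hL hν, ← integral_inner hg]
  -- All three points are shifted by `r z`: strong convexity compares `x` with `y`, smoothness
  -- compares `x` with `v`. Undoing the shifts at `v` and `y` leaves a term linear in `z`, which has
  -- mean zero, so the bias costs only order `r² d` and no multiple of `‖v - y‖`.
  have pt : ∀ z : Vec d, P.localObj i v - P.localObj i y + ℓ / 2 * ‖x - y‖ ^ 2 - L * ‖x - v‖ ^ 2
        + r * inner ℝ (gradient (P.localObj i) v - gradient (P.localObj i) y) z
        - L * r ^ 2 * ‖z‖ ^ 2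
      ≤ inner ℝ (v - y) (gradient (P.localObj i) (x + r • z)) := by
    intro z
    have h1 := quadratic_lower_bound hgrad hc (x + r • z) (y + r • z)
    have h2 := (abs_le.1 (abs_sub_linearization_le hL hgrad (norm_gradient_localObj_sub_le hS hV i)
      (x + r • z) (v + r • z))).2
    have h3 := quadratic_lower_bound hgrad hc v (v + r • z)
    have h4 := (abs_le.1 (abs_sub_linearization_le hL hgrad (norm_gradient_localObj_sub_le hS hV i)
      y (y + r • z))).2
    rw [add_sub_add_right_eq_sub] at h1 h2
    rw [add_sub_cancel_left, inner_smul_right] at h3 h4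
    rw [norm_smul, mul_pow, Real.norm_eq_abs, sq_abs] at h4
    have h5 : 0 ≤ ℓ / 2 * ‖r • z‖ ^ 2 := by positivity
    rw [norm_sub_rev x y, norm_sub_rev x v]
    have e : inner ℝ (v - y) (gradient (P.localObj i) (x + r • z))
        = inner ℝ (gradient (P.localObj i) (x + r • z)) (v - x)
          - inner ℝ (gradient (P.localObj i) (x + r • z)) (y - x) := by
      rw [← inner_sub_right, sub_sub_sub_cancel_right, real_inner_comm]
    rw [e, inner_sub_left]
    linarith
  have i1 : Integrable (fun z : Vec d =>
      r * inner ℝ (gradient (P.localObj i) v - gradient (P.localObj i) y) z)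
      (stdGaussian (Vec d)) := (integrable_id_stdGaussian.const_inner _).const_mul r
  have i2 : Integrable (fun z : Vec d => L * r ^ 2 * ‖z‖ ^ 2) (stdGaussian (Vec d)) :=
    (integrable_norm_pow 2).const_mul _
  refine le_trans (le_of_eq ?_) (integral_mono (((integrable_const _).add i1).sub i2)
    (hg.const_inner _) pt)
  rw [integral_sub' ((integrable_const _).add i1) i2, integral_add' (integrable_const _) i1,
    integral_const_mul, integral_const_mul, integral_inner integrable_id_stdGaussian,
    integral_id_stdGaussian, integral_sq_norm]
  simp only [integral_const, probReal_univ, one_smul, inner_zero_right]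
  ring

end Problem

end HDO

namespace HDO

/-! ### Means, spreads and averages over pairs. -/

section Averages

variable {N : ℕ} {E : Type*} [NormedAddCommGroup E] [InnerProductSpace ℝ E]

/-- The mean of `N` vectors. -/
noncomputable def mean (X : Fin N → E) : E := (1 / (N : ℝ)) • ∑ i, X i

/-- The total squared distance of `N` vectors to their mean. -/
noncomputable def spread (X : Fin N → E) : ℝ := ∑ i, ‖X i - mean X‖ ^ 2

theorem spread_nonneg (X : Fin N → E) : 0 ≤ spread X := Finset.sum_nonneg fun _ _ => sq_nonneg _

theorem sum_sub_mean (hN : 0 < N) (X : Fin N → E) : ∑ i, (X i - mean X) = 0 := by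
  have : (N : ℝ) ≠ 0 := by positivity
  rw [Finset.sum_sub_distrib, Finset.sum_const, Finset.card_univ, Fintype.card_fin, mean,
    ← Nat.cast_smul_eq_nsmul ℝ, smul_smul, mul_one_div_cancel this, one_smul, sub_self]

theorem sum_sq_norm_sub (hN : 0 < N) (X : Fin N → E) (c : E) :
    ∑ i, ‖X i - c‖ ^ 2 = spread X + N * ‖mean X - c‖ ^ 2 := by
  have h : ∀ i, ‖X i - c‖ ^ 2 = ‖X i - mean X‖ ^ 2 + 2 * inner ℝ (X i - mean X) (mean X - c)
      + ‖mean X - c‖ ^ 2 := by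
    intro i
    rw [← norm_add_sq_real, sub_add_sub_cancel]
  simp_rw [h]
  rw [Finset.sum_add_distrib, Finset.sum_add_distrib, ← Finset.mul_sum, ← sum_inner,
    sum_sub_mean hN]
  simp [spread]

theorem spread_le (hN : 0 < N) (X : Fin N → E) (c : E) : spread X ≤ ∑ i, ‖X i - c‖ ^ 2 := by
  rw [sum_sq_norm_sub hN X c]
  have : 0 ≤ N * ‖mean X - c‖ ^ 2 := by positivity
  linarith

/-- The average over the ordered pairs of distinct indices. -/
noncomputable def pairAvg (A : Fin N → Fin N → ℝ) : ℝ :=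
  (1 / ((N : ℝ) * (N - 1))) * ∑ p ∈ (Finset.univ : Finset (Fin N)).offDiag, A p.1 p.2

theorem sum_offDiag (A : Fin N → Fin N → ℝ) :
    ∑ p ∈ (Finset.univ : Finset (Fin N)).offDiag, A p.1 p.2 = ∑ i, ∑ j, A i j - ∑ i, A i i := by
  rw [← Finset.sum_product', ← Finset.diag_union_offDiag,
    Finset.sum_union (Finset.disjoint_diag_offDiag _), Finset.sum_diag]
  ring

theorem pairAvg_add (A B : Fin N → Fin N → ℝ) :
    pairAvg (fun i j => A i j + B i j) = pairAvg A + pairAvg B := by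
  simp only [pairAvg, Finset.sum_add_distrib, mul_add]

theorem pairAvg_const_mul (c : ℝ) (A : Fin N → Fin N → ℝ) :
    pairAvg (fun i j => c * A i j) = c * pairAvg A := by
  simp only [pairAvg, ← Finset.mul_sum]
  ring

theorem pairAvg_const (hN : 2 ≤ N) (c : ℝ) : pairAvg (fun _ _ : Fin N => c) = c := by
  have h2 : (2 : ℝ) ≤ N := by exact_mod_cast hN
  rw [pairAvg, sum_offDiag fun _ _ => c]
  simp only [Finset.sum_const, Finset.card_univ, Fintype.card_fin, nsmul_eq_mul]
  have : (N : ℝ) - 1 ≠ 0 := by linarith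
  have : (N : ℝ) ≠ 0 := by linarith
  field_simp

theorem pairAvg_sum_pair (hN : 2 ≤ N) (a : Fin N → ℝ) :
    pairAvg (fun i j => a i + a j) = 2 / N * ∑ i, a i := by
  have h2 : (2 : ℝ) ≤ N := by exact_mod_cast hN
  rw [pairAvg, sum_offDiag (fun i j => a i + a j)]
  simp only [Finset.sum_add_distrib, Finset.sum_const, Finset.card_univ, Fintype.card_fin,
    nsmul_eq_mul, ← Finset.mul_sum]
  have : (N : ℝ) - 1 ≠ 0 := by linarith
  have : (N : ℝ) ≠ 0 := by linarith
  field_simp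
  ring

/-- Over all pairs the cross terms vanish since the vectors sum to zero. Removing the diagonal
leaves the factor `(2N - 4)/(N(N - 1))`, which is at most `2/N`. -/
theorem pairAvg_sq_norm_add_le (hN : 2 ≤ N) (x : Fin N → E) (hx : ∑ i, x i = 0) :
    pairAvg (fun i j => ‖x i + x j‖ ^ 2) ≤ 2 / N * ∑ i, ‖x i‖ ^ 2 := by
  have h2 : (2 : ℝ) ≤ N := by exact_mod_cast hN
  have e : ∑ i, ∑ j, ‖x i + x j‖ ^ 2 = 2 * N * ∑ i, ‖x i‖ ^ 2 := by
    simp_rw [norm_add_sq_real, Finset.sum_add_distrib, ← Finset.mul_sum, ← inner_sum, hx]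
    simp only [inner_zero_right, Finset.sum_const, Finset.card_univ, Fintype.card_fin,
      nsmul_eq_mul, ← Finset.mul_sum]
    ring
  have e2 : ∑ i, ‖x i + x i‖ ^ 2 = 4 * ∑ i, ‖x i‖ ^ 2 := by
    rw [Finset.mul_sum]
    refine Finset.sum_congr rfl fun i _ => ?_
    rw [← two_smul ℝ (x i), norm_smul, mul_pow]
    norm_num
  rw [pairAvg, sum_offDiag (fun i j => ‖x i + x j‖ ^ 2), e, e2]
  have hS : 0 ≤ ∑ i, ‖x i‖ ^ 2 := Finset.sum_nonneg fun _ _ => sq_nonneg _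
  have hN1 : (0 : ℝ) < N - 1 := by linarith
  have hN0 : (0 : ℝ) < N := by linarith
  rw [one_div_mul_eq_div, div_mul_eq_mul_div, div_le_div_iff₀ (by positivity) hN0]
  nlinarith [mul_nonneg hS hN0.le]

theorem mul_sq_mean_le (hN : 0 < N) (X : Fin N → E) (c : E) :
    N * ‖mean X - c‖ ^ 2 ≤ ∑ i, ‖X i - c‖ ^ 2 := by
  rw [sum_sq_norm_sub hN X c]
  linarith [spread_nonneg X]

/-- The configuration in which `i` and `j` take the average of `X i - g` and `X j - h`. -/
noncomputable def mergePair (X : Fin N → E) (i j : Fin N) (g h : E) : Fin N → E :=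
  fun k => if k = i ∨ k = j then (1 / 2 : ℝ) • ((X i - g) + (X j - h)) else X k

theorem sum_mergePair {F : Type*} [AddCommGroup F] (X : Fin N → E) {i j : Fin N} (hij : i ≠ j)
    (g h : E) (φ : E → F) :
    ∑ k, φ (mergePair X i j g h k) = ∑ k, φ (X k) - φ (X i) - φ (X j)
      + (φ ((1 / 2 : ℝ) • ((X i - g) + (X j - h))) + φ ((1 / 2 : ℝ) • ((X i - g) + (X j - h)))) := by
  have hj : j ∈ (Finset.univ : Finset (Fin N)).erase i :=
    Finset.mem_erase.2 ⟨hij.symm, Finset.mem_univ _⟩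
  rw [← Finset.add_sum_erase _ _ (Finset.mem_univ i), ← Finset.add_sum_erase _ _ hj,
    ← Finset.add_sum_erase _ (fun k => φ (X k)) (Finset.mem_univ i),
    ← Finset.add_sum_erase _ (fun k => φ (X k)) hj]
  have : ∑ k ∈ ((Finset.univ : Finset (Fin N)).erase i).erase j, φ (mergePair X i j g h k)
      = ∑ k ∈ ((Finset.univ : Finset (Fin N)).erase i).erase j, φ (X k) := by
    refine Finset.sum_congr rfl fun k hk => ?_
    have h1 := Finset.mem_erase.1 hk
    have h2 := Finset.mem_erase.1 h1.2
    rw [mergePair, if_neg (by tauto)]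
  rw [this]
  simp only [mergePair, true_or, or_true, if_true]
  abel

theorem mean_mergePair (X : Fin N → E) {i j : Fin N} (hij : i ≠ j) (g h : E) :
    mean (mergePair X i j g h) = mean X - (1 / (N : ℝ)) • (g + h) := by
  have := sum_mergePair X hij g h (fun x => x)
  rw [mean, this, mean, ← smul_sub, ← add_smul]
  norm_num
  module

/-- Measuring deviations from the old mean can only increase the spread. In Young's inequality the
factor `3/2` on the undisturbed part becomes `3/4` after two copies of a halved vector; being below
`1`, it leaves room for contraction after averaging over pairs. -/
theorem spread_mergePair_le (hN : 0 < N) (X : Fin N → E) {i j : Fin N} (hij : i ≠ j) (g h : E) :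
    spread (mergePair X i j g h) ≤ spread X - (‖X i - mean X‖ ^ 2 + ‖X j - mean X‖ ^ 2)
      + 3 / 4 * ‖(X i - mean X) + (X j - mean X)‖ ^ 2 + 3 * (‖g‖ ^ 2 + ‖h‖ ^ 2) := by
  refine (spread_le hN _ (mean X)).trans ?_
  rw [sum_mergePair X hij g h (fun x => ‖x - mean X‖ ^ 2)]
  change spread X - _ - _ + _ ≤ _
  set a := (X i - mean X) + (X j - mean X) with ha
  have e : (1 / 2 : ℝ) • ((X i - g) + (X j - h)) - mean X = (1 / 2 : ℝ) • (a - (g + h)) := by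
    rw [ha]; module
  rw [e, norm_smul, mul_pow]
  have h1 : ‖a - (g + h)‖ ^ 2 ≤ 3 / 2 * ‖a‖ ^ 2 + 3 * ‖g + h‖ ^ 2 := by
    have := norm_sub_le a (g + h)
    nlinarith [norm_nonneg (a - (g + h)), sq_nonneg (‖a‖ - 2 * ‖g + h‖)]
  have h2 : ‖g + h‖ ^ 2 ≤ 2 * ‖g‖ ^ 2 + 2 * ‖h‖ ^ 2 := by
    have := norm_add_le g h
    nlinarith [norm_nonneg (g + h), sq_nonneg (‖g‖ - ‖h‖)]
  norm_num
  linarith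

end Averages

/-! ### One interaction in expectation. -/

namespace Problem

variable {d n₀ n₁ : ℕ} {P : Problem.{u} d n₀ n₁} {L : ℝ} {s : Fin (n₀ + n₁) → ℝ}

theorem measurable_interact (hP : P.WellDefined) (hS : P.Smooth L) (η ν : ℝ) :
    Measurable fun p : (Fin (n₀ + n₁) → Vec d) × P.Input => P.interact η ν p.2 p.1 := by
  have hstep : ∀ i, Measurable fun p : (Fin (n₀ + n₁) → Vec d) ×
      ((∀ i, P.Sample i) × (Fin (n₀ + n₁) → Vec d)) =>
      p.1 i - η • P.estimator ν i (p.1 i) (p.2.1 i) (p.2.2 i) := by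
    intro i
    have hg := (measurable_estimator hP hS ν i).comp
      (f := fun p : (Fin (n₀ + n₁) → Vec d) × ((∀ i, P.Sample i) × (Fin (n₀ + n₁) → Vec d)) =>
        (p.1 i, (p.2.1 i, p.2.2 i))) (by fun_prop)
    exact ((measurable_pi_apply i).comp measurable_fst).sub (hg.const_smul η)
  have hfix : Measurable fun r : (Fin (n₀ + n₁) × Fin (n₀ + n₁)) × ((Fin (n₀ + n₁) → Vec d) ×
      ((∀ i, P.Sample i) × (Fin (n₀ + n₁) → Vec d))) => P.interact η ν (r.1, r.2.2) r.2.1 := by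
    refine measurable_from_prod_countable_right fun pr => measurable_pi_lambda _ fun k => ?_
    simp only [interact, localStep]
    split_ifs
    · exact ((hstep pr.1).add (hstep pr.2)).const_smul (1 / 2 : ℝ)
    · fun_prop
  exact hfix.comp (f := fun p : (Fin (n₀ + n₁) → Vec d) × P.Input => (p.2.1, (p.1, p.2.2)))
    (by fun_prop)

/-- The law of the samples and directions of one interaction. -/
noncomputable abbrev noiseLaw (P : Problem.{u} d n₀ n₁) :
    Measure ((∀ i, P.Sample i) × (Fin (n₀ + n₁) → Vec d)) :=
  (Measure.pi P.law).prod (Measure.pi fun _ => stdGaussian (Vec d))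

theorem measurePreserving_node (i : Fin (n₀ + n₁)) :
    MeasurePreserving (fun q : (∀ i, P.Sample i) × (Fin (n₀ + n₁) → Vec d) => (q.1 i, q.2 i))
      P.noiseLaw (P.nodeLaw i) :=
  (measurePreserving_eval P.law i).prod (measurePreserving_eval _ i)

/-- Lower integrals allow an upper bound before any integrability or measurability of `φ` is known.
-/
theorem lintegral_inputLaw_le (hn : 2 ≤ n₀ + n₁) (φ : P.Input → ENNReal)
    (A : Fin (n₀ + n₁) → Fin (n₀ + n₁) → ℝ) (hA0 : ∀ i j, i ≠ j → 0 ≤ A i j)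
    (hA : ∀ i j, i ≠ j → ∫⁻ q, φ ((i, j), q) ∂P.noiseLaw ≤ ENNReal.ofReal (A i j)) :
    ∫⁻ w, φ w ∂P.inputLaw ≤ ENNReal.ofReal (pairAvg A) := by
  have h2 : (2 : ℝ) ≤ ((n₀ + n₁ : ℕ) : ℝ) := by exact_mod_cast hn
  have hset : {p : Fin (n₀ + n₁) × Fin (n₀ + n₁) | p.1 ≠ p.2}
      = ((Finset.univ : Finset (Fin (n₀ + n₁))).offDiag : Set _) := by
    ext p; simp
  refine (lintegral_prod_le _).trans ?_
  rw [hset, uniformOn, ProbabilityTheory.cond, lintegral_smul_measure, lintegral_finset, Measure.count_apply_finset]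
  simp only [Measure.count_singleton, mul_one]
  have hpos : (0 : ℝ) < ((n₀ + n₁ : ℕ) : ℝ) * (((n₀ + n₁ : ℕ) : ℝ) - 1) :=
    mul_pos (by linarith) (by linarith)
  have hcard : (((Finset.univ : Finset (Fin (n₀ + n₁))).offDiag.card : ENNReal))⁻¹
      = ENNReal.ofReal (1 / (((n₀ + n₁ : ℕ) : ℝ) * (((n₀ + n₁ : ℕ) : ℝ) - 1))) := by
    rw [one_div, ENNReal.ofReal_inv_of_pos hpos, Finset.offDiag_card, Finset.card_univ,
      Fintype.card_fin, ← ENNReal.ofReal_natCast,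
      Nat.cast_sub (Nat.le_mul_of_pos_left _ (by omega)), Nat.cast_mul, mul_sub, mul_one]
  rw [hcard, pairAvg, ENNReal.ofReal_mul (by positivity), ENNReal.ofReal_sum_of_nonneg
    fun p hp => hA0 _ _ (Finset.mem_offDiag.1 hp).2.2, smul_eq_mul]
  gcongr with p hp
  exact hA _ _ (Finset.mem_offDiag.1 hp).2.2

/-- The gradient estimate of node `i` at the configuration `X` as a function of the noise. -/
noncomputable def noisyGrad (P : Problem.{u} d n₀ n₁) (ν : ℝ) (X : Fin (n₀ + n₁) → Vec d)
    (i : Fin (n₀ + n₁)) (q : (∀ i, P.Sample i) × (Fin (n₀ + n₁) → Vec d)) : Vec d :=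
  P.estimator ν i (X i) (q.1 i) (q.2 i)

theorem interact_eq_mergePair (η ν : ℝ) (i j : Fin (n₀ + n₁))
    (q : (∀ i, P.Sample i) × (Fin (n₀ + n₁) → Vec d)) (X : Fin (n₀ + n₁) → Vec d) :
    P.interact η ν ((i, j), q) X
      = mergePair X i j (η • P.noisyGrad ν X i q) (η • P.noisyGrad ν X j q) := rfl

theorem memLp_noisyGrad (hP : P.WellDefined) (hS : P.Smooth L) (hV : P.BoundedVariance s)
    (hL : 0 ≤ L) {ν : ℝ} (hν : 0 < ν) (X : Fin (n₀ + n₁) → Vec d) (i : Fin (n₀ + n₁)) :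
    MemLp (P.noisyGrad ν X i) 2 P.noiseLaw := by
  have h := (memLp_estimator hP hS hV hL hν i (X i)).comp_measurePreserving
    (measurePreserving_node i)
  exact h

theorem integral_comp_node {F : Type*} [NormedAddCommGroup F] [NormedSpace ℝ F]
    (i : Fin (n₀ + n₁)) {f : P.Sample i × Vec d → F} (hf : AEStronglyMeasurable f (P.nodeLaw i)) :
    ∫ q, f (q.1 i, q.2 i) ∂P.noiseLaw = ∫ q, f q ∂(P.nodeLaw i) := by
  rw [← (measurePreserving_node (P := P) i).map_eq] at hf ⊢
  exact (integral_map (measurePreserving_node i).measurable.aemeasurable hf).symm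

theorem integral_noisyGrad (hP : P.WellDefined) (hS : P.Smooth L) (ν : ℝ)
    (X : Fin (n₀ + n₁) → Vec d) (i : Fin (n₀ + n₁)) :
    ∫ q, P.noisyGrad ν X i q ∂P.noiseLaw = P.estMean ν i (X i) :=
  integral_comp_node i (aestronglyMeasurable_estimator hP hS ν i (X i))

theorem integral_sq_norm_noisyGrad (hP : P.WellDefined) (hS : P.Smooth L) (ν : ℝ)
    (X : Fin (n₀ + n₁) → Vec d) (i : Fin (n₀ + n₁)) :
    ∫ q, ‖P.noisyGrad ν X i q‖ ^ 2 ∂P.noiseLaw = P.estSq ν i (X i) :=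
  integral_comp_node (f := fun q => ‖P.estimator ν i (X i) q.1 q.2‖ ^ 2) i
    ((aestronglyMeasurable_estimator hP hS ν i (X i)).norm.pow 2)

/-- The bound is linear in the two estimates and their squared norms, without products between
nodes, so only the first two moments at each node enter. -/
theorem lintegral_inputLaw_le_of_noisyGrad (hP : P.WellDefined) (hS : P.Smooth L)
    (hV : P.BoundedVariance s) (hL : 0 ≤ L) (hn : 2 ≤ n₀ + n₁) {ν : ℝ} (hν : 0 < ν)
    (X : Fin (n₀ + n₁) → Vec d) (φ : P.Input → ℝ) (hφ : ∀ w, 0 ≤ φ w)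
    (A : Fin (n₀ + n₁) → Fin (n₀ + n₁) → ℝ) (v : Vec d) (a c : ℝ)
    (h : ∀ i j, i ≠ j → ∀ q, φ ((i, j), q) ≤ A i j
      + a * (inner ℝ v (P.noisyGrad ν X i q) + inner ℝ v (P.noisyGrad ν X j q))
      + c * (‖P.noisyGrad ν X i q‖ ^ 2 + ‖P.noisyGrad ν X j q‖ ^ 2)) :
    ∫⁻ w, ENNReal.ofReal (φ w) ∂P.inputLaw ≤ ENNReal.ofReal (pairAvg A
      + a * (2 / ((n₀ + n₁ : ℕ) : ℝ) * inner ℝ v (∑ i, P.estMean ν i (X i)))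
      + c * (2 / ((n₀ + n₁ : ℕ) : ℝ) * ∑ i, P.estSq ν i (X i))) := by
  have hL2 := fun i => memLp_noisyGrad hP hS hV hL hν X i
  have iG := fun i => (hL2 i).integrable one_le_two
  have iM := fun i => (iG i).const_inner (𝕜 := ℝ) v
  have iS := fun i => (hL2 i).integrable_norm_pow two_ne_zero
  have j1 : ∀ i j, Integrable (fun q => a * (inner ℝ v (P.noisyGrad ν X i q)
      + inner ℝ v (P.noisyGrad ν X j q))) P.noiseLaw :=
    fun i j => ((iM i).add (iM j)).const_mul a
  have j2 : ∀ i j, Integrable (fun q => c * (‖P.noisyGrad ν X i q‖ ^ 2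
      + ‖P.noisyGrad ν X j q‖ ^ 2)) P.noiseLaw :=
    fun i j => ((iS i).add (iS j)).const_mul c
  have j3 : ∀ i j, Integrable (fun q => A i j + a * (inner ℝ v (P.noisyGrad ν X i q)
      + inner ℝ v (P.noisyGrad ν X j q))) P.noiseLaw :=
    fun i j => (integrable_const _).add (j1 i j)
  have j4 : ∀ i j, Integrable (fun q => A i j + a * (inner ℝ v (P.noisyGrad ν X i q)
      + inner ℝ v (P.noisyGrad ν X j q)) + c * (‖P.noisyGrad ν X i q‖ ^ 2
      + ‖P.noisyGrad ν X j q‖ ^ 2)) P.noiseLaw :=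
    fun i j => (j3 i j).add (j2 i j)
  have e : ∀ i j, ∫ q, (A i j
      + a * (inner ℝ v (P.noisyGrad ν X i q) + inner ℝ v (P.noisyGrad ν X j q))
      + c * (‖P.noisyGrad ν X i q‖ ^ 2 + ‖P.noisyGrad ν X j q‖ ^ 2)) ∂P.noiseLaw
      = A i j + a * (inner ℝ v (P.estMean ν i (X i)) + inner ℝ v (P.estMean ν j (X j)))
        + c * (P.estSq ν i (X i) + P.estSq ν j (X j)) := by
    intro i j
    rw [integral_add (j3 i j) (j2 i j), integral_add (integrable_const _) (j1 i j),
      integral_const_mul, integral_const_mul, integral_add (iM i) (iM j),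
      integral_add (iS i) (iS j), integral_inner (iG i), integral_inner (iG j),
      integral_noisyGrad hP hS, integral_noisyGrad hP hS, integral_sq_norm_noisyGrad hP hS,
      integral_sq_norm_noisyGrad hP hS]
    simp only [integral_const, probReal_univ, one_smul]
  have n0 := fun i j hij q => (hφ ((i, j), q)).trans (h i j hij q)
  have main := lintegral_inputLaw_le hn (fun w => ENNReal.ofReal (φ w)) (fun i j =>
      A i j + a * (inner ℝ v (P.estMean ν i (X i)) + inner ℝ v (P.estMean ν j (X j)))
        + c * (P.estSq ν i (X i) + P.estSq ν j (X j)))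
    (fun i j hij => by rw [← e i j]; exact integral_nonneg (n0 i j hij))
    (fun i j hij => by
      rw [← e i j, ofReal_integral_eq_lintegral_ofReal (j4 i j)
        (Filter.Eventually.of_forall (n0 i j hij))]
      exact lintegral_mono fun q => ENNReal.ofReal_le_ofReal (h i j hij q))
  rw [pairAvg_add, pairAvg_add, pairAvg_const_mul, pairAvg_const_mul,
    pairAvg_sum_pair hn (fun i => inner ℝ v (P.estMean ν i (X i))),
    pairAvg_sum_pair hn (fun i => P.estSq ν i (X i)), ← inner_sum] at main
  exact main

/-- One interaction contracts the spread and moves the mean along the estimators: bound on the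
expectation of a Lyapunov function of the form `φ (mean) + κ * spread`. -/
theorem lintegral_lyapunov_interact_le (hP : P.WellDefined) (hS : P.Smooth L)
    (hV : P.BoundedVariance s) (hL : 0 ≤ L) (hn : 2 ≤ n₀ + n₁) {η ν κ b : ℝ} (hν : 0 < ν)
    (hκ : 0 ≤ κ) (hb : 0 ≤ b) (X : Fin (n₀ + n₁) → Vec d) {φ : Vec d → ℝ} (hφ : ∀ x, 0 ≤ φ x)
    (v : Vec d) (hstep : ∀ g, φ (mean X - g) ≤ φ (mean X) - inner ℝ v g + b * ‖g‖ ^ 2) :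
    ∫⁻ w, ENNReal.ofReal (φ (mean (P.interact η ν w X)) + κ * spread (P.interact η ν w X))
        ∂P.inputLaw
      ≤ ENNReal.ofReal (φ (mean X)
        - 2 * η / ((n₀ + n₁ : ℕ) : ℝ) ^ 2 * inner ℝ v (∑ i, P.estMean ν i (X i))
        + κ * ((1 - 1 / (2 * ((n₀ + n₁ : ℕ) : ℝ))) * spread X)
        + η ^ 2 * (4 * b / ((n₀ + n₁ : ℕ) : ℝ) ^ 2 + 6 * κ) / ((n₀ + n₁ : ℕ) : ℝ)
          * ∑ i, P.estSq ν i (X i)) := by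
  have hx := pairAvg_sq_norm_add_le hn (fun i => X i - mean X) (sum_sub_mean (by omega) X)
  change _ ≤ _ * spread X at hx
  set N : ℝ := ((n₀ + n₁ : ℕ) : ℝ) with hNdef
  have h2 : (2 : ℝ) ≤ N := by rw [hNdef]; exact_mod_cast hn
  have hN0 : 0 < N := by linarith
  have main := lintegral_inputLaw_le_of_noisyGrad hP hS hV hL hn hν X
    (fun w => φ (mean (P.interact η ν w X)) + κ * spread (P.interact η ν w X))
    (fun w => add_nonneg (hφ _) (mul_nonneg hκ (spread_nonneg _)))
    -- The noise-free part. Averaged over pairs, it loses `2κ/N` times the spread and regains at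
    -- most `3/4` of this, a net contraction by `1/(2N)`.
    (fun i j => (φ (mean X) + κ * spread X) + ((-κ) * (‖X i - mean X‖ ^ 2 + ‖X j - mean X‖ ^ 2)
        + (3 / 4 * κ) * ‖(X i - mean X) + (X j - mean X)‖ ^ 2)) v
    (-(η / N)) (η ^ 2 * (2 * b / N ^ 2 + 3 * κ)) (by
      intro i j hij q
      rw [interact_eq_mergePair]
      set g := P.noisyGrad ν X i q
      set h := P.noisyGrad ν X j q
      have h1 := mul_le_mul_of_nonneg_left
        (spread_mergePair_le (by omega) X hij (η • g) (η • h)) hκ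
      have h3 := hstep ((η / N) • (g + h))
      have e6 : (1 / N) • (η • g + η • h) = (η / N) • (g + h) := by
        rw [← smul_add, smul_smul]; congr 1; ring
      rw [mean_mergePair X hij, ← hNdef, e6]
      rw [inner_smul_right, inner_add_right, norm_smul, mul_pow, Real.norm_eq_abs, sq_abs] at h3
      rw [norm_smul, norm_smul, mul_pow, mul_pow, Real.norm_eq_abs, sq_abs] at h1
      have h4 : ‖g + h‖ ^ 2 ≤ 2 * (‖g‖ ^ 2 + ‖h‖ ^ 2) := by
        have := norm_add_le g h
        nlinarith [norm_nonneg (g + h), sq_nonneg (‖g‖ - ‖h‖)]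
      have h5 : b * ((η / N) ^ 2 * ‖g + h‖ ^ 2)
          ≤ b * ((η / N) ^ 2 * (2 * (‖g‖ ^ 2 + ‖h‖ ^ 2))) := by gcongr
      have e5 : b * ((η / N) ^ 2 * (2 * (‖g‖ ^ 2 + ‖h‖ ^ 2)))
          = η ^ 2 * (2 * b / N ^ 2) * (‖g‖ ^ 2 + ‖h‖ ^ 2) := by field_simp
      rw [e5] at h5
      linarith)
  refine main.trans (ENNReal.ofReal_le_ofReal ?_)
  rw [pairAvg_add, pairAvg_const hn, pairAvg_add, pairAvg_const_mul, pairAvg_const_mul,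
    pairAvg_sum_pair hn (fun i => ‖X i - mean X‖ ^ 2)]
  have hx' := mul_le_mul_of_nonneg_left hx (show 0 ≤ 3 / 4 * κ by positivity)
  rw [← hNdef]
  change _ + (-κ * (2 / N * spread X) + _) + _ + _ ≤ _
  set I := inner ℝ v (∑ i, P.estMean ν i (X i))
  set Q := ∑ i, P.estSq ν i (X i)
  have e1 : -(η / N) * (2 / N * I) = - (2 * η / N ^ 2 * I) := by field_simp
  have e2 : η ^ 2 * (2 * b / N ^ 2 + 3 * κ) * (2 / N * Q)
      = η ^ 2 * (4 * b / N ^ 2 + 6 * κ) / N * Q := by field_simp; ring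
  have e3 : κ * ((1 - 1 / (2 * N)) * spread X) = κ * spread X - 1 / 4 * κ * (2 / N * spread X) := by
    field_simp; ring
  rw [e1, e2, e3]
  linarith

end Problem

end HDO

namespace HDO
namespace Problem

/-! ### The run as a Markov chain. -/

section Chain

variable {d n₀ n₁ : ℕ} {P : Problem.{u} d n₀ n₁} {L : ℝ}
  {Ω : Type v}

/-- The models after `t` steps only depend on the inputs of these steps. -/
theorem measurable_models_past (hP : P.WellDefined) (hS : P.Smooth L) (η ν : ℝ) (x₀ : Vec d)
    (W : ℕ → Ω → P.Input) (t : ℕ) :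
    Measurable[⨆ r ∈ {r | r < t}, MeasurableSpace.comap (W r) inferInstance]
      fun ω => P.models η ν x₀ (fun r => W r ω) t := by
  induction t with
  | zero => exact @measurable_const _ _ _ _ _
  | succ t ih =>
    have h1 : Measurable[⨆ r ∈ {r | r < t + 1}, MeasurableSpace.comap (W r) inferInstance]
        fun ω => P.models η ν x₀ (fun r => W r ω) t := by
      refine ih.mono (iSup₂_le fun r hr => ?_) le_rfl
      exact le_iSup₂_of_le (f := fun r (_ : r ∈ {r | r < t + 1}) =>
        MeasurableSpace.comap (W r) inferInstance) r (Nat.lt_succ_of_lt hr) le_rfl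
    have h2 : Measurable[⨆ r ∈ {r | r < t + 1}, MeasurableSpace.comap (W r) inferInstance]
        (W t) := by
      refine (comap_measurable (W t)).mono ?_ le_rfl
      exact le_iSup₂_of_le (f := fun r (_ : r ∈ {r | r < t + 1}) =>
        MeasurableSpace.comap (W r) inferInstance) t (Nat.lt_succ_self t) le_rfl
    exact (measurable_interact hP hS η ν).comp (h1.prodMk h2)

variable [MeasurableSpace Ω] {Pr : Measure Ω} {W : ℕ → Ω → P.Input}

theorem measurable_models (hP : P.WellDefined) (hS : P.Smooth L) (hW : P.IsInput Pr W)
    (η ν : ℝ) (x₀ : Vec d) (t : ℕ) :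
    Measurable fun ω => P.models η ν x₀ (fun r => W r ω) t :=
  (measurable_models_past hP hS η ν x₀ W t).mono
    (iSup₂_le fun r _ => (hW.measurable r).comap_le) le_rfl

/-- The models at time `t` are measurable with respect to the inputs before `t`, which are
independent of `W t`. -/
theorem indepFun_models (hP : P.WellDefined) (hS : P.Smooth L) (hW : P.IsInput Pr W)
    (η ν : ℝ) (x₀ : Vec d) (t : ℕ) :
    IndepFun (fun ω => P.models η ν x₀ (fun r => W r ω) t) (W t) Pr := by
  have h := indep_iSup_of_disjoint (fun r => (hW.measurable r).comap_le) hW.indep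
    (S := {r | r < t}) (T := {t}) (by simp)
  refine (IndepFun_iff_Indep _ _ _).2 (indep_of_indep_of_le_left (indep_of_indep_of_le_right h ?_) ?_)
  · exact le_iSup₂_of_le (f := fun r (_ : r ∈ ({t} : Set ℕ)) =>
      MeasurableSpace.comap (W r) inferInstance) t rfl le_rfl
  · exact (measurable_models_past hP hS η ν x₀ W t).comap_le

variable [IsProbabilityMeasure Pr]

/-- The Markov property, as Fubini for the product law of current models and fresh input. -/
theorem lintegral_models_succ (hP : P.WellDefined) (hS : P.Smooth L) (hW : P.IsInput Pr W)
    (η ν : ℝ) (x₀ : Vec d) (t : ℕ) {g : (Fin (n₀ + n₁) → Vec d) → ENNReal} (hg : Measurable g) :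
    ∫⁻ ω, g (P.models η ν x₀ (fun r => W r ω) (t + 1)) ∂Pr
      = ∫⁻ ω, ∫⁻ w, g (P.interact η ν w (P.models η ν x₀ (fun r => W r ω) t)) ∂P.inputLaw ∂Pr := by
  have hX := measurable_models hP hS hW η ν x₀ t
  have : IsProbabilityMeasure P.inputLaw := by
    rw [← hW.map_eq 0]
    exact Measure.isProbabilityMeasure_map (hW.measurable 0).aemeasurable
  have hgi : Measurable fun p : (Fin (n₀ + n₁) → Vec d) × P.Input => g (P.interact η ν p.2 p.1) :=
    hg.comp (measurable_interact hP hS η ν)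
  have hlaw := (indepFun_iff_map_prod_eq_prod_map_map hX.aemeasurable
    (hW.measurable t).aemeasurable).1 (indepFun_models hP hS hW η ν x₀ t)
  rw [hW.map_eq t] at hlaw
  calc ∫⁻ ω, g (P.models η ν x₀ (fun r => W r ω) (t + 1)) ∂Pr
      = ∫⁻ p, g (P.interact η ν p.2 p.1)
          ∂(Pr.map fun ω => (P.models η ν x₀ (fun r => W r ω) t, W t ω)) :=
        (lintegral_map hgi (hX.prodMk (hW.measurable t))).symm
    _ = _ := by
        rw [hlaw, lintegral_prod _ hgi.aemeasurable, lintegral_map hgi.lintegral_prod_right' hX]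

/-- A drift condition for one interaction, integrated along the run of the algorithm. -/
theorem integrable_and_drift (hP : P.WellDefined) (hS : P.Smooth L) (hW : P.IsInput Pr W)
    (η ν : ℝ) (x₀ : Vec d) {V h : (Fin (n₀ + n₁) → Vec d) → ℝ} {q K : ℝ}
    (hVm : Measurable V) (hhm : Measurable h) (hV0 : ∀ X, 0 ≤ V X) (hh0 : ∀ X, 0 ≤ h X)
    (hhV : ∀ X, h X ≤ q * V X) (hK : 0 ≤ K)
    (hdrift : ∀ X, ∫⁻ w, ENNReal.ofReal (V (P.interact η ν w X)) ∂P.inputLaw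
      ≤ ENNReal.ofReal (q * V X - h X + K)) (t : ℕ) :
    Integrable (fun ω => V (P.models η ν x₀ (fun r => W r ω) t)) Pr ∧
    Integrable (fun ω => h (P.models η ν x₀ (fun r => W r ω) t)) Pr ∧
    ∫ ω, V (P.models η ν x₀ (fun r => W r ω) (t + 1)) ∂Pr
      ≤ q * ∫ ω, V (P.models η ν x₀ (fun r => W r ω) t) ∂Pr
        - ∫ ω, h (P.models η ν x₀ (fun r => W r ω) t) ∂Pr + K := by
  have hX := fun t => measurable_models hP hS hW η ν x₀ t
  have hh : ∀ t, Integrable (fun ω => V (P.models η ν x₀ (fun r => W r ω) t)) Pr →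
      Integrable (fun ω => h (P.models η ν x₀ (fun r => W r ω) t)) Pr := fun t hi =>
    (hi.const_mul q).mono' (hhm.comp (hX t)).aestronglyMeasurable
      (Filter.Eventually.of_forall fun ω => by
        rw [Real.norm_of_nonneg (hh0 _)]; exact hhV _)
  have hstep : ∀ t, ∫⁻ ω, ENNReal.ofReal (V (P.models η ν x₀ (fun r => W r ω) (t + 1))) ∂Pr
      ≤ ∫⁻ ω, ENNReal.ofReal (q * V (P.models η ν x₀ (fun r => W r ω) t)
        - h (P.models η ν x₀ (fun r => W r ω) t) + K) ∂Pr := by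
    intro t
    rw [lintegral_models_succ hP hS hW η ν x₀ t (g := fun X => ENNReal.ofReal (V X))
      hVm.ennreal_ofReal]
    exact lintegral_mono fun ω => hdrift _
  have hRi : ∀ t, Integrable (fun ω => V (P.models η ν x₀ (fun r => W r ω) t)) Pr →
      Integrable (fun ω => q * V (P.models η ν x₀ (fun r => W r ω) t)
        - h (P.models η ν x₀ (fun r => W r ω) t) + K) Pr := fun t hi =>
    ((hi.const_mul q).sub (hh t hi)).add (integrable_const K)
  -- The condition `h ≤ q * V` keeps the right side nonnegative, so `ENNReal.ofReal` truncates
  -- nothing and the drift survives the return to real integrals.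
  have hR0 : ∀ t, 0 ≤ᵐ[Pr] fun ω => q * V (P.models η ν x₀ (fun r => W r ω) t)
        - h (P.models η ν x₀ (fun r => W r ω) t) + K := fun t =>
    Filter.Eventually.of_forall fun ω => add_nonneg (sub_nonneg.2 (hhV _)) hK
  -- Integrability propagates through the drift itself: a finite right side at time `t` bounds the
  -- lower integral at `t + 1`.
  have hVi : ∀ t, Integrable (fun ω => V (P.models η ν x₀ (fun r => W r ω) t)) Pr := by
    intro t
    induction t with
    | zero => exact integrable_const (V fun _ => x₀)
    | succ t ih =>
      refine (lintegral_ofReal_ne_top_iff_integrable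
        (hVm.comp (hX (t + 1))).aestronglyMeasurable
        (Filter.Eventually.of_forall fun ω => hV0 _)).1 (ne_of_lt ((hstep t).trans_lt ?_))
      exact lt_top_iff_ne_top.2 ((lintegral_ofReal_ne_top_iff_integrable
        (hRi t ih).aestronglyMeasurable (hR0 t)).2 (hRi t ih))
  refine ⟨hVi t, hh t (hVi t), ?_⟩
  have h1 := hstep t
  have hs : Integrable (fun ω => q * V (P.models η ν x₀ (fun r => W r ω) t)
      - h (P.models η ν x₀ (fun r => W r ω) t)) Pr := ((hVi t).const_mul q).sub (hh t (hVi t))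
  rw [← ofReal_integral_eq_lintegral_ofReal (hVi (t + 1)) (Filter.Eventually.of_forall fun ω => hV0 _),
    ← ofReal_integral_eq_lintegral_ofReal (hRi t (hVi t)) (hR0 t),
    ENNReal.ofReal_le_ofReal_iff (integral_nonneg_of_ae (hR0 t)),
    integral_add hs (integrable_const K),
    integral_sub ((hVi t).const_mul q) (hh t (hVi t)), integral_const_mul] at h1
  simpa using h1

end Chain

end Problem

end HDO

namespace HDO
namespace Problem

/-! ### Sums of estimator moments over all nodes. -/

section Bounds

variable {d n₀ n₁ : ℕ} {P : Problem.{u} d n₀ n₁} {L : ℝ} {s : Fin (n₀ + n₁) → ℝ}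

theorem sum_dimFactor_mul (a : Fin (n₀ + n₁) → ℝ) :
    ∑ i, dimFactor d n₀ n₁ i * a i
      = d * ∑ i ∈ zerothNodes n₀ n₁, a i + ∑ i ∈ firstNodes n₀ n₁, a i := by
  rw [zerothNodes, firstNodes, ← Finset.sum_filter_add_sum_filter_not Finset.univ
    (fun i : Fin (n₀ + n₁) => (i : ℕ) < n₀), Finset.mul_sum]
  simp only [not_lt]
  congr 1
  · refine Finset.sum_congr rfl fun i hi => ?_
    rw [dimFactor, if_pos (Finset.mem_filter.1 hi).2]
  · refine Finset.sum_congr rfl fun i hi => ?_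
    rw [dimFactor, if_neg (not_lt.2 (Finset.mem_filter.1 hi).2), one_mul]

theorem card_zerothNodes : (zerothNodes n₀ n₁).card = n₀ := by
  rw [zerothNodes, Finset.card_filter, Fin.sum_univ_add]
  simp

theorem card_firstNodes : (firstNodes n₀ n₁).card = n₁ := by
  rw [firstNodes, Finset.card_filter, Fin.sum_univ_add]
  simp

theorem sum_dimFactor : ∑ i, dimFactor d n₀ n₁ i = d * n₀ + n₁ := by
  have := sum_dimFactor_mul (d := d) (n₀ := n₀) (n₁ := n₁) fun _ => 1
  simpa [card_zerothNodes, card_firstNodes] using this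

theorem sum_radius_mul (ν : ℝ) (c : ℝ → ℝ) (hc : c 0 = 0) :
    ∑ i, c (radius n₀ n₁ ν i) = n₀ * c ν := by
  simp only [radius, apply_ite c, hc]
  rw [← Finset.sum_filter]
  change ∑ i ∈ zerothNodes n₀ n₁, c ν = _
  simp [card_zerothNodes]

/-- Also valid for an empty group, where the convention `1 / 0 = 0` does no harm. -/
theorem sum_eq_card_mul_average {ι : Type*} (t : Finset ι) (a : ι → ℝ) {m : ℕ} (hm : t.card = m) :
    ∑ i ∈ t, a i = m * ((1 / (m : ℝ)) * ∑ i ∈ t, a i) := by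
  rcases Nat.eq_zero_or_pos m with rfl | h
  · simp [Finset.card_eq_zero.1 hm]
  · have : (m : ℝ) ≠ 0 := by positivity
    field_simp

/-- The sum of the second moments of the estimators at a configuration. -/
theorem sum_estSq_le (hP : P.WellDefined) (hS : P.Smooth L) (hV : P.BoundedVariance s)
    (hL : 0 ≤ L) {ς₀ ς₁ : ℝ} (hB : P.Balanced ς₀ ς₁) (hd : 1 ≤ d) {η ν : ℝ} (hν : 0 < ν)
    (hην : ν ^ 2 * d = η ^ 2) (X : Fin (n₀ + n₁) → Vec d) :
    ∑ i, P.estSq ν i (X i) ≤ 3 * estConst * (d * L ^ 2 * spread X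
      + (d * n₀ + n₁) * ‖gradient P.obj (mean X)‖ ^ 2
      + ((d * n₀ * ς₀ ^ 2 + n₁ * ς₁ ^ 2)
        + (d * n₀ * sigmaSqZeroth s + n₁ * sigmaSqFirst s))
      + n₀ * (L ^ 2 * η ^ 2 * d ^ 2)) := by
  have hd' : (1 : ℝ) ≤ d := by exact_mod_cast hd
  have hc : 0 ≤ estConst := by
    unfold estConst
    linarith [gaussMoment_nonneg 4, gaussMoment_nonneg 6]
  set v := gradient P.obj (mean X)
  have hδ : ∀ i, 0 ≤ dimFactor d n₀ n₁ i ∧ dimFactor d n₀ n₁ i ≤ d := by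
    intro i
    unfold dimFactor
    split_ifs
    · exact ⟨by linarith, le_rfl⟩
    · exact ⟨zero_le_one, hd'⟩
  have h1 : ∀ i, P.estSq ν i (X i) ≤ 3 * estConst * (d * L ^ 2 * ‖X i - mean X‖ ^ 2
      + dimFactor d n₀ n₁ i * ‖v‖ ^ 2
      + (dimFactor d n₀ n₁ i * ‖gradient (P.localObj i) (mean X) - v‖ ^ 2
        + dimFactor d n₀ n₁ i * s i ^ 2)
      + L ^ 2 * radius n₀ n₁ ν i ^ 2 * d ^ 3) := by
    intro i
    refine (estSq_le hP hS hV hL hν i (X i)).trans ?_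
    have hg : ‖gradient (P.localObj i) (X i)‖ ^ 2 ≤ 3 * (L ^ 2 * ‖X i - mean X‖ ^ 2
        + ‖gradient (P.localObj i) (mean X) - v‖ ^ 2 + ‖v‖ ^ 2) := by
      have t0 : gradient (P.localObj i) (X i)
          = (gradient (P.localObj i) (X i) - gradient (P.localObj i) (mean X))
            + (gradient (P.localObj i) (mean X) - v) + v := by abel
      have t1 := norm_add₃_le (a := gradient (P.localObj i) (X i) - gradient (P.localObj i) (mean X))
        (b := gradient (P.localObj i) (mean X) - v) (c := v)
      rw [← t0] at t1
      have t2 := t1.trans (add_le_add_left (add_le_add_left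
        (norm_gradient_localObj_sub_le hS hV i (X i) (mean X)) _) _)
      have t3 := pow_le_pow_left₀ (norm_nonneg _) t2 2
      set p := L * ‖X i - mean X‖
      have : L ^ 2 * ‖X i - mean X‖ ^ 2 = p ^ 2 := by ring
      rw [this]
      nlinarith [sq_nonneg (p - ‖gradient (P.localObj i) (mean X) - v‖), sq_nonneg (p - ‖v‖),
        sq_nonneg (‖gradient (P.localObj i) (mean X) - v‖ - ‖v‖)]
    have h2 := mul_le_mul_of_nonneg_left hg (hδ i).1
    have h3 : dimFactor d n₀ n₁ i * (L ^ 2 * ‖X i - mean X‖ ^ 2)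
        ≤ d * (L ^ 2 * ‖X i - mean X‖ ^ 2) :=
      mul_le_mul_of_nonneg_right (hδ i).2 (by positivity)
    have h4 : 0 ≤ dimFactor d n₀ n₁ i * s i ^ 2 := mul_nonneg (hδ i).1 (sq_nonneg _)
    have h5 : 0 ≤ L ^ 2 * radius n₀ n₁ ν i ^ 2 * d ^ 3 := by positivity
    rw [mul_comm 3 estConst, mul_assoc estConst]
    refine mul_le_mul_of_nonneg_left ?_ hc
    linarith
  refine (Finset.sum_le_sum fun i _ => h1 i).trans ?_
  rw [← Finset.mul_sum]
  refine mul_le_mul_of_nonneg_left ?_ (by positivity)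
  rw [Finset.sum_add_distrib, Finset.sum_add_distrib, Finset.sum_add_distrib,
    Finset.sum_add_distrib, ← Finset.mul_sum, ← Finset.sum_mul, sum_dimFactor, sum_dimFactor_mul,
    sum_dimFactor_mul, sum_radius_mul ν (fun r => L ^ 2 * r ^ 2 * d ^ 3) (by simp)]
  have e0 := sum_eq_card_mul_average (zerothNodes n₀ n₁)
    (fun i => ‖gradient (P.localObj i) (mean X) - v‖ ^ 2) card_zerothNodes
  have e1 := sum_eq_card_mul_average (firstNodes n₀ n₁)
    (fun i => ‖gradient (P.localObj i) (mean X) - v‖ ^ 2) card_firstNodes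
  have e2 : ∑ i ∈ zerothNodes n₀ n₁, s i ^ 2 = n₀ * sigmaSqZeroth s :=
    sum_eq_card_mul_average _ _ card_zerothNodes
  have e3 : ∑ i ∈ firstNodes n₀ n₁, s i ^ 2 = n₁ * sigmaSqFirst s :=
    sum_eq_card_mul_average _ _ card_firstNodes
  have b0 := mul_le_mul_of_nonneg_left (hB.zerothOrder (mean X)) (Nat.cast_nonneg (α := ℝ) n₀)
  have b1 := mul_le_mul_of_nonneg_left (hB.firstOrder (mean X)) (Nat.cast_nonneg (α := ℝ) n₁)
  rw [← e0] at b0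
  rw [← e1] at b1
  have b0' := mul_le_mul_of_nonneg_left b0 (show (0 : ℝ) ≤ d by linarith)
  have e4 : L ^ 2 * ν ^ 2 * (d : ℝ) ^ 3 = L ^ 2 * η ^ 2 * d ^ 2 := by rw [← hην]; ring
  rw [e2, e3, e4]
  change d * L ^ 2 * spread X + _ + _ + _ ≤ _
  linarith

/-- The mean estimators at a configuration are close to the gradient at the mean model. -/
theorem inner_gradient_sum_estMean_ge (hP : P.WellDefined) (hS : P.Smooth L)
    (hV : P.BoundedVariance s) (hL : 0 ≤ L) (hd : 1 ≤ d) (hn : 0 < n₀ + n₁) {η ν : ℝ}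
    (hν : 0 < ν) (hην : ν * √d = η) (X : Fin (n₀ + n₁) → Vec d) :
    ((n₀ + n₁ : ℕ) : ℝ) * ‖gradient P.obj (mean X)‖ ^ 2 / 2 - L ^ 2 * spread X
        - n₀ ^ 2 * (L ^ 2 * η ^ 2) / ((n₀ + n₁ : ℕ) : ℝ)
      ≤ inner ℝ (gradient P.obj (mean X)) (∑ i, P.estMean ν i (X i)) := by
  set N : ℝ := ((n₀ + n₁ : ℕ) : ℝ) with hN
  have hN0 : 0 < N := by rw [hN]; exact_mod_cast hn
  set v := gradient P.obj (mean X) with hv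
  have hv' : ∑ i, gradient (P.localObj i) (mean X) = N • v := by
    rw [hv, gradient_obj hP hS hV hL, smul_smul, mul_one_div_cancel hN0.ne', one_smul]
  set w := ∑ i, (P.estMean ν i (X i) - gradient (P.localObj i) (mean X)) with hw
  have e : ∑ i, P.estMean ν i (X i) = N • v + w := by
    rw [hw, Finset.sum_sub_distrib, hv']; abel
  have hwn : ‖w‖ ≤ L * ∑ i, ‖X i - mean X‖ + n₀ * (L * η) := by
    have h0 : ∀ i, ‖P.estMean ν i (X i) - gradient (P.localObj i) (mean X)‖
        ≤ L * ‖X i - mean X‖ + L * (radius n₀ n₁ ν i * √d) := by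
      intro i
      have t1 := norm_estMean_sub_le hP hS hV hL hν hd i (X i)
      have t2 := norm_gradient_localObj_sub_le hS hV i (X i) (mean X)
      have t3 := norm_sub_le_norm_sub_add_norm_sub (P.estMean ν i (X i))
        (gradient (P.localObj i) (X i)) (gradient (P.localObj i) (mean X))
      linarith
    refine (norm_sum_le _ _).trans ((Finset.sum_le_sum fun i _ => h0 i).trans (le_of_eq ?_))
    rw [Finset.sum_add_distrib, ← Finset.mul_sum, sum_radius_mul ν (fun r => L * (r * √d)) (by simp),
      hην]
  have hcs : (∑ i, ‖X i - mean X‖) ^ 2 ≤ N * spread X := by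
    have := sq_sum_le_card_mul_sum_sq (s := Finset.univ) (f := fun i => ‖X i - mean X‖)
    simpa [spread, hN] using this
  have hS0 : 0 ≤ ∑ i, ‖X i - mean X‖ := Finset.sum_nonneg fun _ _ => norm_nonneg _
  have hw2 : ‖w‖ ^ 2 ≤ 2 * (L ^ 2 * (N * spread X)) + 2 * (n₀ ^ 2 * (L ^ 2 * η ^ 2)) := by
    have t1 := pow_le_pow_left₀ (norm_nonneg _) hwn 2
    have t2 := mul_le_mul_of_nonneg_left hcs (sq_nonneg L)
    nlinarith [sq_nonneg (L * ∑ i, ‖X i - mean X‖ - n₀ * (L * η))]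
  rw [e, inner_add_right, inner_smul_right, real_inner_self_eq_norm_sq]
  -- Young's inequality with weight `N` gives up half of the main term `N * ‖v‖ ^ 2`.
  have hin : -(N * ‖v‖ ^ 2 / 2 + ‖w‖ ^ 2 / (2 * N)) ≤ inner ℝ v w := by
    have t1 := (abs_le.1 (abs_real_inner_le_norm v w)).1
    have t2 : N * ‖v‖ ^ 2 / 2 + ‖w‖ ^ 2 / (2 * N) - ‖v‖ * ‖w‖ = (N * ‖v‖ - ‖w‖) ^ 2 / (2 * N) := by
      field_simp; ring
    have t3 : 0 ≤ (N * ‖v‖ - ‖w‖) ^ 2 / (2 * N) := by positivity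
    linarith
  have hdiv : ‖w‖ ^ 2 / (2 * N) ≤ L ^ 2 * spread X + n₀ ^ 2 * (L ^ 2 * η ^ 2) / N := by
    rw [div_le_iff₀ (by positivity)]
    have : (L ^ 2 * spread X + n₀ ^ 2 * (L ^ 2 * η ^ 2) / N) * (2 * N)
        = 2 * (L ^ 2 * (N * spread X)) + 2 * (n₀ ^ 2 * (L ^ 2 * η ^ 2)) := by field_simp
    rw [this]; exact hw2
  linarith

/-- Under strong convexity the mean estimators at a configuration point towards `y`. -/
theorem inner_sub_sum_estMean_ge (hP : P.WellDefined) (hS : P.Smooth L)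
    (hV : P.BoundedVariance s) (hL : 0 ≤ L) (hn : 0 < n₀ + n₁) {η ν ℓ : ℝ}
    (hν : 0 < ν) (hην : ν ^ 2 * d = η ^ 2) (hℓ : 0 ≤ ℓ)
    (hc : ∀ i, StronglyConvex ℓ (P.localObj i)) (X : Fin (n₀ + n₁) → Vec d) (y : Vec d) :
    ((n₀ + n₁ : ℕ) : ℝ) * (P.obj (mean X) - P.obj y)
        + ((n₀ + n₁ : ℕ) : ℝ) * (ℓ / 2 * ‖mean X - y‖ ^ 2) - L * spread X - n₀ * (L * η ^ 2)
      ≤ inner ℝ (mean X - y) (∑ i, P.estMean ν i (X i)) := by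
  have hN0 : (0 : ℝ) < ((n₀ + n₁ : ℕ) : ℝ) := by exact_mod_cast hn
  rw [inner_sum]
  refine le_trans ?_ (Finset.sum_le_sum fun i _ =>
    inner_estMean_ge hP hS hV hL hν hℓ i (hc i) (X i) (mean X) y)
  rw [Finset.sum_sub_distrib, Finset.sum_sub_distrib, Finset.sum_add_distrib,
    Finset.sum_sub_distrib, ← Finset.mul_sum, ← Finset.mul_sum,
    sum_radius_mul ν (fun r => L * (r ^ 2 * d)) (by simp), hην]
  have e : ∀ z, ∑ i, P.localObj i z = ((n₀ + n₁ : ℕ) : ℝ) * P.obj z := by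
    intro z
    rw [obj, ← mul_assoc, mul_one_div_cancel hN0.ne', one_mul]
  rw [e, e]
  change _ ≤ _ - L * spread X - _
  have := mul_le_mul_of_nonneg_left (mul_sq_mean_le hn X y) (show 0 ≤ ℓ / 2 by positivity)
  linarith

end Bounds

end Problem

/-! ### Choice of `κ` and the drift inequalities. -/

section Algebra

/-- Here `Γ` is the spread, `a` the squared gradient norm at the mean, `F` the gap, `c = n₀` and `D
= d n₀ + n₁`. The contraction `κ/(2N)` is split in half: one half pays for the drift error
`2ηL²/N²`, the other for the spread in the second moments. The two summands of `κ` are tailored to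
these debts; `h2` absorbs the feedback of `κ` through the noise. By `h1` the noise consumes only
half of the descent in `a`. -/
theorem drift_algebra_nonconvex {N L η d D c m Γ a Q F I S κ : ℝ} (hN : 2 ≤ N) (hL : 0 < L)
    (hη : 0 < η) (hd : 1 ≤ d) (hc : 0 ≤ c) (hm : 6 ≤ m) (hΓ : 0 ≤ Γ) (ha : 0 ≤ a)
    (hQ : 0 ≤ Q) (hκ : κ = 8 * L ^ 2 * η / N + 32 * m * L ^ 3 * η ^ 2 * d / N ^ 2)
    (hI : N * a / 2 - L ^ 2 * Γ - c ^ 2 * (L ^ 2 * η ^ 2) / N ≤ I)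
    (hS : S ≤ m * (d * L ^ 2 * Γ + D * a + Q + c * (L ^ 2 * η ^ 2 * d ^ 2)))
    (hD : 0 ≤ D) (h1 : 112 * m * (L * η * D) ≤ N ^ 2) (h2 : 48 * m * (η ^ 2 * d * L ^ 2) ≤ 1)
    (h3 : L * η * N ≤ 1) :
    F - 2 * η / N ^ 2 * I + κ * ((1 - 1 / (2 * N)) * Γ) + η ^ 2 * (4 * L / N ^ 2 + 6 * κ) / N * S
      ≤ 1 * (F + κ * Γ) - η / (2 * N) * a
        + (2 * η / N ^ 3 * (c ^ 2 * (L ^ 2 * η ^ 2))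
          + 56 * m * (η ^ 2 * L / N ^ 3) * (Q + c * (L ^ 2 * η ^ 2 * d ^ 2))) := by
  have hN0 : 0 < N := by linarith
  have hm0 : 0 < m := by linarith
  have hd0 : 0 < d := by linarith
  have hκ0 : 0 ≤ κ := by rw [hκ]; positivity
  set B := η ^ 2 * (4 * L / N ^ 2 + 6 * κ) / N with hB
  have hB0 : 0 ≤ B := by positivity
  have t1 : 2 * η / N ^ 2 * (N * a / 2 - L ^ 2 * Γ - c ^ 2 * (L ^ 2 * η ^ 2) / N)
      ≤ 2 * η / N ^ 2 * I := mul_le_mul_of_nonneg_left hI (by positivity)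
  have t2 := mul_le_mul_of_nonneg_left hS hB0
  -- the contribution of the spread
  have g1 : B * m * d * L ^ 2 ≤ κ / (4 * N) := by
    have e : B * m * d * L ^ 2
        = 4 * m * L ^ 3 * η ^ 2 * d / N ^ 3 + κ / (8 * N) * (48 * m * (η ^ 2 * d * L ^ 2)) := by
      rw [hB]; field_simp; ring
    have k1 : κ / (8 * N) * (48 * m * (η ^ 2 * d * L ^ 2)) ≤ κ / (8 * N) * 1 :=
      mul_le_mul_of_nonneg_left h2 (by positivity)
    have k2 : 4 * m * L ^ 3 * η ^ 2 * d / N ^ 3 ≤ κ / (8 * N) := by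
      have : κ / (8 * N) = 4 * m * L ^ 3 * η ^ 2 * d / N ^ 3 + L ^ 2 * η / N ^ 2 := by
        rw [hκ]; field_simp; ring
      have : 0 ≤ L ^ 2 * η / N ^ 2 := by positivity
      linarith
    have k3 : κ / (4 * N) = κ / (8 * N) + κ / (8 * N) := by field_simp; ring
    linarith
  have g2 : 2 * η / N ^ 2 * L ^ 2 ≤ κ / (4 * N) := by
    have : κ / (4 * N) = 2 * η / N ^ 2 * L ^ 2 + 8 * m * L ^ 3 * η ^ 2 * d / N ^ 3 := by
      rw [hκ]; field_simp; ring
    have : 0 ≤ 8 * m * L ^ 3 * η ^ 2 * d / N ^ 3 := by positivity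
    linarith
  -- the size of the remaining coefficient
  have g3 : B ≤ 56 * (η ^ 2 * L / N ^ 3) := by
    have e : B = η ^ 2 * L / N ^ 3
        * (4 + 48 * (L * η * N) + 4 * (48 * m * (η ^ 2 * d * L ^ 2))) := by
      rw [hB, hκ]; field_simp; ring
    rw [e, mul_comm 56]
    refine mul_le_mul_of_nonneg_left ?_ (by positivity)
    linarith
  have g4 : 56 * (η ^ 2 * L / N ^ 3) * (m * D) ≤ η / (2 * N) := by
    have e : 56 * (η ^ 2 * L / N ^ 3) * (m * D)
        = η / (2 * N) * ((112 * m * (L * η * D)) / N ^ 2) := by field_simp; ring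
    rw [e]
    refine mul_le_of_le_one_right (by positivity) ?_
    rw [div_le_one (by positivity)]
    exact h1
  have s1 := mul_le_mul_of_nonneg_right g1 hΓ
  have s2 := mul_le_mul_of_nonneg_right g2 hΓ
  have s3 := mul_le_mul_of_nonneg_right g3 (show 0 ≤ m * (D * a + (Q + c * (L ^ 2 * η ^ 2 * d ^ 2)))
    by positivity)
  have s4 := mul_le_mul_of_nonneg_right g4 ha
  have e1 : 2 * η / N ^ 2 * (N * a / 2 - L ^ 2 * Γ - c ^ 2 * (L ^ 2 * η ^ 2) / N)
      = η / N * a - 2 * η / N ^ 2 * L ^ 2 * Γ - 2 * η / N ^ 3 * (c ^ 2 * (L ^ 2 * η ^ 2)) := by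
    field_simp
  have e2 : κ * ((1 - 1 / (2 * N)) * Γ) = κ * Γ - 2 * (κ / (4 * N) * Γ) := by field_simp; ring
  have e3 : η / (2 * N) * a = η / N * a - η / (2 * N) * a := by field_simp; ring
  rw [e2]
  rw [e1] at t1
  linarith

/-- Here `r` is the squared distance of the mean to the minimizer. Of the contraction `κ/(2N)`, a
quarter pays for the drift error, half for the second moments, and the last quarter provides the
factor `1 - ηℓ/(2N)` on `κ * Γ`. Since `a ≤ 4 * L * F`, the gradient noise is charged to half of the
decrease in `F`. -/
theorem drift_algebra_strongly_convex {N L ℓ η d D c m Γ a Q F I S κ r : ℝ} (hN : 2 ≤ N)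
    (hL : 0 < L) (hℓ : 0 < ℓ) (hη : 0 < η) (hd : 1 ≤ d) (hc : 0 ≤ c) (hm : 6 ≤ m) (hΓ : 0 ≤ Γ)
    (hF : 0 ≤ F) (hr : 0 ≤ r) (hQ : 0 ≤ Q) (hκ : κ = 32 * L * η / N) (haF : a ≤ 4 * L * F)
    (ha : 0 ≤ a) (hI : 2 * (N * F + N * (ℓ / 2 * r) - L * Γ - c * (L * η ^ 2)) ≤ I)
    (hS : S ≤ m * (d * L ^ 2 * Γ + D * a + Q + c * (L ^ 2 * η ^ 2 * d ^ 2)))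
    (hD : 0 ≤ D) (hDN : D ≤ d * N) (h1 : 392 * m * (d * L * η) ≤ 1) (h2 : η * ℓ ≤ 1 / 4)
    (h3 : L * η * N ≤ 1) :
    r - 2 * η / N ^ 2 * I + κ * ((1 - 1 / (2 * N)) * Γ) + η ^ 2 * (4 * 1 / N ^ 2 + 6 * κ) / N * S
      ≤ (1 - η * ℓ / (2 * N)) * (r + κ * Γ) - 2 * η / N * F
        + (4 * η ^ 3 * L * c / N ^ 2
          + 196 * m * (η ^ 2 / N ^ 3) * (Q + c * (L ^ 2 * η ^ 2 * d ^ 2))) := by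
  have hN0 : 0 < N := by linarith
  have hm0 : 0 < m := by linarith
  have hd0 : 0 < d := by linarith
  have hκ0 : 0 ≤ κ := by rw [hκ]; positivity
  set B := η ^ 2 * (4 * 1 / N ^ 2 + 6 * κ) / N with hB
  have hB0 : 0 ≤ B := by positivity
  have hx : 0 < d * L * η := by positivity
  have hmx : 6 * (d * L * η) ≤ m * (d * L * η) := mul_le_mul_of_nonneg_right hm hx.le
  have hLη : L * η ≤ 1 := by
    have : 1 * (L * η) ≤ d * (L * η) := mul_le_mul_of_nonneg_right hd (by positivity)
    linarith
  have t1 := mul_le_mul_of_nonneg_left hI (show 0 ≤ 2 * η / N ^ 2 by positivity)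
  have t2 := mul_le_mul_of_nonneg_left hS hB0
  have g1 : B * m * d * L ^ 2 ≤ κ / (4 * N) := by
    have e : B * m * d * L ^ 2
        = κ / (8 * N) * (m * (d * L * η) / N) + κ / (8 * N) * (48 * m * (d * L * η) * (L * η)) := by
      rw [hB, hκ]; field_simp; ring
    have k1 : m * (d * L * η) / N ≤ 1 := by
      rw [div_le_one hN0]
      linarith
    have k2 : 48 * m * (d * L * η) * (L * η) ≤ 1 :=
      mul_le_one₀ (by linarith) (by positivity) hLη
    have k3 : κ / (4 * N) = κ / (8 * N) * 1 + κ / (8 * N) * 1 := by field_simp; ring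
    rw [e, k3]
    gcongr
  have g2 : 4 * η * L / N ^ 2 = κ / (8 * N) := by rw [hκ]; field_simp; norm_num
  have g3 : B ≤ 196 * (η ^ 2 / N ^ 3) := by
    have e : B = η ^ 2 / N ^ 3 * (4 + 192 * (L * η * N)) := by
      rw [hB, hκ]; field_simp; ring
    rw [e, mul_comm 196]
    refine mul_le_mul_of_nonneg_left ?_ (by positivity)
    linarith
  have g4 : 196 * (η ^ 2 / N ^ 3) * (m * (D * a)) ≤ 2 * η / N * F := by
    have k1 : D * a ≤ d * N * (4 * L * F) := mul_le_mul hDN haF ha (by positivity)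
    calc 196 * (η ^ 2 / N ^ 3) * (m * (D * a))
        ≤ 196 * (η ^ 2 / N ^ 3) * (m * (d * N * (4 * L * F))) := by gcongr
      _ = 2 * η / N * F * ((392 * m * (d * L * η)) / N) := by field_simp; ring
      _ ≤ 2 * η / N * F := by
        refine mul_le_of_le_one_right (by positivity) ?_
        rw [div_le_one hN0]; linarith
  have g5 : κ / (8 * N) * Γ ≥ η * ℓ / (2 * N) * (κ * Γ) := by
    have e : κ / (8 * N) * Γ = 1 / 4 / (2 * N) * (κ * Γ) := by field_simp; ring
    rw [e]
    gcongr
  have s1 := mul_le_mul_of_nonneg_right g1 hΓ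
  have s3 := mul_le_mul_of_nonneg_right g3 (show 0 ≤ m * (D * a + (Q + c * (L ^ 2 * η ^ 2 * d ^ 2)))
    by positivity)
  have e1 : 2 * η / N ^ 2 * (2 * (N * F + N * (ℓ / 2 * r) - L * Γ - c * (L * η ^ 2)))
      = 2 * (2 * η / N * F) + 4 * (η * ℓ / (2 * N) * r) - 4 * η * L / N ^ 2 * Γ
        - 4 * η ^ 3 * L * c / N ^ 2 := by
    field_simp; ring
  have e2 : κ * ((1 - 1 / (2 * N)) * Γ) = κ * Γ - 4 * (κ / (8 * N) * Γ) := by field_simp; ring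
  have e3 : κ / (4 * N) * Γ = 2 * (κ / (8 * N) * Γ) := by field_simp; ring
  have p1 : 0 ≤ η * ℓ / (2 * N) * r := by positivity
  rw [e2]
  rw [e1, g2] at t1
  rw [e3] at s1
  linarith

end Algebra

end HDO

namespace HDO

theorem six_le_three_mul_estConst : 6 ≤ 3 * Problem.estConst := by
  unfold Problem.estConst
  linarith [gaussMoment_nonneg 4, gaussMoment_nonneg 6]

/-! ### Continuity and constant configurations. -/

section Continuity

variable {N : ℕ} {E : Type*} [NormedAddCommGroup E] [InnerProductSpace ℝ E]

theorem continuous_mean : Continuous (mean : (Fin N → E) → E) := by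
  unfold mean
  fun_prop

theorem continuous_spread : Continuous (spread : (Fin N → E) → ℝ) := by
  unfold spread
  have := continuous_mean (N := N) (E := E)
  fun_prop

theorem spread_const (hN : 0 < N) (x : E) : spread (fun _ : Fin N => x) = 0 :=
  le_antisymm ((spread_le hN _ x).trans (by simp)) (spread_nonneg _)

theorem mean_const (hN : 0 < N) (x : E) : mean (fun _ : Fin N => x) = x := by
  have : (N : ℝ) ≠ 0 := by positivity
  rw [mean, Finset.sum_const, Finset.card_univ, Fintype.card_fin, ← Nat.cast_smul_eq_nsmul ℝ,
    smul_smul, one_div_mul_cancel this, one_smul]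

end Continuity

/-! ### Telescoping the drift. -/

section Recursions

theorem sum_le_of_drift {v h : ℕ → ℝ} {K : ℝ} (hv : ∀ t, 0 ≤ v t)
    (hrec : ∀ t, v (t + 1) ≤ 1 * v t - h t + K) (T : ℕ) :
    ∑ t ∈ Finset.range T, h t ≤ v 0 + T * K := by
  have : ∑ t ∈ Finset.range T, h t + v T ≤ v 0 + T * K := by
    induction T with
    | zero => simp
    | succ T ih =>
      rw [Finset.sum_range_succ]
      push_cast
      linarith [hrec T]
  linarith [hv T]

/-- Multiplying step `t` by `q⁻⁽ᵗ⁺¹⁾` makes it telescope; hence weight `t` goes with time `t - 1`,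
as in `y_T`. -/
theorem weighted_sum_le_of_drift {v h : ℕ → ℝ} {q K : ℝ} (hq : 0 < q)
    (hrec : ∀ t, v (t + 1) ≤ q * v t - h t + K) (T : ℕ) :
    ∑ t ∈ Finset.Icc 1 T, (q ^ t)⁻¹ * h (t - 1) + (q ^ T)⁻¹ * v T
      ≤ v 0 + K * ∑ t ∈ Finset.Icc 1 T, (q ^ t)⁻¹ := by
  induction T with
  | zero => simp
  | succ T ih =>
    rw [Finset.sum_Icc_succ_top (by omega), Finset.sum_Icc_succ_top (by omega), Nat.add_sub_cancel]
    have h1 := mul_le_mul_of_nonneg_left (hrec T) (show 0 ≤ (q ^ (T + 1))⁻¹ by positivity)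
    have e : (q ^ (T + 1))⁻¹ * (q * v T - h T + K)
        = (q ^ T)⁻¹ * v T - (q ^ (T + 1))⁻¹ * h T + K * (q ^ (T + 1))⁻¹ := by
      rw [pow_succ]; field_simp
    rw [e] at h1
    linarith

theorem one_sub_mul_sum_inv_pow {q : ℝ} (hq : 0 < q) (T : ℕ) :
    (1 - q) * ∑ t ∈ Finset.Icc 1 T, (q ^ t)⁻¹ = (q ^ T)⁻¹ - 1 := by
  induction T with
  | zero => simp
  | succ T ih =>
    rw [Finset.sum_Icc_succ_top (by omega), mul_add, ih, pow_succ]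
    field_simp
    ring

end Recursions

/-! ### From step sizes to rates. -/

section FinalBounds

theorem rate_nonconvex {N d T L m c F Q : ℝ} (hN : 2 ≤ N) (hd : 1 ≤ d) (hT : 0 < T) (hL : 0 < L)
    (hm : 6 ≤ m) (hc : 0 ≤ c) (hc3 : c ≤ c ^ 3) (hF : 0 ≤ F) (hQ : 0 ≤ Q) {η A : ℝ}
    (hη : η = N / √(d * T)) (hT2 : N ^ 2 * L ^ 2 ≤ T) (hT4 : N * c ^ 3 * d ≤ T)
    (hA : η / (2 * N) * A ≤ F + T * (2 * η / N ^ 3 * (c ^ 2 * (L ^ 2 * η ^ 2))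
          + 56 * m * (η ^ 2 * L / N ^ 3) * (Q + c * (L ^ 2 * η ^ 2 * d ^ 2)))) :
    1 / T * A ≤ (112 * m + 6) * (F + L * (Q / (N * d)) + L ^ 2 * √(c / N)) * √(d / T) := by
  have hN0 : 0 < N := by linarith
  have hd0 : 0 < d := by linarith
  obtain ⟨δ, hδ, rfl⟩ : ∃ δ : ℝ, 0 < δ ∧ d = δ ^ 2 :=
    ⟨√d, Real.sqrt_pos.2 hd0, (Real.sq_sqrt hd0.le).symm⟩
  obtain ⟨τ, hτ, rfl⟩ : ∃ τ : ℝ, 0 < τ ∧ T = τ ^ 2 :=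
    ⟨√T, Real.sqrt_pos.2 hT, (Real.sq_sqrt hT.le).symm⟩
  rw [← mul_pow, Real.sqrt_sq (by positivity)] at hη
  rw [← div_pow, Real.sqrt_sq (by positivity)]
  have hη0 : 0 < η := by rw [hη]; positivity
  set ρ := √(c / N)
  have hρ : ρ ^ 2 = c / N := Real.sq_sqrt (by positivity)
  have hρ0 : 0 ≤ ρ := Real.sqrt_nonneg _
  have hcN : c = N * ρ ^ 2 := by rw [hρ]; field_simp
  -- The bias of the mean estimators is absorbed into `L² √(n₀/n)`; this is where the lower bound `n
  -- n₀³ d` on `T` is needed.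
  have b1 : c ^ 2 ≤ ρ * δ ^ 3 * τ := by
    refine abs_le_of_sq_le_sq' ?_ (by positivity) |>.2
    have k1 : N * c ^ 3 ≤ τ ^ 2 :=
      (le_mul_of_one_le_right (by positivity) hd).trans hT4
    calc (c ^ 2) ^ 2 = c / N * (N * c ^ 3) := by field_simp
      _ ≤ c / N * τ ^ 2 := by gcongr
      _ ≤ c / N * τ ^ 2 * (δ ^ 2) ^ 3 := le_mul_of_one_le_right (by positivity) (one_le_pow₀ hd)
      _ = (ρ * δ ^ 3 * τ) ^ 2 := by rw [← hρ]; ring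
  -- The finite-difference error in the second moments. It needs only `N * c ≤ T`, and `c ≤ c ^ 3`
  -- holds because `c` will be a natural number.
  have b2 : L * c * N ≤ ρ * τ ^ 2 := by
    refine abs_le_of_sq_le_sq' ?_ (by positivity) |>.2
    have k1 : N * c ≤ τ ^ 2 :=
      (mul_le_mul_of_nonneg_left hc3 hN0.le).trans
        ((le_mul_of_one_le_right (by positivity) hd).trans hT4)
    calc (L * c * N) ^ 2 = c / N * ((N ^ 2 * L ^ 2) * (N * c)) := by field_simp
      _ ≤ c / N * (τ ^ 2 * τ ^ 2) := by gcongr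
      _ = (ρ * τ ^ 2) ^ 2 := by rw [← hρ]; ring
  have hA' : 1 / τ ^ 2 * A ≤ 2 * N / (η * τ ^ 2) * (F + τ ^ 2 *
      (2 * η / N ^ 3 * (c ^ 2 * (L ^ 2 * η ^ 2))
          + 56 * m * (η ^ 2 * L / N ^ 3) * (Q + c * (L ^ 2 * η ^ 2 * (δ ^ 2) ^ 2)))) := by
    have := mul_le_mul_of_nonneg_left hA (show 0 ≤ 2 * N / (η * τ ^ 2) by positivity)
    refine le_trans (le_of_eq ?_) this
    field_simp
  refine hA'.trans ?_
  have e : 2 * N / (η * τ ^ 2) * (F + τ ^ 2 *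
      (2 * η / N ^ 3 * (c ^ 2 * (L ^ 2 * η ^ 2))
          + 56 * m * (η ^ 2 * L / N ^ 3) * (Q + c * (L ^ 2 * η ^ 2 * (δ ^ 2) ^ 2))))
      = 2 * (F * (δ / τ)) + 4 * (L ^ 2 / (δ ^ 2 * τ ^ 2) * c ^ 2)
        + 112 * m * (L * (Q / (N * δ ^ 2)) * (δ / τ))
        + 112 * m * (L ^ 2 * δ / τ ^ 3 * (L * c * N)) := by
    rw [hη]; field_simp; ring
  have c1 : L ^ 2 / (δ ^ 2 * τ ^ 2) * c ^ 2 ≤ L ^ 2 * ρ * (δ / τ) := by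
    calc L ^ 2 / (δ ^ 2 * τ ^ 2) * c ^ 2 ≤ L ^ 2 / (δ ^ 2 * τ ^ 2) * (ρ * δ ^ 3 * τ) := by gcongr
      _ = L ^ 2 * ρ * (δ / τ) := by field_simp
  have c2 : L ^ 2 * δ / τ ^ 3 * (L * c * N) ≤ L ^ 2 * ρ * (δ / τ) := by
    calc L ^ 2 * δ / τ ^ 3 * (L * c * N) ≤ L ^ 2 * δ / τ ^ 3 * (ρ * τ ^ 2) := by gcongr
      _ = L ^ 2 * ρ * (δ / τ) := by field_simp
  have p1 : 0 ≤ F * (δ / τ) := by positivity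
  have p2 : 0 ≤ L * (Q / (N * δ ^ 2)) * (δ / τ) := by positivity
  have p3 : 0 ≤ L ^ 2 * ρ * (δ / τ) := by positivity
  have c3 := mul_le_mul_of_nonneg_left c2 (show 0 ≤ 112 * m by linarith)
  have p4 : 0 ≤ m * (F * (δ / τ)) := mul_nonneg (by linarith) p1
  have e2 : (112 * m + 6) * (F + L * (Q / (N * δ ^ 2)) + L ^ 2 * ρ) * (δ / τ)
      = (112 * m + 6) * (F * (δ / τ)) + (112 * m + 6) * (L * (Q / (N * δ ^ 2)) * (δ / τ))
        + (112 * m + 6) * (L ^ 2 * ρ * (δ / τ)) := by ring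
  rw [e, e2]
  linarith

/-- Three of the lower bounds on `T` correspond, in order, to the three step-size conditions. The
first and third are compared after squaring, since `η` scales like `T^(-1/2)`; hence the squared
constant. -/
theorem step_size_nonconvex {N d T L m D η : ℝ} (hN : 2 ≤ N) (hd : 1 ≤ d) (hT : 0 < T)
    (hL : 0 < L) (hm : 6 ≤ m) (hη : η = N / √(d * T))
    (hT1 : (112 * m) ^ 2 * (L ^ 2 * D ^ 2 / (d * N ^ 2)) ≤ T)
    (hT2 : (112 * m) ^ 2 * (N ^ 2 * L ^ 2) ≤ T) (hT3 : N ^ 4 * L ^ 2 / d ≤ T) :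
    112 * m * (L * η * D) ≤ N ^ 2 ∧ 48 * m * (η ^ 2 * d * L ^ 2) ≤ 1 ∧ L * η * N ≤ 1 := by
  have hN0 : 0 < N := by linarith
  have hd0 : 0 < d := by linarith
  have hs : 0 < √(d * T) := Real.sqrt_pos.2 (by positivity)
  have hs2 : √(d * T) ^ 2 = d * T := Real.sq_sqrt (by positivity)
  set p := √(d * T)
  refine ⟨?_, ?_, ?_⟩
  · have k : 112 * m * (L * D) ≤ N * p := by
      refine abs_le_of_sq_le_sq' ?_ (by positivity) |>.2
      rw [← mul_div_assoc, div_le_iff₀ (by positivity)] at hT1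
      calc (112 * m * (L * D)) ^ 2 = (112 * m) ^ 2 * (L ^ 2 * D ^ 2) := by ring
        _ ≤ T * (d * N ^ 2) := hT1
        _ = (N * p) ^ 2 := by rw [mul_pow, hs2]; ring
    have e : 112 * m * (L * η * D) = N / p * (112 * m * (L * D)) := by rw [hη]; ring
    rw [e]
    calc N / p * (112 * m * (L * D)) ≤ N / p * (N * p) := by gcongr
      _ = N ^ 2 := by field_simp
  · have e : 48 * m * (η ^ 2 * d * L ^ 2) = 48 * m * (N ^ 2 * L ^ 2) / T := by
      rw [hη, div_pow, hs2]; field_simp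
    rw [e, div_le_one hT]
    refine le_trans ?_ hT2
    refine mul_le_mul_of_nonneg_right ?_ (by positivity)
    nlinarith
  · have k : L * N ^ 2 ≤ p := by
      refine abs_le_of_sq_le_sq' ?_ hs.le |>.2
      rw [div_le_iff₀ hd0] at hT3
      rw [hs2]
      linarith
    have e : L * η * N = L * N ^ 2 / p := by rw [hη]; ring
    rw [e, div_le_one hs]
    exact k

theorem step_size_strongly_convex {N d T L ℓ m η : ℝ} (hN : 2 ≤ N) (hd : 1 ≤ d) (hT : 2 ≤ T)
    (hL : 0 < L) (hℓ : 0 < ℓ) (hℓL : ℓ ≤ L) (hm : 6 ≤ m) (hη : η = 4 * N * Real.log T / (T * ℓ))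
    (hTT : 4 * (392 * m) * (N * (d + N) * (L + 1) * (1 / ℓ + 1) / ℓ) ≤ T / Real.log T) :
    392 * m * (d * L * η) ≤ 1 ∧ η * ℓ ≤ 1 / 4 ∧ L * η * N ≤ 1 := by
  have hN0 : 0 < N := by linarith
  have hd0 : 0 < d := by linarith
  have hT0 : 0 < T := by linarith
  have hlog : 0 < Real.log T := Real.log_pos (by linarith)
  have hη0 : 0 < η := by rw [hη]; positivity
  -- This is the hypothesis on `T / log T` rewritten with `η`; all three conditions follow from it,
  -- the second using `ℓ ≤ L ≤ d * L`.
  have key : 392 * m * (η * ((d + N) * (L + 1) * (1 / ℓ + 1))) ≤ 1 := by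
    have e : 392 * m * (η * ((d + N) * (L + 1) * (1 / ℓ + 1)))
        = Real.log T / T * (4 * (392 * m) * (N * (d + N) * (L + 1) * (1 / ℓ + 1) / ℓ)) := by
      rw [hη]; field_simp
    rw [e]
    calc _ ≤ Real.log T / T * (T / Real.log T) := by gcongr
      _ = 1 := by field_simp
  have hG : (d + N) * L ≤ (d + N) * (L + 1) * (1 / ℓ + 1) := by
    have h1 : (0 : ℝ) < 1 / ℓ := by positivity
    calc (d + N) * L ≤ (d + N) * (L + 1) := by gcongr; linarith
      _ ≤ (d + N) * (L + 1) * (1 / ℓ + 1) := le_mul_of_one_le_right (by positivity) (by linarith)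
  have key2 : 392 * m * (η * ((d + N) * L)) ≤ 1 := by
    refine le_trans ?_ key
    gcongr
  have p1 : 0 < η * (d * L) := by positivity
  have p2 : 0 < η * (N * L) := by positivity
  have e : η * ((d + N) * L) = η * (d * L) + η * (N * L) := by ring
  rw [e] at key2
  have q1 : 6 * (η * (d * L)) ≤ m * (η * (d * L)) := mul_le_mul_of_nonneg_right hm p1.le
  have q2 : 6 * (η * (N * L)) ≤ m * (η * (N * L)) := mul_le_mul_of_nonneg_right hm p2.le
  refine ⟨?_, ?_, ?_⟩
  · linarith
  · have : η * ℓ ≤ η * (d * L) := by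
      gcongr
      exact hℓL.trans (le_mul_of_one_le_left hL.le hd)
    linarith
  · linarith

theorem rate_strongly_convex {N d T L ℓ m c r Q η S w A R : ℝ} (hN : 2 ≤ N) (hd : 1 ≤ d)
    (hT : 2 ≤ T) (hL : 0 < L) (hℓ : 0 < ℓ) (hℓL : ℓ ≤ L) (hm : 6 ≤ m) (hc : 0 ≤ c) (hr : 0 ≤ r)
    (hQ : 0 ≤ Q) (hR : 0 ≤ R) (hη : η = 4 * N * Real.log T / (T * ℓ))
    (h1 : 392 * m * (d * L * η) ≤ 1) (h3 : L * η * N ≤ 1) (hS : 0 < S)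
    (hwS : η * ℓ / (2 * N) * S ≤ w) (hST : T ^ 2 ≤ S)
    (hA : 2 * η / N * (A * S) + w * R ≤ r + (4 * η ^ 3 * L * c / N ^ 2
          + 196 * m * (η ^ 2 / N ^ 3) * (Q + c * (L ^ 2 * η ^ 2 * d ^ 2))) * S) :
    A + ℓ * R / 8 ≤ (392 * m + 8) * (L * r / (T * Real.log T)
      + Real.log T * Q / (T * ℓ * N) + Real.log T * (d * c) / (T * ℓ * N)) := by
  have hN0 : 0 < N := by linarith
  have hd0 : 0 < d := by linarith
  have hT0 : 0 < T := by linarith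
  have hm0 : 0 < m := by linarith
  have hlog : 0 < Real.log T := Real.log_pos (by linarith)
  have hη0 : 0 < η := by rw [hη]; positivity
  set K := 4 * η ^ 3 * L * c / N ^ 2
          + 196 * m * (η ^ 2 / N ^ 3) * (Q + c * (L ^ 2 * η ^ 2 * d ^ 2)) with hK
  have a1 := mul_le_mul_of_nonneg_right hwS hR
  -- The telescoped inequality is divided by `2ηS/N`. The bound `hwS` turns the final weight into
  -- `ℓ/4`, twice what is needed.
  have a2 : A + ℓ * R / 4 ≤ N / (2 * η) * (r / S) + N / (2 * η) * K := by
    have e1 : A + ℓ * R / 4 = N / (2 * η * S) * (2 * η / N * (A * S) + η * ℓ / (2 * N) * S * R) := by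
      field_simp
      ring
    have e2 : N / (2 * η) * (r / S) + N / (2 * η) * K = N / (2 * η * S) * (r + K * S) := by
      field_simp
    rw [e1, e2]
    refine mul_le_mul_of_nonneg_left ?_ (by positivity)
    linarith
  have a3 : N / (2 * η) * (r / S) ≤ L * r / (T * Real.log T) := by
    calc N / (2 * η) * (r / S) ≤ N / (2 * η) * (r / T ^ 2) := by gcongr
      _ = 1 / 8 * (ℓ * r / (T * Real.log T)) := by rw [hη]; field_simp; ring
      _ ≤ 1 * (L * r / (T * Real.log T)) := by gcongr; norm_num
      _ = _ := one_mul _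
  have a4 : N / (2 * η) * K = Real.log T / (T * ℓ * N)
      * (8 * (L * η * N * c) + 392 * m * (Q + d * c * ((d * L * η) * (L * η)))) := by
    rw [hK, hη]; field_simp; ring
  have hx : 0 < d * L * η := by positivity
  have hmx : 6 * (d * L * η) ≤ m * (d * L * η) := mul_le_mul_of_nonneg_right hm hx.le
  have hLη : L * η ≤ 1 := by
    have : 1 * (L * η) ≤ d * (L * η) := mul_le_mul_of_nonneg_right hd (by positivity)
    linarith
  have a5 : 8 * (L * η * N * c) + 392 * m * (Q + d * c * ((d * L * η) * (L * η)))
      ≤ (392 * m + 8) * (Q + d * c) := by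
    have b1 : L * η * N * c ≤ 1 * (d * c) :=
      mul_le_mul h3 (le_mul_of_one_le_left hc hd) hc zero_le_one
    have b2 : d * c * ((d * L * η) * (L * η)) ≤ d * c :=
      mul_le_of_le_one_right (by positivity) (mul_le_one₀ (by linarith) (by positivity) hLη)
    have b3 := mul_le_mul_of_nonneg_left b2 (show 0 ≤ 392 * m by positivity)
    linarith
  have a6 := mul_le_mul_of_nonneg_left a5 (show 0 ≤ Real.log T / (T * ℓ * N) by positivity)
  rw [← a4] at a6
  have e : Real.log T / (T * ℓ * N) * ((392 * m + 8) * (Q + d * c)) = (392 * m + 8) *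
      (Real.log T * Q / (T * ℓ * N) + Real.log T * (d * c) / (T * ℓ * N)) := by ring
  have p1 : 0 ≤ L * r / (T * Real.log T) := by positivity
  have p2 : 0 ≤ m * (L * r / (T * Real.log T)) := by positivity
  have p3 : 0 ≤ ℓ * R := by positivity
  rw [e] at a6
  linarith

end FinalBounds

end HDO

namespace HDO

namespace Problem

/-! ### The two rates for a run of the algorithm. -/

section Rates

variable {d n₀ n₁ : ℕ} {P : Problem.{u} d n₀ n₁} {L : ℝ} {s : Fin (n₀ + n₁) → ℝ}

theorem continuous_obj (hP : P.WellDefined) (hS : P.Smooth L) (hV : P.BoundedVariance s)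
    (hL : 0 ≤ L) : Continuous P.obj :=
  continuous_iff_continuousAt.2 fun x => (hasGradientAt_obj hP hS hV hL x).continuousAt

theorem continuous_gradient_obj (hP : P.WellDefined) (hS : P.Smooth L)
    (hV : P.BoundedVariance s) (hL : 0 ≤ L) : Continuous (gradient P.obj) := by
  have h : gradient P.obj
      = fun x => (1 / ((n₀ + n₁ : ℕ) : ℝ)) • ∑ i, gradient (P.localObj i) x :=
    funext (gradient_obj hP hS hV hL)
  have hc := continuous_gradient_localObj hS hV
  rw [h]
  fun_prop

theorem noise_nonneg (d n₀ n₁ : ℕ) (s : Fin (n₀ + n₁) → ℝ) (ς₀ ς₁ : ℝ) :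
    0 ≤ ((d * n₀ * ς₀ ^ 2 + n₁ * ς₁ ^ 2)
        + (d * n₀ * sigmaSqZeroth s + n₁ * sigmaSqFirst s) : ℝ) := by
  have h0 : 0 ≤ sigmaSqZeroth s := by unfold sigmaSqZeroth; positivity
  have h1 : 0 ≤ sigmaSqFirst s := by unfold sigmaSqFirst; positivity
  positivity

theorem cast_le_cast_pow_three (n : ℕ) : (n : ℝ) ≤ (n : ℝ) ^ 3 := by
  exact_mod_cast Nat.le_self_pow (by norm_num) n

variable {Ω : Type v} [MeasurableSpace Ω] {Pr : Measure Ω} [IsProbabilityMeasure Pr]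
  {W : ℕ → Ω → P.Input}

theorem nonconvex_rate {ς₀ ς₁ m : ℝ} (hm : m = 3 * estConst) {x₀ : Vec d} {T : ℕ} {η ν : ℝ}
    (hd : 1 ≤ d) (hn : 2 ≤ n₀ + n₁) (hL : 0 < L) (hP : P.WellDefined) (hS : P.Smooth L)
    (hB : P.Balanced ς₀ ς₁) (hV : P.BoundedVariance s) (hbdd : BddBelow (Set.range P.obj))
    (hT : (112 * m) ^ 2 * max (max (L ^ 2 * (d * n₀ + n₁) ^ 2 / (d * ((n₀ + n₁ : ℕ) : ℝ) ^ 2))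
        (((n₀ + n₁ : ℕ) : ℝ) ^ 2 * L ^ 2))
      (max (((n₀ + n₁ : ℕ) : ℝ) ^ 4 * L ^ 2 / d) (((n₀ + n₁ : ℕ) : ℝ) * n₀ ^ 3 * d)) ≤ T)
    (hη : η = ((n₀ + n₁ : ℕ) : ℝ) / √(d * T)) (hν : ν = η / √d) (hW : P.IsInput Pr W) :
    (∀ t < T, Integrable
      (fun ω => ‖gradient P.obj (P.meanModel η ν x₀ (fun r => W r ω) t)‖ ^ 2) Pr) ∧
    (1 / (T : ℝ)) * ∑ t ∈ Finset.range T,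
        ∫ ω, ‖gradient P.obj (P.meanModel η ν x₀ (fun r => W r ω) t)‖ ^ 2 ∂Pr
      ≤ (112 * m + 6) * ((P.obj x₀ - ⨅ x, P.obj x)
          + L * (((d * n₀ * ς₀ ^ 2 + n₁ * ς₁ ^ 2)
              + (d * n₀ * sigmaSqZeroth s + n₁ * sigmaSqFirst s)) / (((n₀ + n₁ : ℕ) : ℝ) * d))
          + L ^ 2 * √(n₀ / ((n₀ + n₁ : ℕ) : ℝ))) * √(d / T) := by
  have hm6 : 6 ≤ m := hm ▸ six_le_three_mul_estConst
  have hn0 : 0 < n₀ + n₁ := by omega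
  set N : ℝ := ((n₀ + n₁ : ℕ) : ℝ) with hN
  have hN2 : (2 : ℝ) ≤ N := by rw [hN]; exact_mod_cast hn
  have hN0 : 0 < N := by linarith
  have hd' : (1 : ℝ) ≤ d := by exact_mod_cast hd
  have hd0 : (0 : ℝ) < d := by linarith
  have hC : 1 ≤ (112 * m) ^ 2 := one_le_pow₀ (by linarith)
  have hM := fun x (hx : x ≤ max (max (L ^ 2 * (d * n₀ + n₁) ^ 2 / (d * N ^ 2)) (N ^ 2 * L ^ 2))
      (max (N ^ 4 * L ^ 2 / d) (N * n₀ ^ 3 * d))) =>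
    (mul_le_mul_of_nonneg_left hx (by positivity : 0 ≤ (112 * m) ^ 2)).trans hT
  have hT1 := hM _ ((le_max_left _ _).trans (le_max_left _ _))
  have hT2 := hM _ ((le_max_right _ _).trans (le_max_left _ _))
  have hT3 := hM _ ((le_max_left _ _).trans (le_max_right _ _))
  have hT4 := hM _ ((le_max_right _ _).trans (le_max_right _ _))
  have hT0 : (0 : ℝ) < T := lt_of_lt_of_le (by positivity) hT2
  have drop : ∀ {x : ℝ}, 0 ≤ x → (112 * m) ^ 2 * x ≤ T → x ≤ T := fun hx h =>
    (le_mul_of_one_le_left hx hC).trans h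
  obtain ⟨c1, c2, c3⟩ := step_size_nonconvex (D := d * n₀ + n₁) hN2 hd' hT0 hL hm6 hη hT1 hT2
    (drop (by positivity) hT3)
  have hη0 : 0 < η := by rw [hη]; positivity
  have hsd : 0 < √(d : ℝ) := Real.sqrt_pos.2 hd0
  have hν0 : 0 < ν := by rw [hν]; positivity
  have hν1 : ν * √d = η := by rw [hν]; field_simp
  have hν2 : ν ^ 2 * d = η ^ 2 := by rw [← hν1, mul_pow, Real.sq_sqrt hd0.le]
  have hg := hasGradientAt_obj hP hS hV hL.le
  have hLip := norm_gradient_obj_sub_le hP hS hV hL.le hn0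
  set fs := ⨅ x, P.obj x
  have hfs : ∀ x, fs ≤ P.obj x := fun x => ciInf_le hbdd x
  set Q : ℝ := (d * n₀ * ς₀ ^ 2 + n₁ * ς₁ ^ 2)
    + (d * n₀ * sigmaSqZeroth s + n₁ * sigmaSqFirst s) with hQ
  have hQ0 : 0 ≤ Q := noise_nonneg d n₀ n₁ s ς₀ ς₁
  set κ := 8 * L ^ 2 * η / N + 32 * m * L ^ 3 * η ^ 2 * d / N ^ 2 with hκ
  have hκ0 : 0 ≤ κ := by rw [hκ]; positivity
  set V : (Fin (n₀ + n₁) → Vec d) → ℝ := fun X => (P.obj (mean X) - fs) + κ * spread X with hVdef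
  set h : (Fin (n₀ + n₁) → Vec d) → ℝ := fun X => η / (2 * N) * ‖gradient P.obj (mean X)‖ ^ 2
    with hh
  have cV : Continuous V :=
    (((continuous_obj hP hS hV hL.le).comp continuous_mean).sub continuous_const).add
      (continuous_spread.const_mul κ)
  have ch : Continuous h :=
    (((continuous_gradient_obj hP hS hV hL.le).comp continuous_mean).norm.pow 2).const_mul _
  set K := 2 * η / N ^ 3 * ((n₀ : ℝ) ^ 2 * (L ^ 2 * η ^ 2))
          + 56 * m * (η ^ 2 * L / N ^ 3) * (Q + n₀ * (L ^ 2 * η ^ 2 * d ^ 2)) with hK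
  have hV0 : ∀ X, 0 ≤ V X := fun X =>
    add_nonneg (sub_nonneg.2 (hfs _)) (mul_nonneg hκ0 (spread_nonneg _))
  have main := integrable_and_drift hP hS hW η ν x₀ (V := V) (h := h) (q := 1) (K := K)
    cV.measurable ch.measurable hV0 (fun X => by positivity)
    -- The requirement `h ≤ V`: the squared gradient is at most `4 L (f - f*)`, and `L * η * N ≤ 1`
    -- makes the resulting coefficient at most one.
    (fun X => by
      have t1 := mul_le_mul_of_nonneg_left (sq_norm_gradient_le hL hg hLip hfs (mean X))
        (show 0 ≤ η / (2 * N) by positivity)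
      have t2 : η / (2 * N) * (4 * L * (P.obj (mean X) - fs))
          = (2 * (L * η * N) / N ^ 2) * (P.obj (mean X) - fs) := by field_simp; ring
      have t3 : 2 * (L * η * N) / N ^ 2 ≤ 1 := by
        have : (2 : ℝ) ^ 2 ≤ N ^ 2 := pow_le_pow_left₀ zero_le_two hN2 2
        rw [div_le_one (by positivity)]
        linarith
      have t4 := mul_le_of_le_one_left (sub_nonneg.2 (hfs (mean X))) t3
      have t5 := mul_nonneg hκ0 (spread_nonneg X)
      simp only [hh, hVdef]
      linarith)
    (by positivity)
    (fun X => by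
      have hstep : ∀ g, P.obj (mean X - g) - fs ≤ P.obj (mean X) - fs
          - inner ℝ (gradient P.obj (mean X)) g + L * ‖g‖ ^ 2 := by
        intro g
        have t := (abs_le.1 (abs_sub_linearization_le hL.le hg hLip (mean X) (mean X - g))).2
        rw [sub_sub_cancel_left, inner_neg_right, norm_neg] at t
        linarith
      refine (lintegral_lyapunov_interact_le hP hS hV hL.le hn hν0 hκ0 hL.le X
        (φ := fun x => P.obj x - fs) (η := η) (fun x => sub_nonneg.2 (hfs x)) _ hstep).trans
        (ENNReal.ofReal_le_ofReal ?_)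
      exact drift_algebra_nonconvex hN2 hL hη0 hd' (Nat.cast_nonneg n₀) hm6 (spread_nonneg X)
        (sq_nonneg _) hQ0 hκ
        (inner_gradient_sum_estMean_ge hP hS hV hL.le hd hn0 hν0 hν1 X)
        (hm ▸ sum_estSq_le hP hS hV hL.le hB hd hν0 hν2 X) (by positivity) c1 c2 c3)
  have hint : ∀ t, Integrable
      (fun ω => ‖gradient P.obj (P.meanModel η ν x₀ (fun r => W r ω) t)‖ ^ 2) Pr := by
    intro t
    have := (main t).2.1.const_mul (η / (2 * N))⁻¹
    refine this.congr (Filter.Eventually.of_forall fun ω => ?_)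
    simp only [hh]
    rw [inv_mul_cancel_left₀ (by positivity)]
    rfl
  refine ⟨fun t _ => hint t, ?_⟩
  have tele := sum_le_of_drift
    (v := fun t => ∫ ω, V (P.models η ν x₀ (fun r => W r ω) t) ∂Pr)
    (h := fun t => ∫ ω, h (P.models η ν x₀ (fun r => W r ω) t) ∂Pr)
    (fun t => integral_nonneg fun ω => hV0 _) (fun t => (main t).2.2) T
  have hinit : ∫ ω, V (P.models η ν x₀ (fun r => W r ω) 0) ∂Pr = P.obj x₀ - fs := by
    simp only [models, hVdef, spread_const hn0, mean_const hn0]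
    simp
  simp only [hh, integral_const_mul, ← Finset.mul_sum] at tele
  rw [hinit] at tele
  exact rate_nonconvex hN2 hd' hT0 hL hm6 (Nat.cast_nonneg n₀) (cast_le_cast_pow_three n₀)
    (sub_nonneg.2 (hfs x₀)) hQ0 hη (drop (by positivity) hT2) (drop (by positivity) hT4) tele

/-- Both conditions are tested on a unit vector, which exists because `d ≥ 1`. -/
theorem strong_convexity_le_smoothness (hP : P.WellDefined) (hS : P.Smooth L)
    (hV : P.BoundedVariance s) (hL : 0 ≤ L) (hn : 0 < n₀ + n₁) (hd : 1 ≤ d) {ℓ : ℝ}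
    (hc : StronglyConvex ℓ P.obj) : ℓ ≤ L := by
  have h1 := hc (EuclideanSpace.single ⟨0, hd⟩ (1 : ℝ)) 0
  have h2 := norm_gradient_obj_sub_le hP hS hV hL hn (EuclideanSpace.single ⟨0, hd⟩ (1 : ℝ)) 0
  have h3 := real_inner_le_norm (EuclideanSpace.single ⟨0, hd⟩ (1 : ℝ) - 0)
    (gradient P.obj (EuclideanSpace.single ⟨0, hd⟩ (1 : ℝ)) - gradient P.obj 0)
  simp only [sub_zero, PiLp.norm_single, norm_one, one_pow, mul_one, one_mul] at h1 h2 h3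
  linarith

/-- Jensen's inequality for the strongly convex objective. -/
theorem obj_weighted_sum_le (hP : P.WellDefined) (hS : P.Smooth L) (hV : P.BoundedVariance s)
    (hL : 0 ≤ L) {ℓ : ℝ} (hℓ : 0 ≤ ℓ) (hc : StronglyConvex ℓ P.obj) {ι : Type*} (t : Finset ι)
    (c : ι → ℝ) (hc0 : ∀ i ∈ t, 0 ≤ c i) (hc1 : ∑ i ∈ t, c i = 1) (z : ι → Vec d) :
    P.obj (∑ i ∈ t, c i • z i) ≤ ∑ i ∈ t, c i * P.obj (z i) := by
  set y := ∑ i ∈ t, c i • z i with hy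
  have h : ∀ i ∈ t, c i * (P.obj y + inner ℝ (gradient P.obj y) (z i - y)) ≤ c i * P.obj (z i) := by
    intro i hi
    refine mul_le_mul_of_nonneg_left ?_ (hc0 i hi)
    have := quadratic_lower_bound (hasGradientAt_obj hP hS hV hL) hc y (z i)
    have : 0 ≤ ℓ / 2 * ‖z i - y‖ ^ 2 := by positivity
    linarith
  refine le_trans (le_of_eq ?_) (Finset.sum_le_sum h)
  simp_rw [mul_add, Finset.sum_add_distrib, ← inner_smul_right, ← inner_sum, smul_sub,
    Finset.sum_sub_distrib, ← Finset.sum_smul, ← Finset.sum_mul, hc1, ← hy]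
  simp

theorem strongly_convex_rate {ς₀ ς₁ m ℓ : ℝ} (hm : m = 3 * estConst) {x₀ xstar : Vec d} {T : ℕ}
    {η ν : ℝ} (hd : 1 ≤ d) (hn : 2 ≤ n₀ + n₁) (hℓ : 0 < ℓ) (hL : 0 < L) (hP : P.WellDefined)
    (hS : P.Smooth L) (hB : P.Balanced ς₀ ς₁) (hV : P.BoundedVariance s)
    (hc : StronglyConvex ℓ P.obj) (hci : ∀ i, StronglyConvex ℓ (P.localObj i))
    (hmin : ∀ x, P.obj xstar ≤ P.obj x) (hT : 2 ≤ T)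
    (hTT : 4 * (392 * m) * (((n₀ + n₁ : ℕ) : ℝ) * (d + ((n₀ + n₁ : ℕ) : ℝ)) * (L + 1)
      * (1 / ℓ + 1) / ℓ) ≤ T / Real.log T)
    (hη : η = 4 * ((n₀ + n₁ : ℕ) : ℝ) * Real.log T / (T * ℓ)) (hν : ν = η / √d)
    (hW : P.IsInput Pr W) :
    Integrable (fun ω => P.obj (P.weightedMean η ν ℓ x₀ (fun r => W r ω) T)) Pr ∧
    Integrable (fun ω => ‖P.meanModel η ν x₀ (fun r => W r ω) T - xstar‖ ^ 2) Pr ∧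
    ∫ ω, (P.obj (P.weightedMean η ν ℓ x₀ (fun r => W r ω) T) - P.obj xstar) ∂Pr
        + ℓ * (∫ ω, ‖P.meanModel η ν x₀ (fun r => W r ω) T - xstar‖ ^ 2 ∂Pr) / 8
      ≤ (392 * m + 8) * (L * ‖x₀ - xstar‖ ^ 2 / (T * Real.log T)
          + Real.log T * ((d * n₀ * ς₀ ^ 2 + n₁ * ς₁ ^ 2)
              + (d * n₀ * sigmaSqZeroth s + n₁ * sigmaSqFirst s))
            / (T * ℓ * ((n₀ + n₁ : ℕ) : ℝ))
          + Real.log T * (d * n₀) / (T * ℓ * ((n₀ + n₁ : ℕ) : ℝ))) := by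
  have hm6 : 6 ≤ m := hm ▸ six_le_three_mul_estConst
  have hn0 : 0 < n₀ + n₁ := by omega
  set N : ℝ := ((n₀ + n₁ : ℕ) : ℝ) with hN
  have hN2 : (2 : ℝ) ≤ N := by rw [hN]; exact_mod_cast hn
  have hN0 : 0 < N := by linarith
  have hd' : (1 : ℝ) ≤ d := by exact_mod_cast hd
  have hd0 : (0 : ℝ) < d := by linarith
  have hT2 : (2 : ℝ) ≤ T := by exact_mod_cast hT
  have hT0 : (0 : ℝ) < T := by linarith
  have hlog : 0 < Real.log T := Real.log_pos (by linarith)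
  have hℓL := strong_convexity_le_smoothness hP hS hV hL.le hn0 hd hc
  obtain ⟨c1, c2, c3⟩ := step_size_strongly_convex hN2 hd' hT2 hL hℓ hℓL hm6 hη hTT
  have hη0 : 0 < η := by rw [hη]; positivity
  have hsd : 0 < √(d : ℝ) := Real.sqrt_pos.2 hd0
  have hν0 : 0 < ν := by rw [hν]; positivity
  have hν1 : ν * √d = η := by rw [hν]; field_simp
  have hν2 : ν ^ 2 * d = η ^ 2 := by rw [← hν1, mul_pow, Real.sq_sqrt hd0.le]
  have hg := hasGradientAt_obj hP hS hV hL.le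
  have hLip := norm_gradient_obj_sub_le hP hS hV hL.le hn0
  set Q : ℝ := (d * n₀ * ς₀ ^ 2 + n₁ * ς₁ ^ 2)
    + (d * n₀ * sigmaSqZeroth s + n₁ * sigmaSqFirst s) with hQ
  have hQ0 : 0 ≤ Q := noise_nonneg d n₀ n₁ s ς₀ ς₁
  have hD : (d * n₀ + n₁ : ℝ) ≤ d * N := by
    have := le_mul_of_one_le_left (Nat.cast_nonneg (α := ℝ) n₁) hd'
    rw [hN]; push_cast
    linarith
  set q := 1 - η * ℓ / (2 * N) with hq
  have hq1 : 1 / 2 ≤ q := by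
    have : η * ℓ / (2 * N) ≤ 1 / 2 := by
      rw [div_le_iff₀ (by positivity)]; linarith
    rw [hq]; linarith
  have hq0 : 0 < q := by linarith
  set κ := 32 * L * η / N with hκ
  have hκ0 : 0 ≤ κ := by rw [hκ]; positivity
  set V : (Fin (n₀ + n₁) → Vec d) → ℝ := fun X => ‖mean X - xstar‖ ^ 2 + κ * spread X with hVdef
  set h : (Fin (n₀ + n₁) → Vec d) → ℝ := fun X => 2 * η / N * (P.obj (mean X) - P.obj xstar)
    with hh
  have cV : Continuous V :=
    ((continuous_mean.sub continuous_const).norm.pow 2).add (continuous_spread.const_mul κ)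
  have ch : Continuous h :=
    (((continuous_obj hP hS hV hL.le).comp continuous_mean).sub continuous_const).const_mul _
  set K := 4 * η ^ 3 * L * (n₀ : ℝ) / N ^ 2
          + 196 * m * (η ^ 2 / N ^ 3) * (Q + n₀ * (L ^ 2 * η ^ 2 * d ^ 2)) with hK
  have hV0 : ∀ X, 0 ≤ V X := fun X =>
    add_nonneg (sq_nonneg _) (mul_nonneg hκ0 (spread_nonneg _))
  have hF0 : ∀ x, 0 ≤ P.obj x - P.obj xstar := fun x => sub_nonneg.2 (hmin x)
  have hh0 : ∀ X, 0 ≤ h X := fun X => mul_nonneg (by positivity) (hF0 _)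
  have hgrad0 : gradient P.obj xstar = 0 := by
    have := sq_norm_gradient_le hL hg hLip hmin xstar
    rw [sub_self, mul_zero] at this
    exact norm_eq_zero.1 (pow_eq_zero_iff two_ne_zero |>.1 (le_antisymm this (sq_nonneg _)))
  have main := integrable_and_drift hP hS hW η ν x₀ (V := V) (h := h) (q := q) (K := K)
    cV.measurable ch.measurable hV0 hh0
    -- The requirement `h ≤ q * V`: the gap is at most `L` times the squared distance, which costs a
    -- coefficient at most `1/2 ≤ q`.
    (fun X => by
      have t1 := (abs_le.1 (abs_sub_linearization_le hL.le hg hLip xstar (mean X))).2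
      rw [hgrad0, inner_zero_left, sub_zero] at t1
      have t2 := mul_le_mul_of_nonneg_left t1 (show 0 ≤ 2 * η / N by positivity)
      have t3 : 2 * η / N * (L * ‖mean X - xstar‖ ^ 2)
          = 2 * (L * η * N) / N ^ 2 * ‖mean X - xstar‖ ^ 2 := by field_simp
      have t4 : 2 * (L * η * N) / N ^ 2 ≤ 1 / 2 := by
        have : (2 : ℝ) ^ 2 ≤ N ^ 2 := pow_le_pow_left₀ zero_le_two hN2 2
        rw [div_le_iff₀ (by positivity)]
        linarith
      have t5 := mul_le_mul_of_nonneg_right (t4.trans hq1) (sq_nonneg ‖mean X - xstar‖)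
      have t6 := mul_nonneg hq0.le (mul_nonneg hκ0 (spread_nonneg X))
      simp only [hh, hVdef]
      linarith)
    (by positivity)
    (fun X => by
      -- Here the expansion is exact, with quadratic coefficient `b = 1`.
      have hstep : ∀ g, ‖mean X - g - xstar‖ ^ 2 ≤ ‖mean X - xstar‖ ^ 2
          - inner ℝ ((2 : ℝ) • (mean X - xstar)) g + 1 * ‖g‖ ^ 2 := by
        intro g
        rw [sub_right_comm, norm_sub_sq_real, real_inner_smul_left, one_mul]
      refine (lintegral_lyapunov_interact_le hP hS hV hL.le hn hν0 hκ0 zero_le_one X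
        (φ := fun x => ‖x - xstar‖ ^ 2) (η := η) (fun x => sq_nonneg _) _ hstep).trans
        (ENNReal.ofReal_le_ofReal ?_)
      refine drift_algebra_strongly_convex hN2 hL hℓ hη0 hd' (Nat.cast_nonneg n₀) hm6
        (spread_nonneg X) (hF0 _) (sq_nonneg _) hQ0 hκ
        (sq_norm_gradient_le hL hg hLip hmin (mean X)) (sq_nonneg _) ?_
        (hm ▸ sum_estSq_le hP hS hV hL.le hB hd hν0 hν2 X) (by positivity) hD c1 c2 c3
      rw [real_inner_smul_left]
      exact mul_le_mul_of_nonneg_left (inner_sub_sum_estMean_ge hP hS hV hL.le hn0 hν0 hν2 hℓ.le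
        hci X xstar) zero_le_two)
  have hX := measurable_models hP hS hW η ν x₀
  have hmean : ∀ t, Measurable fun ω => P.meanModel η ν x₀ (fun r => W r ω) t := fun t =>
    continuous_mean.measurable.comp (hX t)
  have hFint : ∀ t, Integrable
      (fun ω => P.obj (P.meanModel η ν x₀ (fun r => W r ω) t) - P.obj xstar) Pr := by
    intro t
    have := (main t).2.1.const_mul (2 * η / N)⁻¹
    refine this.congr (Filter.Eventually.of_forall fun ω => ?_)
    simp only [hh]
    rw [inv_mul_cancel_left₀ (by positivity)]
    rfl
  have hRle : ∀ ω, ‖P.meanModel η ν x₀ (fun r => W r ω) T - xstar‖ ^ 2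
      ≤ V (P.models η ν x₀ (fun r => W r ω) T) := fun ω =>
    le_add_of_nonneg_right (mul_nonneg hκ0 (spread_nonneg _))
  have hRint : Integrable (fun ω => ‖P.meanModel η ν x₀ (fun r => W r ω) T - xstar‖ ^ 2) Pr :=
    (main T).1.mono' (((hmean T).sub_const xstar).norm.pow_const 2).aestronglyMeasurable
      (Filter.Eventually.of_forall fun ω => by
        rw [Real.norm_of_nonneg (sq_nonneg _)]; exact hRle ω)
  have hweight : ∀ t, weight (n₀ + n₁) η ℓ t = (q ^ t)⁻¹ := fun t => rfl
  set S := ∑ t ∈ Finset.Icc 1 T, (q ^ t)⁻¹ with hSdef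
  have hqpos : ∀ t : ℕ, 0 < (q ^ t)⁻¹ := fun t => by positivity
  have hwT : (q ^ T)⁻¹ ≤ S :=
    Finset.single_le_sum (f := fun t => (q ^ t)⁻¹) (fun t _ => (hqpos t).le)
      (Finset.mem_Icc.2 ⟨by omega, le_rfl⟩)
  have hS0 : 0 < S := (hqpos T).trans_le hwT
  have hwS : η * ℓ / (2 * N) * S ≤ (q ^ T)⁻¹ := by
    have := one_sub_mul_sum_inv_pow hq0 T
    rw [← hSdef, hq, sub_sub_cancel, ← hq] at this
    linarith
  -- The step size makes `ηℓT/(2n) = 2 log T`, so the last weight alone is at least `T²`. This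
  -- accounts for the factor `4 log T` in `η`.
  have hST : (T : ℝ) ^ 2 ≤ S := by
    refine le_trans ?_ hwT
    have e1 : q ≤ Real.exp (-(η * ℓ / (2 * N))) := by
      have := Real.add_one_le_exp (-(η * ℓ / (2 * N)))
      rw [hq]; linarith
    have e2 : q ^ T ≤ ((T : ℝ) ^ 2)⁻¹ := by
      calc q ^ T ≤ Real.exp (-(η * ℓ / (2 * N))) ^ T := pow_le_pow_left₀ hq0.le e1 T
        _ = Real.exp (-(2 * Real.log T)) := by
          rw [← Real.exp_nat_mul]
          congr 1
          rw [hη]; field_simp; ring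
        _ = ((T : ℝ) ^ 2)⁻¹ := by
          rw [Real.exp_neg, two_mul, Real.exp_add, Real.exp_log hT0, sq]
    exact (le_inv_comm₀ (by positivity) (by positivity)).1 e2
  have hy : ∀ ω, P.obj (P.weightedMean η ν ℓ x₀ (fun r => W r ω) T) - P.obj xstar
      ≤ ∑ t ∈ Finset.Icc 1 T, (q ^ t)⁻¹ / S *
        (P.obj (P.meanModel η ν x₀ (fun r => W r ω) (t - 1)) - P.obj xstar) := by
    intro ω
    have h1 : ∑ t ∈ Finset.Icc 1 T, (q ^ t)⁻¹ / S = 1 := by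
      rw [← Finset.sum_div, ← hSdef, div_self hS0.ne']
    have := obj_weighted_sum_le hP hS hV hL.le hℓ.le hc (Finset.Icc 1 T)
      (fun t => (q ^ t)⁻¹ / S) (fun t _ => (div_pos (hqpos t) hS0).le) h1
      (fun t => P.meanModel η ν x₀ (fun r => W r ω) (t - 1))
    simp only [mul_sub, Finset.sum_sub_distrib, ← Finset.sum_mul, h1, one_mul]
    exact sub_le_sub_right this _
  have hsumint : Integrable (fun ω => ∑ t ∈ Finset.Icc 1 T, (q ^ t)⁻¹ / S *
      (P.obj (P.meanModel η ν x₀ (fun r => W r ω) (t - 1)) - P.obj xstar)) Pr :=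
    integrable_finsetSum _ fun t _ => (hFint (t - 1)).const_mul _
  have hym : Measurable fun ω => P.obj (P.weightedMean η ν ℓ x₀ (fun r => W r ω) T) := by
    refine (continuous_obj hP hS hV hL.le).measurable.comp ?_
    unfold weightedMean
    exact Finset.measurable_fun_sum _ fun t _ => (hmean (t - 1)).fun_const_smul _
  -- Integrability at the weighted mean follows by domination: the gap is nonnegative, and Jensen
  -- bounds it by integrable gaps.
  have hyint : Integrable
      (fun ω => P.obj (P.weightedMean η ν ℓ x₀ (fun r => W r ω) T) - P.obj xstar) Pr :=
    hsumint.mono' (hym.sub_const _).aestronglyMeasurable (Filter.Eventually.of_forall fun ω => by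
      rw [Real.norm_of_nonneg (hF0 _)]; exact hy ω)
  have hyint' : Integrable
      (fun ω => P.obj (P.weightedMean η ν ℓ x₀ (fun r => W r ω) T)) Pr :=
    (hyint.add (integrable_const (P.obj xstar))).congr
      (Filter.Eventually.of_forall fun ω => sub_add_cancel _ _)
  refine ⟨hyint', hRint, ?_⟩
  have tele := weighted_sum_le_of_drift hq0
    (v := fun t => ∫ ω, V (P.models η ν x₀ (fun r => W r ω) t) ∂Pr)
    (h := fun t => ∫ ω, h (P.models η ν x₀ (fun r => W r ω) t) ∂Pr)
    (fun t => (main t).2.2) T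
  have hinit : ∫ ω, V (P.models η ν x₀ (fun r => W r ω) 0) ∂Pr = ‖x₀ - xstar‖ ^ 2 := by
    simp only [models, hVdef, spread_const hn0, mean_const hn0]
    simp
  rw [hinit, ← hSdef] at tele
  set A := ∑ t ∈ Finset.Icc 1 T, (q ^ t)⁻¹ / S *
    ∫ ω, (P.obj (P.meanModel η ν x₀ (fun r => W r ω) (t - 1)) - P.obj xstar) ∂Pr with hAdef
  have hyA : ∫ ω, (P.obj (P.weightedMean η ν ℓ x₀ (fun r => W r ω) T) - P.obj xstar) ∂Pr ≤ A := by
    refine (integral_mono hyint hsumint hy).trans (le_of_eq ?_)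
    rw [integral_finsetSum _ fun t _ => (hFint (t - 1)).const_mul _]
    simp only [integral_const_mul, hAdef]
  have hAS : ∑ t ∈ Finset.Icc 1 T, (q ^ t)⁻¹ *
      ∫ ω, h (P.models η ν x₀ (fun r => W r ω) (t - 1)) ∂Pr = 2 * η / N * (A * S) := by
    rw [hAdef, Finset.sum_mul, Finset.mul_sum]
    refine Finset.sum_congr rfl fun t _ => ?_
    simp only [hh, integral_const_mul]
    change (q ^ t)⁻¹ * (2 * η / N * ∫ ω,
      (P.obj (P.meanModel η ν x₀ (fun r => W r ω) (t - 1)) - P.obj xstar) ∂Pr) = _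
    field_simp
  have hR := mul_le_mul_of_nonneg_left (integral_mono hRint (main T).1 hRle) (hqpos T).le
  rw [hAS] at tele
  refine (add_le_add_left hyA _).trans ?_
  exact rate_strongly_convex hN2 hd' hT2 hL hℓ hℓL hm6 (Nat.cast_nonneg n₀) (sq_nonneg _) hQ0
    (integral_nonneg fun ω => sq_nonneg _) hη c1 c3 hS0 hwS hST (by linarith)

end Rates

end Problem

end HDO

/-! ### The theorem with explicit universal constants. -/

theorem theorem1 :
    -- Non-convex case: learning rate `η = n / √(dT)` and smoothing parameter `ν = η / √d`.
    (∃ C₀ C : ℝ, 0 < C₀ ∧ 0 < C ∧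
      ∀ (d n₀ n₁ : ℕ) (P : HDO.Problem.{u} d n₀ n₁) (L ς₀ ς₁ : ℝ) (s : Fin (n₀ + n₁) → ℝ)
        (x₀ : HDO.Vec d) (T : ℕ) (n η ν : ℝ)
        (Ω : Type v) [MeasurableSpace Ω] (Pr : Measure Ω) [IsProbabilityMeasure Pr]
        (W : ℕ → Ω → P.Input),
        1 ≤ d → 2 ≤ n₀ + n₁ → n = ((n₀ + n₁ : ℕ) : ℝ) → 0 < L →
        P.WellDefined → P.Smooth L → P.Balanced ς₀ ς₁ → P.BoundedVariance s →
        BddBelow (Set.range P.obj) →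
        C₀ * max (max (L ^ 2 * (d * n₀ + n₁) ^ 2 / (d * n ^ 2)) (n ^ 2 * L ^ 2))
            (max (n ^ 4 * L ^ 2 / d) (n * n₀ ^ 3 * d)) ≤ T →
        η = n / Real.sqrt (d * T) → ν = η / Real.sqrt d →
        P.IsInput Pr W →
        (∀ t < T, Integrable
          (fun ω => ‖gradient P.obj (P.meanModel η ν x₀ (fun r => W r ω) t)‖ ^ 2) Pr) ∧
        (1 / (T : ℝ)) * ∑ t ∈ Finset.range T,
            ∫ ω, ‖gradient P.obj (P.meanModel η ν x₀ (fun r => W r ω) t)‖ ^ 2 ∂Pr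
          ≤ C * ((P.obj x₀ - ⨅ x, P.obj x)
              + L * ((d * n₀ * ς₀ ^ 2 + n₁ * ς₁ ^ 2) / (n * d))
              + L * ((d * n₀ * HDO.sigmaSqZeroth s + n₁ * HDO.sigmaSqFirst s) / (n * d))
              + L ^ 2 * Real.sqrt (n₀ / n)) * Real.sqrt (d / T))
    ∧
    -- Strongly convex case: learning rate `η = 4 n log T / (T ℓ)` and `ν = η / √d`.
    (∃ C₀ C : ℝ, 0 < C₀ ∧ 0 < C ∧
      ∀ (d n₀ n₁ : ℕ) (P : HDO.Problem.{u} d n₀ n₁) (ℓ L ς₀ ς₁ : ℝ) (s : Fin (n₀ + n₁) → ℝ)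
        (x₀ xstar : HDO.Vec d) (T : ℕ) (n η ν : ℝ)
        (Ω : Type v) [MeasurableSpace Ω] (Pr : Measure Ω) [IsProbabilityMeasure Pr]
        (W : ℕ → Ω → P.Input),
        1 ≤ d → 2 ≤ n₀ + n₁ → n = ((n₀ + n₁ : ℕ) : ℝ) → 0 < ℓ → 0 < L →
        P.WellDefined → P.Smooth L → P.Balanced ς₀ ς₁ → P.BoundedVariance s →
        HDO.Problem.StronglyConvex ℓ P.obj →
        (∀ i, HDO.Problem.StronglyConvex ℓ (P.localObj i)) →
        (∀ x, P.obj xstar ≤ P.obj x) →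
        2 ≤ T →
        C₀ * (n * (d + n) * (L + 1) * (1 / ℓ + 1) / ℓ) ≤ T / Real.log T →
        η = 4 * n * Real.log T / (T * ℓ) → ν = η / Real.sqrt d →
        P.IsInput Pr W →
        Integrable (fun ω => P.obj (P.weightedMean η ν ℓ x₀ (fun r => W r ω) T)) Pr ∧
        Integrable (fun ω => ‖P.meanModel η ν x₀ (fun r => W r ω) T - xstar‖ ^ 2) Pr ∧
        ∫ ω, (P.obj (P.weightedMean η ν ℓ x₀ (fun r => W r ω) T) - P.obj xstar) ∂Pr
            + ℓ * (∫ ω, ‖P.meanModel η ν x₀ (fun r => W r ω) T - xstar‖ ^ 2 ∂Pr) / 8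
          ≤ C * (L * ‖x₀ - xstar‖ ^ 2 / (T * Real.log T)
              + Real.log T * (d * n₀ * ς₀ ^ 2 + n₁ * ς₁ ^ 2) / (T * ℓ * n)
              + Real.log T * (d * n₀ * HDO.sigmaSqZeroth s + n₁ * HDO.sigmaSqFirst s)
                  / (T * ℓ * n)
              + Real.log T * (d * n₀) / (T * ℓ * n))) := by
  have hC : 6 ≤ 3 * HDO.Problem.estConst := HDO.six_le_three_mul_estConst
  -- With `m = 3 * estConst`, the factors `112` and `392` are twice the noise coefficients `56` and
  -- `196` of the drift inequalities. Only Gaussian moments enter, so the constants are universal.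
  refine ⟨⟨(112 * (3 * HDO.Problem.estConst)) ^ 2, 112 * (3 * HDO.Problem.estConst) + 6,
    by positivity, by linarith, ?_⟩, ⟨4 * (392 * (3 * HDO.Problem.estConst)),
    392 * (3 * HDO.Problem.estConst) + 8, by linarith, by linarith, ?_⟩⟩
  · intro d n₀ n₁ P L ς₀ ς₁ s x₀ T n η ν Ω _ Pr _ W hd hn hnN hL hP hS hB hV hbdd hT hη hν hW
    subst hnN
    obtain ⟨h1, h2⟩ := HDO.Problem.nonconvex_rate (x₀ := x₀) rfl hd hn hL hP hS hB hV hbdd hT hη hν hW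
    refine ⟨h1, h2.trans (le_of_eq ?_)⟩
    ring
  · intro d n₀ n₁ P ℓ L ς₀ ς₁ s x₀ xstar T n η ν Ω _ Pr _ W hd hn hnN hℓ hL hP hS hB hV hc hci
      hmin hT hTT hη hν hW
    subst hnN
    obtain ⟨h1, h2, h3⟩ := HDO.Problem.strongly_convex_rate (x₀ := x₀) rfl hd hn hℓ hL hP hS hB hV
      hc hci hmin hT hTT hη hν hW
    refine ⟨h1, h2, h3.trans (le_of_eq ?_)⟩
    ring
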